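/- **Setting.** Let $(M,g)$ be a four-dimensional smooth Lorentzian manifold, signature $(-,+,+,+)$, with two commuting Killing vector fields $\kappa_0$ (stationary) and $\kappa_1$. Let $\mathcal G_{ab}=g(\kappa_a,\kappa_b)$, with inverse $\mathcal G^{ab}$; assume that the set of points "off the axis", i.e. where $\det\mathcal G_{ab}<0$, is dense. Let $M$ be foliated by the level sets (slices) of a smooth function $\Omega$ with everywhere spacelike gradient and $\kappa_a(\Omega)=0$; put $\varphi=|\nabla\Omega|^{-1}$, $n=\varphi\nabla\Omega$ (unit normal) and $f'=\varphi\, n^\alpha\nabla_\alpha f$. The slices have compact spatial sections, in the sense that for all values $a\le b$ of $\Omega$ there is a compact set meeting every orbit of the (complete) flow of $\kappa_0$ in $\{a\le\Omega\le b\}$. Let $$K_{\alpha\beta}=\alpha\, g_{\alpha\beta}+\gamma^{ab}\kappa_{a\alpha}\kappa_{b\beta}+e^{\Psi}n_\alpha n_\beta$$ with smooth $\alpha,\gamma^{ab},\Psi$, and $\gamma^{ab}$ constant on each slice. Particles have mass $m\ge 0$ (with $m^2$ smooth) and worldlines $\nabla_{\dot\gamma}\dot\gamma=-\tfrac12\nabla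 (m^2)$, $g(\dot\gamma,\dot\gamma)=-m^2$. Assume that either (i) $K$ is a Killing tensor, $\alpha$ is constant on each slice and $m$ is constant, or (ii) $K$ is a conformal Killing tensor, $\kappa_a(m^2)=0$, and $(e^\Psi m^2)'$ is constant on each slice. **Observer.** A stationary observer sits at a point $O$ off the axis; bars denote values at $O$. It has a velocity $\bar v^a\kappa_a$ with $\bar v=\sqrt{-\bar{\mathcal G}_{ab}\bar v^a\bar v^b}>0$ and detects particles of observed energy $\bar E>\bar m\bar v$. Put $\bar\tau^a=\bar{\mathcal G}^{ab}(-\det\bar{\mathcal G})^{1/2}\epsilon_{bc}\bar v^c$ with $\epsilon_{01}=1$, $m_E^2=\bar v^2m^2/\bar E^2$, and the orthonormal tetrad $\bar e_0=\bar v^a\kappa_a/\bar v$, $\bar e_1=\bar\tau^a\kappa_a/\bar v$, $\bar e_2$, $\bar e_3=-n$. The particle seen at $(\Theta,\Phi)\in[0,\pi]\times[0,2\pi]$ has at $O$ the tangent vector $$\dot\gamma(0)=\tfrac{\bar E}{\bar v}\bar e_0+\sqrt{\tfrac{\bar E^2}{\bar v^2}-\bar m^2}\,(\sin\Phi\sin\Theta\,\bar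 e_1+\cos\Phi\sin\Theta\,\bar e_2+\cos\Theta\,\bar e_3)$$ and conserved quantities $q_a(\Theta,\Phi)=g(\kappa_a,\dot\gamma)$. Put $X=-2\tan(\Theta/2)\sin\Phi$, $Y=-2\tan(\Theta/2)\cos\Phi$ (for $\Theta<\pi$). The shadow matrix is $$\mathcal S^{ab}=e^\Psi\left(\mathcal G^{ab}+m_E^2\,\bar v^a\bar v^b/\bar v^2\right),$$ with value $\overline{\mathcal S}{}^{ab}$ at $O$; in $(\mathcal S^{ab})'$ the observer's quantities are not differentiated. **Definitions.** A slice is a massive particle surface for $q$ if some worldline with conserved quantities $q$ touches it off the axis, and every worldline with conserved quantities $q$ that touches it at some point lies in it entirely. The massive particle region is the set of points at which, for some $(\Theta,\Phi)$, a worldline with conserved quantities $q(\Theta,\Phi)$ touches a slice which is a massive particle surface for $q(\Theta,\Phi)$. A celestial position $(\Theta,\Phi)$ is on the boundary of the shadow (or of the relativistic images) with respect to the slice $\Omega=c$ if this slice is a massive particle surface for $q(\Theta,\Phi)$ and the worldline of the particle is defined for all $s\le 0$ (or all $s\ge0$) and satisfies $\Omega(\gamma(s))\to c$, $g(n,\dot\gamma(s))\to0$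 as $s\to-\infty$ (respectively $s\to+\infty$). An impact vector at a point $x$ is $\rho\neq0$ with, at $x$, $$(\mathcal S^{ab})'\rho_a\rho_b=0,\qquad \mathcal S^{ab}\rho_a\rho_b\le0,\qquad (\bar\tau^a\rho_a)^2\le(1-\bar m_E^2)(\bar v^a\rho_a)^2 ;$$ the last inequality says $|\sin\Phi\sin\Theta|\le1$ for the expression of $\sin\Phi\sin\Theta$ in (A). **Claim.** (1) A point $x$ off the axis belongs to the massive particle region if and only if there is an impact vector at $x$. Now let $t\mapsto p(t)$ be the integral curve of $\varphi n$ on an open interval $J\ni\bar\Omega$, $p(\bar\Omega)=O$. (2) For every $t\in J$, $p(t)$ is off the axis and lies on the slice $\Omega=t$. (3) Let $c\in J$ and let $(\Theta,\Phi)$ be on the boundary with respect to the slice $\Omega=c$. Then there are an impact vector $\rho$ at $p(c)$ and a sign $\varepsilon=\pm1$ such that, with $\mathcal S^{ab}$ taken at $p(c)$, $(\mathcal S^{ab}-\overline{\mathcal S}{}^{ab})\rho_a\rho_b\ge0$, $q_a=-\bar E\rho_a/(\bar v^b\rho_b)$, and $$\text{(A)}\quad \cos\Theta=\varepsilon\frac{\bar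 v e^{-\bar\Psi/2}\sqrt{(\mathcal S^{ab}-\overline{\mathcal S}{}^{ab})\rho_a\rho_b}}{\sqrt{1-\bar m_E^2}\,\bar v^c\rho_c},\qquad \sin\Phi\sin\Theta=-\frac{\bar\tau^a\rho_a}{\sqrt{1-\bar m_E^2}\,\bar v^b\rho_b};$$ if moreover $\Theta\ne\pi$, then for some sign $\delta=\pm1$ $$\text{(B)}\quad X=\frac{2\bar\tau^a\rho_a}{D},\quad Y=\delta\frac{2\bar v e^{-\bar\Psi/2}\sqrt{-\mathcal S^{ab}\rho_a\rho_b}}{D},\quad D=\sqrt{1-\bar m_E^2}\,\bar v^a\rho_a+\varepsilon\,\bar v e^{-\bar\Psi/2}\sqrt{(\mathcal S^{ab}-\overline{\mathcal S}{}^{ab})\rho_a\rho_b}\neq0 .$$ (4) Conversely, let $c\in J$, $\varepsilon=\pm1$, and let $\rho$ be an impact vector at $p(c)$ with $(\mathcal S^{ab}-\overline{\mathcal S}{}^{ab})\rho_a\rho_b\ge0$. Then the points $(X,Y)$ given by (B) with $\delta=\pm1$ and $D\ne0$ are exactly the stereographic images of the $(\Theta,\Phi)$, $\Theta<\pi$,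 given by (A). For every $(\Theta,\Phi)$ given by (A), $q_a(\Theta,\Phi)=-\bar E\rho_a/(\bar v^b\rho_b)$ and the slice $\Omega=c$ is a massive particle surface for $q(\Theta,\Phi)$. If moreover $c\ne\bar\Omega$, no turning point shields the slice, i.e. $\mathcal S^{ab}(p(t))\rho_a\rho_b<\mathcal S^{ab}(p(c))\rho_a\rho_b$ for all $t\ne c$ in the closed interval between $c$ and $\bar\Omega$, and the worldline of the particle is defined for all $s\le0$ with $(\bar\Omega-c)\cos\Theta<0$ (or for all $s\ge0$ with $(\bar\Omega-c)\cos\Theta>0$), then it is asymptotically tangent to the slice as $s\to-\infty$ (respectively $s\to+\infty$), and $(\Theta,\Phi)$ is on the boundary with respect to the slice $\Omega=c$. -/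

import Mathlib

open scoped Manifold ContDiff Matrix Topology
open Set Filter

noncomputable section

namespace ShadowGeometry

/-! ## Lorentzian geometry on a four-dimensional manifold -/

/-- The model space of a four-dimensional manifold. -/
abbrev E4 : Type := EuclideanSpace ℝ (Fin 4)

section Manifold

variable {M : Type*} [TopologicalSpace M] [ChartedSpace E4 M]

/-- The tangent space of `M` at `x`. -/
abbrev T (x : M) : Type := TangentSpace (𝓡 4) x

/-- The differential of a real function, as a covector. -/
def diff (f : M → ℝ) (x : M) : T x →L[ℝ] ℝ := mfderiv (𝓡 4) 𝓘(ℝ, ℝ) f x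

/-- The velocity of a curve. -/
def velocity (γ : ℝ → M) (s : ℝ) : T (γ s) :=
  mfderiv 𝓘(ℝ, ℝ) (𝓡 4) γ s (1 : ℝ)

variable [IsManifold (𝓡 4) ∞ M]

/-- A smooth field of bilinear forms (a smooth covariant 2-tensor field). -/
def SmoothTensor (B : ∀ x : M, T x →L[ℝ] T x →L[ℝ] ℝ) : Prop :=
  ContMDiff (𝓡 4) ((𝓡 4).prod 𝓘(ℝ, E4 →L[ℝ] E4 →L[ℝ] ℝ)) ∞
    (fun x ↦ Bundle.TotalSpace.mk' (E4 →L[ℝ] E4 →L[ℝ] ℝ)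
      (E := fun x : M ↦ (T x →L[ℝ] T x →L[ℝ] ℝ)) x (B x))

/-- A smooth vector field. -/
def SmoothVectorField (X : ∀ x : M, T x) : Prop :=
  ContMDiff (𝓡 4) (𝓡 4).tangent ∞ (fun x ↦ (⟨x, X x⟩ : TangentBundle (𝓡 4) M))

variable (M) in
/-- A smooth Lorentzian metric of signature `(-,+,+,+)`. -/
structure LorentzMetric where
  /-- the metric at a point -/
  val : ∀ x : M, T x →L[ℝ] T x →L[ℝ] ℝ
  symm : ∀ x v w, val x v w = val x w v
  signature : ∀ x, ∃ e : Module.Basis (Fin 4) ℝ (T x), ∀ i j,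
    val x (e i) (e j) = if i = j then (if i = 0 then -1 else 1) else 0
  smooth : SmoothTensor val

/-- The components, in the chart around `x₀`, of a field of bilinear forms: its pullback by the
inverse of the chart. -/
def coordTensor (B : ∀ x : M, T x →L[ℝ] T x →L[ℝ] ℝ) (x₀ : M) (y : E4) :
    E4 →L[ℝ] E4 →L[ℝ] ℝ :=
  let D : E4 →L[ℝ] T ((extChartAt (𝓡 4) x₀).symm y) :=
    mfderiv 𝓘(ℝ, E4) (𝓡 4) (extChartAt (𝓡 4) x₀).symm y
  ((ContinuousLinearMap.precomp ℝ D).comp (B ((extChartAt (𝓡 4) x₀).symm y))).comp D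

/-- The components of a tangent vector at `x`, in the chart around `x₀`. -/
def coordVec (x₀ x : M) : T x →L[ℝ] E4 :=
  mfderiv (𝓡 4) 𝓘(ℝ, E4) (extChartAt (𝓡 4) x₀) x

/-- The components of a vector field in the chart around `x₀`. -/
def coordField (X : ∀ x : M, T x) (x₀ : M) (y : E4) : E4 :=
  coordVec x₀ ((extChartAt (𝓡 4) x₀).symm y) (X ((extChartAt (𝓡 4) x₀).symm y))

/-- The tangent vector at `x` with the given components in the chart around `x`. -/
def ofCoord (x : M) (v : E4) : T x :=
  (coordVec x x).inverse v

/-- Christoffel symbols (of the second kind) of a metric `G` on the coordinate space: the vector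
`Γ(u,v)` with `G(Γ(u,v), w) = (∂_u G(v,w) + ∂_v G(u,w) - ∂_w G(u,v)) / 2` for all `w`. -/
def christoffel (G : E4 → E4 →L[ℝ] E4 →L[ℝ] ℝ) (y u v : E4) : E4 :=
  (G y).inverse ((1 / 2 : ℝ) •
    (fderiv ℝ G y u v + fderiv ℝ G y v u - ((fderiv ℝ G y).flip u).flip v))

namespace LorentzMetric

variable (g : LorentzMetric M)

/-- Christoffel symbols of `g` at `x`, in the chart around `x`. -/
def Γ (x : M) (u v : E4) : E4 :=
  christoffel (coordTensor g.val x) (extChartAt (𝓡 4) x x) u v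

/-- The Levi-Civita covariant derivative `∇_v X` of a vector field. -/
def covDeriv (X : ∀ x : M, T x) (x : M) (v : T x) : T x :=
  ofCoord x (fderiv ℝ (coordField X x) (extChartAt (𝓡 4) x x) (coordVec x x v)
    + g.Γ x (coordVec x x v) (coordVec x x (X x)))

/-- The Levi-Civita covariant derivative `(∇_u K)(v, w)` of a covariant 2-tensor field. -/
def covDerivTensor (K : ∀ x : M, T x →L[ℝ] T x →L[ℝ] ℝ) (x : M) (u v w : T x) : ℝ :=
  let y := extChartAt (𝓡 4) x x
  let u' := coordVec x x u
  let v' := coordVec x x v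
  let w' := coordVec x x w
  fderiv ℝ (coordTensor K x) y u' v' w'
    - coordTensor K x y (g.Γ x u' v') w' - coordTensor K x y v' (g.Γ x u' w')

/-- The covariant acceleration `∇_γ̇ γ̇` of a curve. -/
def acceleration (γ : ℝ → M) (s : ℝ) : T (γ s) :=
  ofCoord (γ s) (iteratedDeriv 2 (fun t ↦ extChartAt (𝓡 4) (γ s) (γ t)) s
    + g.Γ (γ s) (coordVec (γ s) (γ s) (velocity γ s)) (coordVec (γ s) (γ s) (velocity γ s)))

/-- The gradient `∇^α f`. -/
def grad (f : M → ℝ) (x : M) : T x := (g.val x).inverse (diff f x)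

/-- A Killing vector field: `∇_(α X_β) = 0`. -/
def IsKilling (X : ∀ x : M, T x) : Prop :=
  SmoothVectorField X ∧ ∀ x v, g.val x (g.covDeriv X x v) v = 0

/-- A conformal Killing tensor of rank two: `∇_(α K_βγ) = β_(α g_βγ)` for some covector
field `β` (stated in the equivalent polarized form). -/
def IsConformalKillingTensor (K : ∀ x : M, T x →L[ℝ] T x →L[ℝ] ℝ) : Prop :=
  SmoothTensor K ∧ (∀ x v w, K x v w = K x w v) ∧
    ∃ β : ∀ x : M, T x →L[ℝ] ℝ, ∀ x v, g.covDerivTensor K x v v v = β x v * g.val x v v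

/-- An exact Killing tensor of rank two: `∇_(α K_βγ) = 0`. -/
def IsKillingTensor (K : ∀ x : M, T x →L[ℝ] T x →L[ℝ] ℝ) : Prop :=
  SmoothTensor K ∧ (∀ x v w, K x v w = K x w v) ∧ ∀ x v, g.covDerivTensor K x v v v = 0

/-- `γ` is, on the open interval `I`, the worldline of a particle of (position dependent) mass `m`:
`∇_γ̇ γ̇ = -(1/2) ∇(m²)` (that is `-m ∇m`) and `g(γ̇, γ̇) = -m²`. -/
structure IsWorldline (m : M → ℝ) (γ : ℝ → M) (I : Set ℝ) : Prop where
  isOpen : IsOpen I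
  ordConnected : I.OrdConnected
  smooth : ContMDiffOn 𝓘(ℝ, ℝ) (𝓡 4) 2 γ I
  motion : ∀ s ∈ I, g.acceleration γ s = -(1 / 2 : ℝ) • g.grad (fun x ↦ m x ^ 2) (γ s)
  norm : ∀ s ∈ I, g.val (γ s) (velocity γ s) (velocity γ s) = -(m (γ s)) ^ 2

end LorentzMetric

/-! ## Stationary axisymmetric spacetimes, foliations, Killing tensors -/

variable (M) in
/-- A stationary axisymmetric spacetime: a Lorentzian metric with two commuting Killing vector
fields `κ 0` (the stationary one) and `κ 1`, whose Gram matrix is invertible with signature `(-+)`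
away from a closed set with empty interior (the axis). -/
structure AxiStationary where
  /-- the metric -/
  g : LorentzMetric M
  /-- the Killing vector fields -/
  κ : Fin 2 → ∀ x : M, T x
  killing : ∀ a, g.IsKilling (κ a)
  commute : ∀ x, VectorField.mlieBracket (𝓡 4) (κ 0) (κ 1) x = 0
  dense_offAxis :
    Dense {x : M | (Matrix.of fun a b ↦ g.val x (κ a x) (κ b x) : Matrix (Fin 2) (Fin 2) ℝ).det < 0}

namespace AxiStationary

variable (S : AxiStationary M)

/-- The Gram matrix `G_ab` of the Killing vectors; the matrix `G^ab` is its inverse. -/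
def gram (x : M) : Matrix (Fin 2) (Fin 2) ℝ :=
  Matrix.of fun a b ↦ S.g.val x (S.κ a x) (S.κ b x)

/-- The Gram matrix at `x` is invertible of signature `(-+)`. -/
def OffAxis (x : M) : Prop := (S.gram x).det < 0

end AxiStationary

/-- A foliation by the level sets ("slices") of a smooth function `Ω` (the foliation parameter)
with everywhere spacelike gradient, all the Killing vectors being tangent to the slices. -/
structure Foliation (S : AxiStationary M) where
  /-- the foliation parameter -/
  Ω : M → ℝ
  smooth : ContMDiff (𝓡 4) 𝓘(ℝ, ℝ) ∞ Ω
  spacelike : ∀ x, 0 < S.g.val x (S.g.grad Ω x) (S.g.grad Ω x)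
  tangent : ∀ a x, diff Ω x (S.κ a x) = 0

namespace Foliation

variable {S : AxiStationary M} (F : Foliation S)

/-- The slice on which the foliation parameter equals `c`. -/
def slice (c : ℝ) : Set M := {x | F.Ω x = c}

/-- The lapse function `φ`. -/
def lapse (x : M) : ℝ := (√(S.g.val x (S.g.grad F.Ω x) (S.g.grad F.Ω x)))⁻¹

/-- The outer unit normal `n` of the slices. -/
def normal (x : M) : T x := F.lapse x • S.g.grad F.Ω x

/-- The vector field `φ n`, along which the foliation parameter has unit rate. -/
def flow (x : M) : T x := F.lapse x • F.normal x

/-- The derivative `f' = φ n^α ∇_α f` with respect to the foliation parameter. -/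
def prime (f : M → ℝ) (x : M) : ℝ := diff f x (F.flow x)

/-- `f` is constant on each slice. -/
def SliceConstant (f : M → ℝ) : Prop := ∀ x y, F.Ω x = F.Ω y → f x = f y

/-- The slices have compact spatial sections: every closed shell between two slices (in particular
every slice) is swept out by the orbits of the stationary Killing vector field that meet some
compact set. -/
def CompactSections : Prop :=
  ∀ a ∈ range F.Ω, ∀ b ∈ range F.Ω, ∃ C : Set M, IsCompact C ∧
    ∀ x, F.Ω x ∈ Icc a b → ∃ σ : ℝ → M, IsMIntegralCurve σ (S.κ 0) ∧ σ 0 = x ∧ ∃ t, σ t ∈ C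

/-- The tensor `K` has the slice-reducible form
`K_αβ = α g_αβ + γ^ab κ_aα κ_bβ + e^Ψ n_α n_β`, with `γ^ab` constant on each slice. -/
structure IsSliceReducible (K : ∀ x : M, T x →L[ℝ] T x →L[ℝ] ℝ) (α : M → ℝ)
    (γ : Fin 2 → Fin 2 → M → ℝ) (Ψ : M → ℝ) : Prop where
  smooth_α : ContMDiff (𝓡 4) 𝓘(ℝ, ℝ) ∞ α
  smooth_γ : ∀ a b, ContMDiff (𝓡 4) 𝓘(ℝ, ℝ) ∞ (γ a b)
  smooth_Ψ : ContMDiff (𝓡 4) 𝓘(ℝ, ℝ) ∞ Ψ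
  const_γ : ∀ a b, F.SliceConstant (γ a b)
  form : ∀ x v w, K x v w = α x * S.g.val x v w
    + ∑ a, ∑ b, γ a b x * S.g.val x (S.κ a x) v * S.g.val x (S.κ b x) w
    + Real.exp (Ψ x) * S.g.val x (F.normal x) v * S.g.val x (F.normal x) w

/-- The dynamics of particles of mass `m` is integrable through the slice-reducible tensor `K`:
either `K` is an exact Killing tensor, `α` also being constant on each slice, and the mass is
constant; or `K` is a conformal Killing tensor, the mass is invariant under the Killing vectors
and `(e^Ψ m²)'` is constant on each slice. -/
def Integrable (K : ∀ x : M, T x →L[ℝ] T x →L[ℝ] ℝ) (α Ψ m : M → ℝ) : Prop :=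
  (S.g.IsKillingTensor K ∧ F.SliceConstant α ∧ ∀ x y, m x = m y) ∨
  (S.g.IsConformalKillingTensor K ∧ (∀ a x, diff (fun z ↦ m z ^ 2) x (S.κ a x) = 0) ∧
    F.SliceConstant (F.prime fun x ↦ Real.exp (Ψ x) * m x ^ 2))

/-- The worldlines (of particles of mass `m`) touching the slice `c` and having conserved quantities
`g(κ_a, γ̇) = q_a`: `γ` is such a worldline on `I`, touching the slice at the parameter `s`. -/
structure Touches (m : M → ℝ) (c : ℝ) (q : Fin 2 → ℝ) (γ : ℝ → M) (I : Set ℝ) (s : ℝ) :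
    Prop where
  worldline : S.g.IsWorldline m γ I
  mem : s ∈ I
  conserved : ∀ a, S.g.val (γ s) (S.κ a (γ s)) (velocity γ s) = q a
  on_slice : γ s ∈ F.slice c
  tangent : diff F.Ω (γ s) (velocity γ s) = 0

/-- The slice `c` is a massive particle surface for the conserved quantities `q`: some worldline
with these conserved quantities touches it (off the axis), and every worldline with these conserved
quantities that touches it at least at one point belongs to it entirely. -/
def IsMassiveParticleSurface (m : M → ℝ) (c : ℝ) (q : Fin 2 → ℝ) : Prop :=
  (∃ γ I s, F.Touches m c q γ I s ∧ S.OffAxis (γ s)) ∧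
  ∀ γ I s, F.Touches m c q γ I s → ∀ t ∈ I, γ t ∈ F.slice c

/-- Along the filter `l` of parameter values (`atBot` or `atTop`), the curve `γ` becomes
asymptotically tangent to the slice `c`. -/
def AsymptoticallyTangent (γ : ℝ → M) (c : ℝ) (l : Filter ℝ) : Prop :=
  Tendsto (fun s ↦ F.Ω (γ s)) l (𝓝 c) ∧
  Tendsto (fun s ↦ S.g.val (γ s) (F.normal (γ s)) (velocity γ s)) l (𝓝 0)

end Foliation

/-! ## Observers, celestial sphere, shadow matrix -/

/-- The value `A^ab ρ_a ρ_b` of a quadratic form. -/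
def quad (A : Matrix (Fin 2) (Fin 2) ℝ) (ρ : Fin 2 → ℝ) : ℝ := ρ ⬝ᵥ (A *ᵥ ρ)

/-- A stationary observer: a point `pt` off the axis and a timelike combination `v^a κ_a` of the
Killing vectors, together with the energy `E` at which it detects particles of mass `m`
(`E > v̄ m̄`, that is `m̄_E < 1`) and the tetrad vector `e₂`, which completes `e₀`, `e₁`
(in the span of the Killing vectors) and the normal to an orthonormal tetrad. -/
structure Observer {S : AxiStationary M} (F : Foliation S) (m : M → ℝ) where
  /-- the position `O` of the observer -/
  pt : M
  /-- the components `v̄^a` -/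
  v : Fin 2 → ℝ
  /-- the observed energy -/
  E : ℝ
  /-- the tetrad vector `e₂` -/
  e₂ : T pt
  offAxis : S.OffAxis pt
  timelike : quad (S.gram pt) v < 0
  energy : √(-quad (S.gram pt) v) * m pt < E
  e₂_norm : S.g.val pt e₂ e₂ = 1
  e₂_killing : ∀ a, S.g.val pt (S.κ a pt) e₂ = 0
  e₂_normal : S.g.val pt (F.normal pt) e₂ = 0

namespace Observer

variable {S : AxiStationary M} {F : Foliation S} {m : M → ℝ} (O : Observer F m)

/-- `v̄ = √(-G_ab v̄^a v̄^b)` at the observer. -/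
def speed : ℝ := √(-quad (S.gram O.pt) O.v)

/-- `τ̄^a = G^ab E_bc v̄^c` at the observer, with `E_ab = √(-det G) ε_ab` and `ε_01 = 1`. -/
def τ : Fin 2 → ℝ :=
  (S.gram O.pt)⁻¹ *ᵥ ((√(-(S.gram O.pt).det) • !![0, 1; -1, 0]) *ᵥ O.v)

/-- `m_E² = v̄² m² / E²`, as a function of the position of the particle. -/
def mE2 (x : M) : ℝ := O.speed ^ 2 * m x ^ 2 / O.E ^ 2

/-- The tetrad vector `e₀ = v̄^a κ_a / v̄`. -/
def e₀ : T O.pt := O.speed⁻¹ • ∑ a, O.v a • S.κ a O.pt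

/-- The tetrad vector `e₁ = τ̄^a κ_a / v̄`. -/
def e₁ : T O.pt := O.speed⁻¹ • ∑ a, O.τ a • S.κ a O.pt

/-- The tetrad vector `e₃ = -n`, the zenith. -/
def e₃ : T O.pt := -F.normal O.pt

/-- The tangent vector at the observer of a captured particle with celestial coordinates
`(Θ, Φ)`. -/
def ray (Θ Φ : ℝ) : T O.pt :=
  (O.E / O.speed) • O.e₀ + √((O.E / O.speed) ^ 2 - m O.pt ^ 2) •
    ((Real.sin Φ * Real.sin Θ) • O.e₁ + (Real.cos Φ * Real.sin Θ) • O.e₂ + Real.cos Θ • O.e₃)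

/-- The conserved quantities `q_a = κ_aα γ̇^α` of a captured particle. -/
def q (Θ Φ : ℝ) (a : Fin 2) : ℝ := S.g.val O.pt (S.κ a O.pt) (O.ray Θ Φ)

/-- `γ`, on `I ∋ 0`, is the worldline of the particle captured by the observer at the parameter
`0`, with celestial coordinates `(Θ, Φ)`. -/
structure IsCaptured (Θ Φ : ℝ) (γ : ℝ → M) (I : Set ℝ) : Prop where
  worldline : S.g.IsWorldline m γ I
  zero_mem : (0 : ℝ) ∈ I
  init_pt : γ 0 = O.pt
  init_velocity : (⟨γ 0, velocity γ 0⟩ : TangentBundle (𝓡 4) M) = ⟨O.pt, O.ray Θ Φ⟩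

/-- The celestial position `(Θ, Φ)` lies on the boundary of the shadow (or of the relativistic
images), with respect to the slice `c`: the slice is a massive particle surface for the conserved
quantities of the captured particle, and the worldline of the particle is, in one of the two
directions of the affine parameter, asymptotically tangent to the slice. -/
def IsBoundary (c Θ Φ : ℝ) : Prop :=
  F.IsMassiveParticleSurface m c (O.q Θ Φ) ∧
  ∃ γ I, O.IsCaptured Θ Φ γ I ∧
    ((Iic 0 ⊆ I ∧ F.AsymptoticallyTangent γ c atBot) ∨
     (Ici 0 ⊆ I ∧ F.AsymptoticallyTangent γ c atTop))

/-- The massive particle region: the union, over the slices and over all `(Θ, Φ)`, of the parts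
of the slices which are massive particle surfaces for the conserved quantities `q(Θ, Φ)`
(the points of the slice touched by worldlines with these conserved quantities). -/
def massiveParticleRegion : Set M :=
  {x | ∃ Θ ∈ Icc 0 Real.pi, ∃ Φ ∈ Icc 0 (2 * Real.pi), ∃ c,
    F.IsMassiveParticleSurface m c (O.q Θ Φ) ∧
    ∃ γ I s, F.Touches m c (O.q Θ Φ) γ I s ∧ γ s = x}

/-- The shadow matrix `S^ab = e^Ψ (G^ab + m_E² v̄^a v̄^b / v̄²)`. -/
def shadowMatrix (Ψ : M → ℝ) (x : M) : Matrix (Fin 2) (Fin 2) ℝ :=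
  Real.exp (Ψ x) • ((S.gram x)⁻¹ + (O.mE2 x / O.speed ^ 2) • Matrix.vecMulVec O.v O.v)

/-- The derivative `(S^ab)'` of the shadow matrix with respect to the foliation parameter. -/
def shadowMatrix' (Ψ : M → ℝ) (x : M) : Matrix (Fin 2) (Fin 2) ℝ :=
  Matrix.of fun a b ↦ F.prime (fun z ↦ O.shadowMatrix Ψ z a b) x

/-- `ρ` is an impact vector at the point `x`: a nontrivial solution of `(S^ab)' ρ_a ρ_b = 0` with
`S^ab ρ_a ρ_b ≤ 0` and `(τ̄^a ρ_a)² ≤ (1 - m̄_E²) (v̄^a ρ_a)²`; the last inequality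
is `|sin Φ sin Θ| ≤ 1`. -/
structure IsImpact (Ψ : M → ℝ) (x : M) (ρ : Fin 2 → ℝ) : Prop where
  ne_zero : ρ ≠ 0
  critical : quad (O.shadowMatrix' Ψ x) ρ = 0
  nonpos : quad (O.shadowMatrix Ψ x) ρ ≤ 0
  sines : (O.τ ⬝ᵥ ρ) ^ 2 ≤ (1 - O.mE2 O.pt) * (O.v ⬝ᵥ ρ) ^ 2

/-- `v̄ e^(-Ψ̄/2) √((S^ab - S̄^ab) ρ_a ρ_b)`, with `S^ab` taken at `x` and `S̄^ab` at the
observer. -/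
def rootA (Ψ : M → ℝ) (x : M) (ρ : Fin 2 → ℝ) : ℝ :=
  O.speed * Real.exp (-Ψ O.pt / 2) *
    √(quad (O.shadowMatrix Ψ x - O.shadowMatrix Ψ O.pt) ρ)

/-- `v̄ e^(-Ψ̄/2) √(-S^ab ρ_a ρ_b)`, with `S^ab` taken at `x`. -/
def rootB (Ψ : M → ℝ) (x : M) (ρ : Fin 2 → ℝ) : ℝ :=
  O.speed * Real.exp (-Ψ O.pt / 2) * √(-quad (O.shadowMatrix Ψ x) ρ)

/-- The formula for the celestial coordinates of the boundary, with the sign `ε`. -/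
def AngleFormula (Ψ : M → ℝ) (x : M) (ρ : Fin 2 → ℝ) (ε Θ Φ : ℝ) : Prop :=
  Real.cos Θ = ε * O.rootA Ψ x ρ / (√(1 - O.mE2 O.pt) * (O.v ⬝ᵥ ρ)) ∧
  Real.sin Φ * Real.sin Θ = -(O.τ ⬝ᵥ ρ) / (√(1 - O.mE2 O.pt) * (O.v ⬝ᵥ ρ))

/-- The denominator in the formula for the stereographic coordinates, with the sign `ε`. -/
def denom (Ψ : M → ℝ) (x : M) (ρ : Fin 2 → ℝ) (ε : ℝ) : ℝ :=
  √(1 - O.mE2 O.pt) * (O.v ⬝ᵥ ρ) + ε * O.rootA Ψ x ρ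

/-- The formula for the stereographic coordinates of the boundary, with the sign `ε` in the
denominator and the sign `δ` in front of the fraction for `Y`. -/
def StereoFormula (Ψ : M → ℝ) (x : M) (ρ : Fin 2 → ℝ) (ε δ X Y : ℝ) : Prop :=
  O.denom Ψ x ρ ε ≠ 0 ∧
  X = 2 * (O.τ ⬝ᵥ ρ) / O.denom Ψ x ρ ε ∧
  Y = δ * (2 * O.rootB Ψ x ρ / O.denom Ψ x ρ ε)

end Observer

end Manifold

/-- The stereographic coordinate `X = -2 tan(Θ/2) sin Φ`. -/
def stereoX (Θ Φ : ℝ) : ℝ := -2 * Real.tan (Θ / 2) * Real.sin Φ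

/-- The stereographic coordinate `Y = -2 tan(Θ/2) cos Φ`. -/
def stereoY (Θ Φ : ℝ) : ℝ := -2 * Real.tan (Θ / 2) * Real.cos Φ

end ShadowGeometry

end

noncomputable section

namespace ShadowGeometry

/-! ### Smooth tensors and vector fields read in charts -/

section

variable {M : Type*} [TopologicalSpace M] [ChartedSpace E4 M]

/-! The slice-reducible tensor turns the motion across the slices into a one-dimensional problem for
`Ω`. Along a worldline the Killing momenta `q` are conserved. What is left of `K(γ̇,γ̇)`, after
removing the `α` and `γ^ab` terms, is `kinetic = e^Ψ g(n,γ̇)²`. Its derivative is `-dΩ(γ̇)` times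
`force = (γ^ab)' q_a q_b + (e^Ψ m²)'`, which depends only on the value of `Ω` (`hasDerivAt_kinetic`,
`force_const`). This rests on solving the conformal Killing equation: polarization in tangent and
normal directions gives `β = dα + (e^Ψ)' dΩ` (`conformal_eq`). Dividing by `dΩ` then leaves a
quadratic identity that relates the Hessian of `Ω` to `γ'` and `Ψ` (`quadratic_identity`).

On combinations of Killing vectors this identity reads `(e^Ψ G^ab)' = (γ^ab)'` (`prime_gram`).
Hence, for covectors normalized by `v̄^a q_a = -Ē`, the value of `(S^ab)' q_a q_b` is exactly the
force (`quad_shadowMatrix'_eq_force`).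

A slice touched off the axis by a worldline with momenta `q` is a massive particle surface if and
only if the force vanishes on it. If a worldline lies in the slice, differentiating `dΩ(γ̇) = 0` and
inserting the identity gives zero force. If the force vanishes, Grönwall's inequality for `kinetic +
(Ω - c)²` keeps tangent worldlines in the slice. A tangent worldline through a point off the axis
exists precisely when `G^ab q_a q_b ≤ -m²`, that is `S^ab q_a q_b ≤ 0`, because the orthogonal
complement of the Killing vectors is spacelike there. The third condition on an impact vector says
that `q` is realized by some celestial direction. This is the description of the massive particle
region.

Along the normal curve `p` the determinant of the Gram matrix solves a linear differential equation,
so it keeps its sign. Moreover `S^ab(p(t)) q_a q_b` is a potential of the force, so its sum with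
`kinetic` is conserved (`IsCaptured.kinetic_eq`). At the observer both terms are explicit in `Θ` and
`Φ`; asymptotic tangency makes `kinetic` tend to zero, which yields the formulas (A). The formulas
(B) follow because the two square roots and `τ̄^a ρ_a` lie on a sphere of radius `√(1 - m̄_E²) |v̄^a
ρ_a|`.

For the converse, the absence of shielding makes `kinetic` positive all the way to the slice. The
particle cannot turn around, and it cannot arrive in finite parameter: it would arrive tangentially
and so would always have been in the slice (`tendsto_zero_of_energy`, `IsCaptured.tendsto`). Compact
sections bound `weight`, `e^Ψ` and `e^(-Ψ)` on shells, since these are invariant under the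
stationary Killing field. -/

theorem isOpen_chart_target (x₀ : M) : IsOpen (extChartAt (𝓡 4) x₀).target :=
  isOpen_extChartAt_target x₀

variable [IsManifold (𝓡 4) ∞ M]

/-- The differential of the inverse chart, i.e. the coordinate frame. -/
def chartFrame (x₀ : M) (y : E4) : E4 →L[ℝ] T ((extChartAt (𝓡 4) x₀).symm y) :=
  mfderiv 𝓘(ℝ, E4) (𝓡 4) (extChartAt (𝓡 4) x₀).symm y

theorem coordTensor_apply (B : ∀ x : M, T x →L[ℝ] T x →L[ℝ] ℝ) (x₀ : M) (y u v : E4) :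
    coordTensor B x₀ y u v = B _ (chartFrame x₀ y u) (chartFrame x₀ y v) := rfl

theorem isManifold_one : IsManifold (𝓡 4) 1 M := .of_le (n := ∞) (by simp)

theorem coordVec_chartFrame {x₀ : M} {y : E4} (hy : y ∈ (extChartAt (𝓡 4) x₀).target) (u : E4) :
    coordVec x₀ _ (chartFrame x₀ y u) = u := by
  have : IsManifold (𝓡 4) 1 M := isManifold_one
  have := mfderiv_extChartAt_comp_mfderivWithin_extChartAt_symm (I := 𝓡 4) hy
  simp only [modelWithCornersSelf_coe, range_id, mfderivWithin_univ] at this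
  exact congrArg (fun f : E4 →L[ℝ] E4 ↦ f u) this

theorem chartFrame_coordVec {x₀ : M} {y : E4} (hy : y ∈ (extChartAt (𝓡 4) x₀).target)
    (v : T ((extChartAt (𝓡 4) x₀).symm y)) :
    chartFrame x₀ y (coordVec x₀ _ v) = v := by
  have : IsManifold (𝓡 4) 1 M := isManifold_one
  have := mfderivWithin_extChartAt_symm_comp_mfderiv_extChartAt (I := 𝓡 4) hy
  simp only [modelWithCornersSelf_coe, range_id, mfderivWithin_univ] at this
  exact congrArg (fun f : E4 →L[ℝ] E4 ↦ f v) this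

/-- A tangent vector at `x` is represented in the preferred chart at `x`, so this chart has identity
derivative there. -/
theorem coordVec_self (x : M) (v : T x) : coordVec x x v = v := by
  have : IsManifold (𝓡 4) 1 M := isManifold_one
  unfold coordVec
  rw [mfderiv_extChartAt_self]; rfl

theorem ofCoord_self (x : M) (v : E4) : ofCoord x v = v := by
  have : IsManifold (𝓡 4) 1 M := isManifold_one
  unfold ofCoord coordVec
  rw [mfderiv_extChartAt_self]
  exact congrArg (fun f : E4 →L[ℝ] E4 ↦ f v) (ContinuousLinearMap.inverse_id (R := ℝ) (M := E4))

theorem tensor_eq_coordTensor (B : ∀ x : M, T x →L[ℝ] T x →L[ℝ] ℝ) {x₀ x : M}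
    (hx : x ∈ (extChartAt (𝓡 4) x₀).source) (v w : T x) :
    B x v w = coordTensor B x₀ (extChartAt (𝓡 4) x₀ x) (coordVec x₀ x v) (coordVec x₀ x w) := by
  obtain ⟨y, hy, rfl⟩ : ∃ y ∈ (extChartAt (𝓡 4) x₀).target, (extChartAt (𝓡 4) x₀).symm y = x :=
    ⟨_, (extChartAt (𝓡 4) x₀).map_source hx, (extChartAt (𝓡 4) x₀).left_inv hx⟩
  rw [(extChartAt (𝓡 4) x₀).right_inv hy, coordTensor_apply, chartFrame_coordVec hy,
    chartFrame_coordVec hy]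

theorem coordVec_field {X : ∀ x : M, T x} {x₀ x : M} (hx : x ∈ (extChartAt (𝓡 4) x₀).source) :
    coordVec x₀ x (X x) = coordField X x₀ (extChartAt (𝓡 4) x₀ x) := by
  unfold coordField
  rw [(extChartAt (𝓡 4) x₀).left_inv hx]

/-- Coordinate frame vectors form a smooth vector field along the inverse chart. -/
theorem contMDiffOn_chartFrame (x₀ : M) (u : E4) :
    ContMDiffOn 𝓘(ℝ, E4) (𝓡 4).tangent ∞
      (fun y ↦ (⟨_, chartFrame x₀ y u⟩ : TangentBundle (𝓡 4) M))
      (extChartAt (𝓡 4) x₀).target := by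
  have hopen := isOpen_chart_target x₀
  have h1 : ContMDiffOn 𝓘(ℝ, E4) (𝓡 4) ∞ (extChartAt (𝓡 4) x₀).symm
    (extChartAt (𝓡 4) x₀).target := contMDiffOn_extChartAt_symm x₀
  have h2 := h1.contMDiffOn_tangentMapWithin (m := ∞) (by simp) hopen.uniqueMDiffOn
  have h3 : ContMDiffOn 𝓘(ℝ, E4) 𝓘(ℝ, E4).tangent ∞
      (fun y : E4 ↦ (⟨y, u⟩ : TangentBundle 𝓘(ℝ, E4) E4)) (extChartAt (𝓡 4) x₀).target :=
    contMDiffOn_vectorSpace_iff_contDiffOn.2 contDiffOn_const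
  refine (h2.comp h3 (fun y hy ↦ hy)).congr fun y hy ↦ ?_
  simp only [Function.comp, tangentMapWithin, chartFrame]
  rw [mfderivWithin_of_isOpen hopen hy]
  rfl

/-- Smoothness is tested on pairs of constant vectors; these become coordinate frame fields, which
are smooth along the inverse chart. -/
theorem contDiffOn_coordTensor {B : ∀ x : M, T x →L[ℝ] T x →L[ℝ] ℝ} (hB : SmoothTensor B)
    (x₀ : M) : ContDiffOn ℝ ∞ (coordTensor B x₀) (extChartAt (𝓡 4) x₀).target := by
  rw [contDiffOn_clm_apply]; intro u
  rw [contDiffOn_clm_apply]; intro v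
  rw [← contMDiffOn_iff_contDiffOn]
  intro y hy
  have : ContMDiffWithinAt 𝓘(ℝ, E4) ((𝓡 4).prod 𝓘(ℝ)) ∞
      (fun y ↦ Bundle.TotalSpace.mk' ℝ (E := Bundle.Trivial M ℝ) ((extChartAt (𝓡 4) x₀).symm y)
        (B _ (chartFrame x₀ y u) (chartFrame x₀ y v))) (extChartAt (𝓡 4) x₀).target y := by
    apply ContMDiffWithinAt.clm_bundle_apply₂ (F₁ := E4) (F₂ := E4)
    · exact hB.contMDiffAt.comp_contMDiffWithinAt y (contMDiffOn_extChartAt_symm x₀ y hy)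
    · exact contMDiffOn_chartFrame x₀ u y hy
    · exact contMDiffOn_chartFrame x₀ v y hy
  simp only [Bundle.contMDiffWithinAt_totalSpace] at this
  exact this.2

theorem contMDiff_tensor_apply {B : ∀ x : M, T x →L[ℝ] T x →L[ℝ] ℝ} (hB : SmoothTensor B)
    {X Y : ∀ x : M, T x} (hX : SmoothVectorField X) (hY : SmoothVectorField Y) :
    ContMDiff (𝓡 4) 𝓘(ℝ, ℝ) ∞ (fun x ↦ B x (X x) (Y x)) := by
  intro x
  have : ContMDiffAt (𝓡 4) ((𝓡 4).prod 𝓘(ℝ)) ∞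
      (fun y ↦ Bundle.TotalSpace.mk' ℝ (E := Bundle.Trivial M ℝ) y (B y (X y) (Y y))) x := by
    apply ContMDiffAt.clm_bundle_apply₂ (F₁ := E4) (F₂ := E4)
    · exact hB x
    · exact hX x
    · exact hY x
  rw [Bundle.contMDiffAt_totalSpace] at this
  exact this.2

theorem contDiffOn_coordField {X : ∀ x : M, T x} (hX : SmoothVectorField X) (x₀ : M) :
    ContDiffOn ℝ ∞ (coordField X x₀) (extChartAt (𝓡 4) x₀).target := by
  have h1 : ContMDiffOn 𝓘(ℝ, E4) (𝓡 4).tangent ∞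
      (fun y ↦ (⟨_, X ((extChartAt (𝓡 4) x₀).symm y)⟩ : TangentBundle (𝓡 4) M))
      (extChartAt (𝓡 4) x₀).target :=
    hX.contMDiffOn.comp (t := univ) (contMDiffOn_extChartAt_symm x₀) (fun _ _ ↦ mem_univ _)
  have hs : IsOpen (chartAt E4 x₀).source := (chartAt E4 x₀).open_source
  have h2 := (contMDiffOn_extChartAt (I := 𝓡 4) (n := ∞) (x := x₀)).contMDiffOn_tangentMapWithin
    (m := ∞) (by simp) hs.uniqueMDiffOn
  have h3 := h2.comp h1 (fun y hy ↦ by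
    have := (extChartAt (𝓡 4) x₀).map_target hy
    rwa [extChartAt_source] at this)
  have h4 : ContMDiffOn 𝓘(ℝ, E4) 𝓘(ℝ, E4).tangent ∞
      (fun y : E4 ↦ (⟨y, coordField X x₀ y⟩ : TangentBundle 𝓘(ℝ, E4) E4))
      (extChartAt (𝓡 4) x₀).target := by
    refine h3.congr fun y hy ↦ ?_
    have hy' := (extChartAt (𝓡 4) x₀).map_target hy
    rw [extChartAt_source] at hy'
    simp only [Function.comp, tangentMapWithin]
    rw [mfderivWithin_of_isOpen hs hy', (extChartAt (𝓡 4) x₀).right_inv hy]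
    rfl
  exact contMDiffOn_vectorSpace_iff_contDiffOn.1 h4

theorem contDiffOn_comp_chart_symm {f : M → ℝ} (hf : ContMDiff (𝓡 4) 𝓘(ℝ, ℝ) ∞ f) (x₀ : M) :
    ContDiffOn ℝ ∞ (f ∘ (extChartAt (𝓡 4) x₀).symm) (extChartAt (𝓡 4) x₀).target :=
  contMDiffOn_iff_contDiffOn.1
    (hf.contMDiffOn.comp (t := univ) (contMDiffOn_extChartAt_symm x₀) (fun _ _ ↦ mem_univ _))

/-- A vector field with smooth components is smooth. -/
theorem smoothVectorField_of_coordField {X : ∀ x : M, T x}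
    (h : ∀ x₀, ContDiffOn ℝ ∞ (coordField X x₀) (extChartAt (𝓡 4) x₀).target) :
    SmoothVectorField X := by
  intro x₀
  have hs : IsOpen (chartAt E4 x₀).source := (chartAt E4 x₀).open_source
  have hopen := isOpen_chart_target x₀
  have h1 : ContMDiffOn 𝓘(ℝ, E4) (𝓡 4) ∞ (extChartAt (𝓡 4) x₀).symm
    (extChartAt (𝓡 4) x₀).target := contMDiffOn_extChartAt_symm x₀
  have h2 := h1.contMDiffOn_tangentMapWithin (m := ∞) (by simp) hopen.uniqueMDiffOn
  have h4 : ContMDiffOn 𝓘(ℝ, E4) 𝓘(ℝ, E4).tangent ∞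
      (fun y : E4 ↦ (⟨y, coordField X x₀ y⟩ : TangentBundle 𝓘(ℝ, E4) E4))
      (extChartAt (𝓡 4) x₀).target := contMDiffOn_vectorSpace_iff_contDiffOn.2 (h x₀)
  have h5 := (h2.comp h4 (fun y hy ↦ hy)).comp
    (contMDiffOn_extChartAt (I := 𝓡 4) (n := ∞) (x := x₀)) (fun y hy ↦ by
      rw [← extChartAt_source (𝓡 4)] at hy
      exact (extChartAt (𝓡 4) x₀).map_source hy)
  refine (h5.congr fun x hx ↦ ?_).contMDiffAt (hs.mem_nhds (mem_chart_source E4 x₀))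
  rw [← extChartAt_source (𝓡 4)] at hx
  have hx' := (extChartAt (𝓡 4) x₀).map_source hx
  simp only [Function.comp, tangentMapWithin]
  rw [mfderivWithin_of_isOpen hopen hx']
  obtain ⟨y, hy, rfl⟩ : ∃ y ∈ (extChartAt (𝓡 4) x₀).target, (extChartAt (𝓡 4) x₀).symm y = x :=
    ⟨_, hx', (extChartAt (𝓡 4) x₀).left_inv hx⟩
  rw [(extChartAt (𝓡 4) x₀).right_inv hy]
  have := chartFrame_coordVec hy (X ((extChartAt (𝓡 4) x₀).symm y))
  exact congrArg (Bundle.TotalSpace.mk _) this.symm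

end

section

/-! ## Christoffel symbols on the coordinate space -/

/-- `inverse` takes the value zero at maps that are not invertible, so gradients and Christoffel
symbols have their meaning only through this lemma. An injective map between spaces of the same
dimension is bijective. -/
theorem isInvertible_of_nondegenerate {B : E4 →L[ℝ] E4 →L[ℝ] ℝ} (h : ∀ v, B v = 0 → v = 0) :
    B.IsInvertible := by
  have hinj : Function.Injective B.toLinearMap :=
    (injective_iff_map_eq_zero B.toLinearMap).2 h
  have hdim : Module.finrank ℝ E4 = Module.finrank ℝ (E4 →L[ℝ] ℝ) := by
    rw [← (LinearMap.toContinuousLinearMap (𝕜 := ℝ) (E := E4) (F' := ℝ)).finrank_eq,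
      Module.finrank_linearMap]
    simp
  exact ⟨(LinearEquiv.ofInjectiveOfFinrankEq B.toLinearMap hinj hdim).toContinuousLinearEquiv, by
    ext; rfl⟩

theorem inverse_apply_of_isInvertible {B : E4 →L[ℝ] E4 →L[ℝ] ℝ} (h : B.IsInvertible)
    (l : E4 →L[ℝ] ℝ) : B (B.inverse l) = l := by
  obtain ⟨e, rfl⟩ := h
  simp

section christoffel

variable {G : E4 → E4 →L[ℝ] E4 →L[ℝ] ℝ} {y : E4}

theorem fderiv_bilin_apply (hG : DifferentiableAt ℝ G y) (u v w : E4) :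
    fderiv ℝ G y u v w = fderiv ℝ (fun z ↦ G z v w) y u := by
  have h1 : HasFDerivAt (fun z ↦ G z v w) _ y :=
    (hG.hasFDerivAt.clm_apply (hasFDerivAt_const v y)).clm_apply (hasFDerivAt_const w y)
  rw [h1.fderiv]
  simp

theorem fderiv_bilin_symm (hG : DifferentiableAt ℝ G y) (hs : ∀ᶠ z in 𝓝 y, ∀ v w, G z v w = G z w v)
    (u v w : E4) : fderiv ℝ G y u v w = fderiv ℝ G y u w v := by
  rw [fderiv_bilin_apply hG, fderiv_bilin_apply hG]
  have : (fun z ↦ G z v w) =ᶠ[𝓝 y] fun z ↦ G z w v := hs.mono fun z hz ↦ hz v w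
  rw [this.fderiv_eq]

theorem christoffel_apply (hi : (G y).IsInvertible) (u v w : E4) :
    G y (christoffel G y u v) w =
      (1 / 2) * (fderiv ℝ G y u v w + fderiv ℝ G y v u w - fderiv ℝ G y w u v) := by
  unfold christoffel
  rw [inverse_apply_of_isInvertible hi]
  simp

theorem christoffel_symm (hG : DifferentiableAt ℝ G y)
    (hs : ∀ᶠ z in 𝓝 y, ∀ v w, G z v w = G z w v) (u v : E4) :
    christoffel G y u v = christoffel G y v u := by
  unfold christoffel
  congr 2
  ext w
  simp [add_comm, fderiv_bilin_symm hG hs w u v]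

/-- In the sum of the two Koszul formulas all the derivatives cancel except the one in the direction
`u`. -/
theorem christoffel_compat (hG : DifferentiableAt ℝ G y)
    (hs : ∀ᶠ z in 𝓝 y, ∀ v w, G z v w = G z w v) (hi : (G y).IsInvertible) (u v w : E4) :
    fderiv ℝ G y u v w = G y (christoffel G y u v) w + G y v (christoffel G y u w) := by
  rw [hs.self_of_nhds v, christoffel_apply hi, christoffel_apply hi,
    fderiv_bilin_symm hG hs v u w, fderiv_bilin_symm hG hs w u v, fderiv_bilin_symm hG hs u w v]
  ring

theorem christoffel_add_left (u u' v : E4) :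
    christoffel G y (u + u') v = christoffel G y u v + christoffel G y u' v := by
  unfold christoffel
  rw [← map_add]
  congr 1
  ext w
  simp; ring

theorem christoffel_smul_left (r : ℝ) (u v : E4) :
    christoffel G y (r • u) v = r • christoffel G y u v := by
  unfold christoffel
  rw [← map_smul]
  congr 1
  ext w
  simp; ring

end christoffel

variable {M : Type*} [TopologicalSpace M] [ChartedSpace E4 M] [IsManifold (𝓡 4) ∞ M]

/-! ## Differentials and velocities in a chart -/

theorem diff_eq_fderiv {f : M → ℝ} {x x₀ : M} (hx : x ∈ (extChartAt (𝓡 4) x₀).source)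
    (hf : MDifferentiableAt (𝓡 4) 𝓘(ℝ, ℝ) f x) (v : T x) :
    diff f x v = fderiv ℝ (f ∘ (extChartAt (𝓡 4) x₀).symm) (extChartAt (𝓡 4) x₀ x)
      (coordVec x₀ x v) := by
  have h1m : IsManifold (𝓡 4) 1 M := isManifold_one
  obtain ⟨y, hy, rfl⟩ : ∃ y ∈ (extChartAt (𝓡 4) x₀).target, (extChartAt (𝓡 4) x₀).symm y = x :=
    ⟨_, (extChartAt (𝓡 4) x₀).map_source hx, (extChartAt (𝓡 4) x₀).left_inv hx⟩
  rw [(extChartAt (𝓡 4) x₀).right_inv hy, ← mfderiv_eq_fderiv]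
  have h1 : MDifferentiableAt 𝓘(ℝ, E4) (𝓡 4) (extChartAt (𝓡 4) x₀).symm y :=
    (mdifferentiableOn_extChartAt_symm y hy).mdifferentiableAt
      ((isOpen_chart_target x₀).mem_nhds hy)
  rw [mfderiv_comp y hf h1]
  conv_lhs => rw [← chartFrame_coordVec hy v]
  rfl

theorem hasDerivAt_deriv_of_contDiffAt {c : ℝ → E4} {s : ℝ} (hc : ContDiffAt ℝ 2 c s) :
    HasDerivAt (deriv c) (iteratedDeriv 2 c s) s := by
  have h : DifferentiableAt ℝ (deriv c) s :=
    (((hc.fderiv_right (m := 1) (by norm_num)).differentiableAt (by simp)).clm_apply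
      (differentiableAt_const (1 : ℝ)))
  rw [iteratedDeriv_succ, iteratedDeriv_one]
  exact h.hasDerivAt

theorem hasDerivAt_bilin {E : Type*} [NormedAddCommGroup E] [NormedSpace ℝ E]
    {B : E → E →L[ℝ] E →L[ℝ] ℝ} {B' : E →L[ℝ] E →L[ℝ] E →L[ℝ] ℝ}
    {c u w : ℝ → E} {c' u' w' : E} {s : ℝ} (hB : HasFDerivAt B B' (c s))
    (hc : HasDerivAt c c' s) (hu : HasDerivAt u u' s) (hw : HasDerivAt w w' s) :
    HasDerivAt (fun t ↦ B (c t) (u t) (w t))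
      (B' c' (u s) (w s) + B (c s) u' (w s) + B (c s) (u s) w') s := by
  have h1 := HasFDerivAt.comp_hasDerivAt (F := E) (E := E →L[ℝ] E →L[ℝ] ℝ) s hB hc
  have h2 : HasDerivAt (fun t ↦ B (c t) (u t)) (B' c' (u s) + B (c s) u') s := h1.clm_apply hu
  exact h2.clm_apply hw

section curves

variable {γ : ℝ → M} {s : ℝ} {x₀ : M}

theorem contDiffAt_coord_curve {n : WithTop ℕ∞} (hn : n ≤ ∞) (hγ : ContMDiffAt 𝓘(ℝ, ℝ) (𝓡 4) n γ s)
    (hx : γ s ∈ (extChartAt (𝓡 4) x₀).source) :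
    ContDiffAt ℝ n (fun t ↦ extChartAt (𝓡 4) x₀ (γ t)) s := by
  rw [← contMDiffAt_iff_contDiffAt]
  rw [extChartAt_source] at hx
  exact ((contMDiffAt_extChartAt' (I := 𝓡 4) (n := ∞) hx).of_le hn).comp s hγ

theorem coordVec_velocity (hγ : MDifferentiableAt 𝓘(ℝ, ℝ) (𝓡 4) γ s)
    (hx : γ s ∈ (extChartAt (𝓡 4) x₀).source) :
    coordVec x₀ (γ s) (velocity γ s) = deriv (fun t ↦ extChartAt (𝓡 4) x₀ (γ t)) s := by
  have h1m : IsManifold (𝓡 4) 1 M := isManifold_one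
  rw [extChartAt_source] at hx
  have h := mfderiv_comp s (mdifferentiableAt_extChartAt (I := 𝓡 4) hx) hγ
  rw [mfderiv_eq_fderiv] at h
  have h2 := congrArg (fun f : ℝ →L[ℝ] E4 ↦ f 1) h
  exact h2.symm

theorem hasDerivAt_comp_curve {f : M → ℝ} (hf : MDifferentiableAt (𝓡 4) 𝓘(ℝ, ℝ) f (γ s))
    (hγ : MDifferentiableAt 𝓘(ℝ, ℝ) (𝓡 4) γ s) :
    HasDerivAt (fun t ↦ f (γ t)) (diff f (γ s) (velocity γ s)) s := by
  have h := hf.hasMFDerivAt.comp s hγ.hasMFDerivAt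
  let L : ℝ →L[ℝ] ℝ := (mfderiv (𝓡 4) 𝓘(ℝ, ℝ) f (γ s)).comp (mfderiv 𝓘(ℝ, ℝ) (𝓡 4) γ s)
  have h2 : HasFDerivAt (f ∘ γ) L s := h.hasFDerivAt
  exact h2.hasDerivAt

theorem eventually_contMDiffAt_two (hγ : ContMDiffAt 𝓘(ℝ, ℝ) (𝓡 4) 2 γ s)
    (hx : γ s ∈ (extChartAt (𝓡 4) x₀).source) :
    ∀ᶠ t in 𝓝 s, γ t ∈ (extChartAt (𝓡 4) x₀).source ∧ MDifferentiableAt 𝓘(ℝ, ℝ) (𝓡 4) γ t := by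
  refine (hγ.continuousAt.eventually_mem
    ((isOpen_extChartAt_source x₀).mem_nhds hx)).and ?_
  have h2 : IsManifold (𝓡 4) 2 M := .of_le (n := ∞) ENat.LEInfty.out
  filter_upwards [(contMDiffAt_iff_contMDiffAt_nhds (by simp)).1 hγ] with t ht
  exact ht.mdifferentiableAt (by simp)

end curves

/-! ## The metric in a chart -/

namespace LorentzMetric

variable (g : LorentzMetric M)

/-- Pairing with the vectors of an orthonormal basis recovers the coordinates up to sign. -/
theorem nondegenerate {x : M} {v : T x} (h : ∀ w, g.val x v w = 0) : v = 0 := by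
  obtain ⟨e, he⟩ := g.signature x
  have h1 : ∀ j, e.repr v j = 0 := by
    intro j
    have h2 := h (e j)
    rw [← e.sum_repr v] at h2
    simp only [map_sum, map_smul, sum_apply, smul_apply,
      he, smul_eq_mul] at h2
    rw [Finset.sum_eq_single j] at h2
    · rcases mul_eq_zero.1 h2 with h | h
      · exact h
      · exfalso; revert h; simp only [if_true]; split_ifs <;> norm_num
    · intro i _ hi; simp [hi]
    · simp
  exact e.ext_elem fun i ↦ by simp [h1 i]

theorem isInvertible_val (x : M) : (g.val x).IsInvertible :=
  isInvertible_of_nondegenerate (B := g.val x) fun v hv ↦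
    g.nondegenerate (x := x) (v := v) fun w ↦ congrArg (fun l : E4 →L[ℝ] ℝ ↦ l w) hv

theorem val_grad (f : M → ℝ) (x : M) (w : T x) : g.val x (g.grad f x) w = diff f x w :=
  congrArg (fun l : E4 →L[ℝ] ℝ ↦ l w) (inverse_apply_of_isInvertible (g.isInvertible_val x) _)

theorem isInvertible_coordTensor {x₀ : M} {y : E4} (hy : y ∈ (extChartAt (𝓡 4) x₀).target) :
    (coordTensor g.val x₀ y).IsInvertible := by
  refine isInvertible_of_nondegenerate fun u hu ↦ ?_
  have h : chartFrame x₀ y u = 0 := g.nondegenerate fun w ↦ by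
    rw [← chartFrame_coordVec hy w]
    exact congrArg (fun l : E4 →L[ℝ] ℝ ↦ l _) hu
  rw [← coordVec_chartFrame hy u, h, map_zero]

theorem coordTensor_symm (x₀ : M) (y u v : E4) :
    coordTensor g.val x₀ y u v = coordTensor g.val x₀ y v u := by
  rw [coordTensor_apply, coordTensor_apply, g.symm]

theorem differentiableAt_coordTensor {B : ∀ x : M, T x →L[ℝ] T x →L[ℝ] ℝ} (hB : SmoothTensor B)
    {x₀ : M} {y : E4} (hy : y ∈ (extChartAt (𝓡 4) x₀).target) :
    DifferentiableAt ℝ (coordTensor B x₀) y :=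
  ((contDiffOn_coordTensor hB x₀).contDiffAt ((isOpen_chart_target x₀).mem_nhds hy)).differentiableAt
    (by simp)

theorem Γ_symm (x : M) (u v : E4) : g.Γ x u v = g.Γ x v u :=
  christoffel_symm (differentiableAt_coordTensor g.smooth (mem_extChartAt_target x))
    (.of_forall fun z ↦ g.coordTensor_symm x z) u v

theorem Γ_compat (x : M) (u v w : E4) :
    fderiv ℝ (coordTensor g.val x) (extChartAt (𝓡 4) x x) u v w =
      coordTensor g.val x (extChartAt (𝓡 4) x x) (g.Γ x u v) w
        + coordTensor g.val x (extChartAt (𝓡 4) x x) v (g.Γ x u w) :=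
  christoffel_compat (differentiableAt_coordTensor g.smooth (mem_extChartAt_target x))
    (.of_forall fun z ↦ g.coordTensor_symm x z)
    (g.isInvertible_coordTensor (mem_extChartAt_target x)) u v w

theorem coordVec_ofCoord (x : M) (v : E4) : coordVec x x (ofCoord x v) = v := by
  rw [coordVec_self, ofCoord_self]

theorem coordVec_covDeriv (X : ∀ x : M, T x) (x : M) (v : T x) :
    coordVec x x (g.covDeriv X x v) =
      fderiv ℝ (coordField X x) (extChartAt (𝓡 4) x x) (coordVec x x v)
        + g.Γ x (coordVec x x v) (coordVec x x (X x)) :=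
  coordVec_ofCoord x _

theorem coordVec_acceleration (γ : ℝ → M) (s : ℝ) :
    coordVec (γ s) (γ s) (g.acceleration γ s) =
      iteratedDeriv 2 (fun t ↦ extChartAt (𝓡 4) (γ s) (γ t)) s
        + g.Γ (γ s) (coordVec (γ s) (γ s) (velocity γ s)) (coordVec (γ s) (γ s) (velocity γ s)) :=
  coordVec_ofCoord _ _

theorem covDerivTensor_val (x : M) (u v w : T x) : g.covDerivTensor g.val x u v w = 0 := by
  simp only [covDerivTensor]
  rw [g.Γ_compat]; ring

theorem coordVec_injective (x : M) : Function.Injective (coordVec x x) := fun v w h ↦ by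
  rwa [coordVec_self, coordVec_self] at h

theorem covDeriv_add (X : ∀ x : M, T x) (x : M) (v w : T x) :
    g.covDeriv X x (v + w) = g.covDeriv X x v + g.covDeriv X x w := by
  apply coordVec_injective x
  simp only [map_add, coordVec_covDeriv, Γ, christoffel_add_left]
  abel

theorem covDeriv_smul (X : ∀ x : M, T x) (x : M) (r : ℝ) (v : T x) :
    g.covDeriv X x (r • v) = r • g.covDeriv X x v := by
  apply coordVec_injective x
  simp only [map_smul, coordVec_covDeriv, Γ, christoffel_smul_left, smul_add]

theorem hasFDerivAt_coordField {X : ∀ x : M, T x} (hX : SmoothVectorField X) (x : M) :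
    HasFDerivAt (coordField X x) (fderiv ℝ (coordField X x) (extChartAt (𝓡 4) x x))
      (extChartAt (𝓡 4) x x) :=
  (((contDiffOn_coordField hX x).contDiffAt ((isOpen_chart_target x).mem_nhds
    (mem_extChartAt_target x))).differentiableAt (by simp)).hasFDerivAt

theorem hasFDerivAt_coordTensor {B : ∀ x : M, T x →L[ℝ] T x →L[ℝ] ℝ} (hB : SmoothTensor B)
    (x : M) : HasFDerivAt (coordTensor B x) (fderiv ℝ (coordTensor B x) (extChartAt (𝓡 4) x x))
      (extChartAt (𝓡 4) x x) :=
  (differentiableAt_coordTensor hB (mem_extChartAt_target x)).hasFDerivAt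

/-- The differential of the product of two vector fields. -/
theorem diff_val {X Y : ∀ x : M, T x} (hX : SmoothVectorField X) (hY : SmoothVectorField Y)
    (x : M) (v : T x) :
    diff (fun z ↦ g.val z (X z) (Y z)) x v =
      g.val x (g.covDeriv X x v) (Y x) + g.val x (X x) (g.covDeriv Y x v) := by
  have hx := mem_extChartAt_source (I := 𝓡 4) x
  have hnhds := (isOpen_chart_target x).mem_nhds (mem_extChartAt_target (I := 𝓡 4) x)
  rw [diff_eq_fderiv hx (((contMDiff_tensor_apply g.smooth hX hY) x).mdifferentiableAt (by simp))]
  have heq : ((fun z ↦ g.val z (X z) (Y z)) ∘ (extChartAt (𝓡 4) x).symm) =ᶠ[𝓝 (extChartAt (𝓡 4) x x)]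
      fun y ↦ coordTensor g.val x y (coordField X x y) (coordField Y x y) := by
    filter_upwards [hnhds] with y hy
    rw [coordTensor_apply]
    unfold coordField
    rw [chartFrame_coordVec hy, chartFrame_coordVec hy]
    rfl
  have := (((hasFDerivAt_coordTensor g.smooth x).clm_apply (hasFDerivAt_coordField hX x)).clm_apply
    (hasFDerivAt_coordField hY x))
  rw [heq.fderiv_eq, this.fderiv, tensor_eq_coordTensor g.val hx, tensor_eq_coordTensor g.val hx,
    coordVec_covDeriv, coordVec_covDeriv, coordVec_field hx, coordVec_field hx]
  simp only [add_apply, ContinuousLinearMap.comp_apply, ContinuousLinearMap.flip_apply,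
    g.Γ_compat, map_add]
  ring

section curves

variable {γ : ℝ → M} {s : ℝ}

/-- The derivative of `B(γ̇, γ̇)` along a curve. -/
theorem hasDerivAt_tensor_velocity {B : ∀ x : M, T x →L[ℝ] T x →L[ℝ] ℝ} (hB : SmoothTensor B)
    (hγ : ContMDiffAt 𝓘(ℝ, ℝ) (𝓡 4) 2 γ s) :
    HasDerivAt (fun t ↦ B (γ t) (velocity γ t) (velocity γ t))
      (g.covDerivTensor B (γ s) (velocity γ s) (velocity γ s) (velocity γ s)
        + B (γ s) (g.acceleration γ s) (velocity γ s)
        + B (γ s) (velocity γ s) (g.acceleration γ s)) s := by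
  have hx := mem_extChartAt_source (I := 𝓡 4) (γ s)
  have hc : ContDiffAt ℝ 2 (fun t ↦ extChartAt (𝓡 4) (γ s) (γ t)) s :=
    contDiffAt_coord_curve ENat.LEInfty.out hγ hx
  have hd1 := (hc.differentiableAt (by simp)).hasDerivAt
  have hd2 := hasDerivAt_deriv_of_contDiffAt hc
  -- The chart stays fixed at `γ s` while `t` varies, so near `s` the derivative is an ordinary one
  -- in coordinates.
  have heq : (fun t ↦ B (γ t) (velocity γ t) (velocity γ t)) =ᶠ[𝓝 s]
      fun t ↦ coordTensor B (γ s) (extChartAt (𝓡 4) (γ s) (γ t))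
        (deriv (fun t ↦ extChartAt (𝓡 4) (γ s) (γ t)) t)
        (deriv (fun t ↦ extChartAt (𝓡 4) (γ s) (γ t)) t) := by
    filter_upwards [eventually_contMDiffAt_two hγ hx] with t ht
    rw [tensor_eq_coordTensor B ht.1, coordVec_velocity ht.2 ht.1]
  have h := hasDerivAt_bilin (c := fun t ↦ extChartAt (𝓡 4) (γ s) (γ t))
    (hasFDerivAt_coordTensor hB (γ s)) hd1 hd2 hd2
  refine (h.congr_of_eventuallyEq heq).congr_deriv ?_
  rw [tensor_eq_coordTensor B hx, tensor_eq_coordTensor B hx, coordVec_acceleration]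
  simp only [covDerivTensor, coordVec_velocity (hγ.mdifferentiableAt (by simp)) hx, map_add,
    add_apply]
  ring

/-- The derivative of `g(X, γ̇)` along a curve. -/
theorem hasDerivAt_field_velocity {X : ∀ x : M, T x} (hX : SmoothVectorField X)
    (hγ : ContMDiffAt 𝓘(ℝ, ℝ) (𝓡 4) 2 γ s) :
    HasDerivAt (fun t ↦ g.val (γ t) (X (γ t)) (velocity γ t))
      (g.val (γ s) (g.covDeriv X (γ s) (velocity γ s)) (velocity γ s)
        + g.val (γ s) (X (γ s)) (g.acceleration γ s)) s := by
  have hx := mem_extChartAt_source (I := 𝓡 4) (γ s)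
  have hc : ContDiffAt ℝ 2 (fun t ↦ extChartAt (𝓡 4) (γ s) (γ t)) s :=
    contDiffAt_coord_curve ENat.LEInfty.out hγ hx
  have hd1 := (hc.differentiableAt (by simp)).hasDerivAt
  have hd2 := hasDerivAt_deriv_of_contDiffAt hc
  have heq : (fun t ↦ g.val (γ t) (X (γ t)) (velocity γ t)) =ᶠ[𝓝 s]
      fun t ↦ coordTensor g.val (γ s) (extChartAt (𝓡 4) (γ s) (γ t))
        (coordField X (γ s) (extChartAt (𝓡 4) (γ s) (γ t)))
        (deriv (fun t ↦ extChartAt (𝓡 4) (γ s) (γ t)) t) := by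
    filter_upwards [eventually_contMDiffAt_two hγ hx] with t ht
    rw [tensor_eq_coordTensor g.val ht.1, coordVec_velocity ht.2 ht.1, coordVec_field ht.1]
  have h := hasDerivAt_bilin (c := fun t ↦ extChartAt (𝓡 4) (γ s) (γ t))
    (hasFDerivAt_coordTensor g.smooth (γ s)) hd1
    (HasFDerivAt.comp_hasDerivAt (f := fun t ↦ extChartAt (𝓡 4) (γ s) (γ t)) s
      (hasFDerivAt_coordField hX (γ s)) hd1) hd2
  refine (h.congr_of_eventuallyEq heq).congr_deriv ?_
  rw [tensor_eq_coordTensor g.val hx, tensor_eq_coordTensor g.val hx, coordVec_acceleration,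
    coordVec_covDeriv, coordVec_field hx]
  simp only [coordVec_velocity (hγ.mdifferentiableAt (by simp)) hx, map_add,
    add_apply, Function.comp, g.Γ_compat]
  ring

end curves

end LorentzMetric

end

section

variable {M : Type*} [TopologicalSpace M] [ChartedSpace E4 M] [IsManifold (𝓡 4) ∞ M]

/-! ## Gradients -/

namespace LorentzMetric

variable (g : LorentzMetric M)

theorem coordTensor_coordField_grad {f : M → ℝ} (hf : ContMDiff (𝓡 4) 𝓘(ℝ, ℝ) ∞ f) {x₀ : M} {y : E4}
    (hy : y ∈ (extChartAt (𝓡 4) x₀).target) (v : E4) :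
    coordTensor g.val x₀ y (coordField (g.grad f) x₀ y) v =
      fderiv ℝ (f ∘ (extChartAt (𝓡 4) x₀).symm) y v := by
  rw [coordTensor_apply]
  unfold coordField
  rw [chartFrame_coordVec hy, val_grad, diff_eq_fderiv ((extChartAt (𝓡 4) x₀).map_target hy)
    ((hf _).mdifferentiableAt (by simp)), (extChartAt (𝓡 4) x₀).right_inv hy, coordVec_chartFrame hy]

theorem coordField_grad {f : M → ℝ} (hf : ContMDiff (𝓡 4) 𝓘(ℝ, ℝ) ∞ f) {x₀ : M} {y : E4}
    (hy : y ∈ (extChartAt (𝓡 4) x₀).target) :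
    coordField (g.grad f) x₀ y =
      (coordTensor g.val x₀ y).inverse (fderiv ℝ (f ∘ (extChartAt (𝓡 4) x₀).symm) y) := by
  obtain ⟨e, he⟩ := g.isInvertible_coordTensor hy
  have h : coordTensor g.val x₀ y (coordField (g.grad f) x₀ y) =
      fderiv ℝ (f ∘ (extChartAt (𝓡 4) x₀).symm) y := by
    ext v; exact g.coordTensor_coordField_grad hf hy v
  rw [← h, ← he, ContinuousLinearMap.inverse_equiv]
  simp

theorem contDiffOn_fderiv_comp_chart_symm {f : M → ℝ} (hf : ContMDiff (𝓡 4) 𝓘(ℝ, ℝ) ∞ f) (x₀ : M) :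
    ContDiffOn ℝ ∞ (fderiv ℝ (f ∘ (extChartAt (𝓡 4) x₀).symm)) (extChartAt (𝓡 4) x₀).target :=
  (contDiffOn_comp_chart_symm hf x₀).fderiv_of_isOpen (isOpen_chart_target x₀) (by simp)

theorem contDiffOn_inverse_coordTensor (x₀ : M) :
    ContDiffOn ℝ ∞ (fun y ↦ (coordTensor g.val x₀ y).inverse) (extChartAt (𝓡 4) x₀).target := by
  intro y hy
  exact (g.isInvertible_coordTensor hy).contDiffAt_map_inverse.comp_contDiffWithinAt y
    (contDiffOn_coordTensor g.smooth x₀ y hy)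

theorem smooth_grad {f : M → ℝ} (hf : ContMDiff (𝓡 4) 𝓘(ℝ, ℝ) ∞ f) :
    SmoothVectorField (g.grad f) :=
  smoothVectorField_of_coordField fun x₀ ↦
    ((g.contDiffOn_inverse_coordTensor x₀).clm_apply
      (contDiffOn_fderiv_comp_chart_symm hf x₀)).congr fun _ hy ↦ g.coordField_grad hf hy

/-- The Hessian of a function is symmetric. -/
theorem hessian_symm {f : M → ℝ} (hf : ContMDiff (𝓡 4) 𝓘(ℝ, ℝ) ∞ f) (x : M) (u v : T x) :
    g.val x (g.covDeriv (g.grad f) x u) v = g.val x (g.covDeriv (g.grad f) x v) u := by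
  have hx := mem_extChartAt_source (I := 𝓡 4) x
  have hy := mem_extChartAt_target (I := 𝓡 4) x
  have hnhds := (isOpen_chart_target x).mem_nhds hy
  set F := f ∘ (extChartAt (𝓡 4) x).symm with hF
  have hcd : ContDiffAt ℝ ∞ F (extChartAt (𝓡 4) x x) :=
    (contDiffOn_comp_chart_symm hf x).contDiffAt hnhds
  have hsymm : IsSymmSndFDerivAt ℝ F (extChartAt (𝓡 4) x x) :=
    hcd.isSymmSndFDerivAt (by simp; exact ENat.LEInfty.out)
  -- Differentiate `G(grad f, v) = ∂_v f` in the direction `u`. Metric compatibility leaves the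
  -- second derivative of `f` and a Christoffel term, both symmetric in `u`, `v`.
  have key : ∀ u v : E4,
      coordTensor g.val x (extChartAt (𝓡 4) x x)
        (fderiv ℝ (coordField (g.grad f) x) (extChartAt (𝓡 4) x x) u
          + g.Γ x u (coordField (g.grad f) x (extChartAt (𝓡 4) x x))) v =
      fderiv ℝ (fderiv ℝ F) (extChartAt (𝓡 4) x x) u v
        - coordTensor g.val x (extChartAt (𝓡 4) x x)
          (coordField (g.grad f) x (extChartAt (𝓡 4) x x)) (g.Γ x u v) := by
    intro u v
    have heq : (fun y ↦ coordTensor g.val x y (coordField (g.grad f) x y) v)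
        =ᶠ[𝓝 (extChartAt (𝓡 4) x x)] fun y ↦ fderiv ℝ F y v := by
      filter_upwards [hnhds] with y hy
      exact g.coordTensor_coordField_grad hf hy v
    have h1 := ((hasFDerivAt_coordTensor g.smooth x).clm_apply
      (hasFDerivAt_coordField (g.smooth_grad hf) x)).clm_apply (hasFDerivAt_const v _)
    have hcd2 : HasFDerivAt (fderiv ℝ F) (fderiv ℝ (fderiv ℝ F) (extChartAt (𝓡 4) x x))
        (extChartAt (𝓡 4) x x) :=
      (((hcd.of_le (m := 2) ENat.LEInfty.out).fderiv_right (m := 1)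
        (by norm_num)).differentiableAt (by simp)).hasFDerivAt
    have h2 := hcd2.clm_apply (hasFDerivAt_const (𝕜 := ℝ) v (extChartAt (𝓡 4) x x))
    have h3 := heq.fderiv_eq (𝕜 := ℝ)
    rw [h1.fderiv, h2.fderiv] at h3
    have h4 := congrArg (fun l : E4 →L[ℝ] ℝ ↦ l u) h3
    simp only [add_apply, ContinuousLinearMap.comp_apply, ContinuousLinearMap.flip_apply,
      g.Γ_compat, zero_apply, map_zero, zero_add] at h4
    rw [← h4]
    simp only [map_add, add_apply]
    ring
  rw [tensor_eq_coordTensor g.val hx, tensor_eq_coordTensor g.val hx, coordVec_covDeriv,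
    coordVec_covDeriv, coordVec_field hx, key, key, g.Γ_symm, hsymm]

end LorentzMetric

/-! ## Change of charts -/

/-- The transformation law of Christoffel symbols. -/
theorem christoffel_transition {G₀ G₁ : E4 → E4 →L[ℝ] E4 →L[ℝ] ℝ} {ψ : E4 → E4} {y : E4}
    (hψ : ContDiffAt ℝ 2 ψ y)
    (h : ∀ᶠ z in 𝓝 y, ∀ u v, G₀ z u v = G₁ (ψ z) (fderiv ℝ ψ z u) (fderiv ℝ ψ z v))
    (hG₀ : DifferentiableAt ℝ G₀ y) (hG₁ : DifferentiableAt ℝ G₁ (ψ y))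
    (hi₀ : (G₀ y).IsInvertible) (hi₁ : (G₁ (ψ y)).IsInvertible)
    (hs₁ : ∀ v w, G₁ (ψ y) v w = G₁ (ψ y) w v)
    (hsurj : Function.Surjective (fderiv ℝ ψ y)) (u : E4) :
    fderiv ℝ ψ y (christoffel G₀ y u u) =
      christoffel G₁ (ψ y) (fderiv ℝ ψ y u) (fderiv ℝ ψ y u) + fderiv ℝ (fderiv ℝ ψ) y u u := by
  -- The relation `G₀ = ψ^* G₁` is differentiated along the line through `y` in the direction `w`.
  have hD : ∀ w u v, fderiv ℝ G₀ y w u v =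
      fderiv ℝ G₁ (ψ y) (fderiv ℝ ψ y w) (fderiv ℝ ψ y u) (fderiv ℝ ψ y v)
        + G₁ (ψ y) (fderiv ℝ (fderiv ℝ ψ) y w u) (fderiv ℝ ψ y v)
        + G₁ (ψ y) (fderiv ℝ ψ y u) (fderiv ℝ (fderiv ℝ ψ) y w v) := by
    intro w u v
    have hl : HasDerivAt (fun t : ℝ ↦ y + t • w) w 0 := by
      simpa using ((hasDerivAt_id (0 : ℝ)).smul_const w).const_add y
    have hl0 : y + (0 : ℝ) • w = y := by simp
    have hψ1 : HasDerivAt (fun t : ℝ ↦ ψ (y + t • w)) (fderiv ℝ ψ y w) 0 := by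
      have : HasFDerivAt ψ (fderiv ℝ ψ y) (y + (0 : ℝ) • w) := by
        rw [hl0]; exact (hψ.differentiableAt (by simp)).hasFDerivAt
      exact this.comp_hasDerivAt (0 : ℝ) hl
    have hψ2 : ∀ a : E4, HasDerivAt (fun t : ℝ ↦ fderiv ℝ ψ (y + t • w) a)
        (fderiv ℝ (fderiv ℝ ψ) y w a) 0 := by
      intro a
      have h1 : HasFDerivAt (fderiv ℝ ψ) (fderiv ℝ (fderiv ℝ ψ) y) (y + (0 : ℝ) • w) := by
        rw [hl0]
        exact ((hψ.fderiv_right (m := 1) (by norm_num)).differentiableAt (by simp)).hasFDerivAt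
      have h2 := HasFDerivAt.comp_hasDerivAt (F := E4) (E := E4 →L[ℝ] E4) (0 : ℝ) h1 hl
      simpa using h2.clm_apply (hasDerivAt_const (0 : ℝ) a)
    have hG1' : HasFDerivAt G₁ (fderiv ℝ G₁ (ψ y)) (ψ (y + (0 : ℝ) • w)) := by
      rw [hl0]; exact hG₁.hasFDerivAt
    have hR := hasDerivAt_bilin (c := fun t : ℝ ↦ ψ (y + t • w)) hG1' hψ1 (hψ2 u) (hψ2 v)
    have hG0' : HasFDerivAt G₀ (fderiv ℝ G₀ y) (y + (0 : ℝ) • w) := by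
      rw [hl0]; exact hG₀.hasFDerivAt
    have hL := hasDerivAt_bilin (c := fun t : ℝ ↦ y + t • w) hG0' hl
      (hasDerivAt_const (0 : ℝ) u) (hasDerivAt_const (0 : ℝ) v)
    have hcont : Tendsto (fun t : ℝ ↦ y + t • w) (𝓝 0) (𝓝 y) := by
      have := hl.continuousAt.tendsto
      rwa [hl0] at this
    have heq : (fun t : ℝ ↦ G₀ (y + t • w) u v) =ᶠ[𝓝 0] fun t ↦ G₁ (ψ (y + t • w))
        (fderiv ℝ ψ (y + t • w) u) (fderiv ℝ ψ (y + t • w) v) :=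
      (hcont.eventually h).mono fun t ht ↦ ht u v
    have := hL.unique (hR.congr_of_eventuallyEq heq)
    simpa using this
  have hsym : IsSymmSndFDerivAt ℝ ψ y := hψ.isSymmSndFDerivAt (by simp)
  obtain ⟨e, he⟩ := hi₁
  have hinj : Function.Injective (G₁ (ψ y)) := by rw [← he]; exact e.injective
  apply hinj
  ext w'
  obtain ⟨w, rfl⟩ := hsurj w'
  rw [← h.self_of_nhds, christoffel_apply hi₀, map_add, add_apply,
    christoffel_apply ⟨e, he⟩, hD, hD, hsym w u, hs₁ (fderiv ℝ ψ y u)]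
  ring

section transition

variable {x₀ x : M}

theorem contDiffAt_transition {y : E4} (hy : y ∈ (extChartAt (𝓡 4) x₀).target)
    (hx : (extChartAt (𝓡 4) x₀).symm y ∈ (extChartAt (𝓡 4) x).source) :
    ContDiffAt ℝ ∞ (extChartAt (𝓡 4) x ∘ (extChartAt (𝓡 4) x₀).symm) y := by
  rw [← contMDiffAt_iff_contDiffAt]
  rw [extChartAt_source] at hx
  exact (contMDiffAt_extChartAt' (I := 𝓡 4) (n := ∞) hx).comp y
    ((contMDiffOn_extChartAt_symm x₀ y hy).contMDiffAt ((isOpen_chart_target x₀).mem_nhds hy))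

theorem coordVec_chartFrame_transition {y : E4} (hy : y ∈ (extChartAt (𝓡 4) x₀).target)
    (hx : (extChartAt (𝓡 4) x₀).symm y ∈ (extChartAt (𝓡 4) x).source) (v : E4) :
    coordVec x _ (chartFrame x₀ y v) =
      fderiv ℝ (extChartAt (𝓡 4) x ∘ (extChartAt (𝓡 4) x₀).symm) y v := by
  have h1m : IsManifold (𝓡 4) 1 M := isManifold_one
  rw [extChartAt_source] at hx
  have h1 : MDifferentiableAt 𝓘(ℝ, E4) (𝓡 4) (extChartAt (𝓡 4) x₀).symm y :=
    (mdifferentiableOn_extChartAt_symm y hy).mdifferentiableAt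
      ((isOpen_chart_target x₀).mem_nhds hy)
  have h := mfderiv_comp y (mdifferentiableAt_extChartAt (I := 𝓡 4) hx) h1
  rw [mfderiv_eq_fderiv] at h
  exact (congrArg (fun f : E4 →L[ℝ] E4 ↦ f v) h).symm

theorem coordVec_transition {z : M} (hz₀ : z ∈ (extChartAt (𝓡 4) x₀).source)
    (hz : z ∈ (extChartAt (𝓡 4) x).source) (v : T z) :
    coordVec x z v = fderiv ℝ (extChartAt (𝓡 4) x ∘ (extChartAt (𝓡 4) x₀).symm)
      (extChartAt (𝓡 4) x₀ z) (coordVec x₀ z v) := by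
  obtain ⟨y, hy, rfl⟩ : ∃ y ∈ (extChartAt (𝓡 4) x₀).target, (extChartAt (𝓡 4) x₀).symm y = z :=
    ⟨_, (extChartAt (𝓡 4) x₀).map_source hz₀, (extChartAt (𝓡 4) x₀).left_inv hz₀⟩
  rw [(extChartAt (𝓡 4) x₀).right_inv hy, ← coordVec_chartFrame_transition hy hz,
    chartFrame_coordVec hy]

end transition

namespace LorentzMetric

variable (g : LorentzMetric M)

/-- The covariant acceleration can be computed in any chart. -/
theorem coordVec_acceleration_chart {γ : ℝ → M} {s : ℝ} {x₀ : M}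
    (hγ : ContMDiffAt 𝓘(ℝ, ℝ) (𝓡 4) 2 γ s) (hx₀ : γ s ∈ (extChartAt (𝓡 4) x₀).source) :
    coordVec x₀ (γ s) (g.acceleration γ s) =
      iteratedDeriv 2 (fun t ↦ extChartAt (𝓡 4) x₀ (γ t)) s
        + christoffel (coordTensor g.val x₀) (extChartAt (𝓡 4) x₀ (γ s))
          (coordVec x₀ (γ s) (velocity γ s)) (coordVec x₀ (γ s) (velocity γ s)) := by
  have hx := mem_extChartAt_source (I := 𝓡 4) (γ s)
  have hy := (extChartAt (𝓡 4) x₀).map_source hx₀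
  have hinv := (extChartAt (𝓡 4) x₀).left_inv hx₀
  set ψ := extChartAt (𝓡 4) (γ s) ∘ (extChartAt (𝓡 4) x₀).symm with hψdef
  set y := extChartAt (𝓡 4) x₀ (γ s) with hydef
  have hψy : ψ y = extChartAt (𝓡 4) (γ s) (γ s) := by
    rw [hψdef, Function.comp_apply, hinv]
  have hsrc : (extChartAt (𝓡 4) x₀).symm y ∈ (extChartAt (𝓡 4) (γ s)).source := by rwa [hinv]
  have hψ : ContDiffAt ℝ 2 ψ y := (contDiffAt_transition hy hsrc).of_le ENat.LEInfty.out
  have hP : ∀ v : T (γ s), coordVec (γ s) (γ s) v = fderiv ℝ ψ y (coordVec x₀ (γ s) v) :=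
    coordVec_transition hx₀ hx
  have hsurj : Function.Surjective (fderiv ℝ ψ y) := fun w ↦ by
    refine ⟨coordVec x₀ (γ s) (ofCoord (γ s) w), ?_⟩
    rw [← hP, coordVec_ofCoord]
  have hinj : Function.Injective (fderiv ℝ ψ y) :=
    (LinearMap.injective_iff_surjective (f := (fderiv ℝ ψ y).toLinearMap)).2 hsurj
  apply hinj
  rw [← hP, coordVec_acceleration, map_add, hP]
  have hev : ∀ᶠ z in 𝓝 y, ∀ u v, coordTensor g.val x₀ z u v =
      coordTensor g.val (γ s) (ψ z) (fderiv ℝ ψ z u) (fderiv ℝ ψ z v) := by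
    have hcont : ContinuousAt (extChartAt (𝓡 4) x₀).symm y :=
      (continuousOn_extChartAt_symm x₀).continuousAt ((isOpen_chart_target x₀).mem_nhds hy)
    filter_upwards [(isOpen_chart_target x₀).mem_nhds hy,
      hcont.eventually_mem ((isOpen_extChartAt_source (γ s)).mem_nhds hsrc)] with z hz hz' u v
    rw [coordTensor_apply, tensor_eq_coordTensor g.val hz', coordVec_chartFrame_transition hz hz',
      coordVec_chartFrame_transition hz hz']
    rfl
  have htr := christoffel_transition hψ hev (differentiableAt_coordTensor g.smooth hy)
    (by rw [hψy]; exact differentiableAt_coordTensor g.smooth (mem_extChartAt_target _))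
    (g.isInvertible_coordTensor hy)
    (by rw [hψy]; exact g.isInvertible_coordTensor (mem_extChartAt_target _))
    (fun v w ↦ g.coordTensor_symm _ _ _ _) hsurj (coordVec x₀ (γ s) (velocity γ s))
  have hc : ContDiffAt ℝ 2 (fun t ↦ extChartAt (𝓡 4) x₀ (γ t)) s :=
    contDiffAt_coord_curve ENat.LEInfty.out hγ hx₀
  have hd1 := (hc.differentiableAt (by simp)).hasDerivAt
  have hd2 := hasDerivAt_deriv_of_contDiffAt hc
  have hvel : coordVec x₀ (γ s) (velocity γ s) = deriv (fun t ↦ extChartAt (𝓡 4) x₀ (γ t)) s :=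
    coordVec_velocity (hγ.mdifferentiableAt (by simp)) hx₀
  have heq1 : deriv (fun t ↦ extChartAt (𝓡 4) (γ s) (γ t)) =ᶠ[𝓝 s] fun t ↦
      fderiv ℝ ψ (extChartAt (𝓡 4) x₀ (γ t)) (deriv (fun t ↦ extChartAt (𝓡 4) x₀ (γ t)) t) := by
    filter_upwards [eventually_contMDiffAt_two hγ hx₀, eventually_contMDiffAt_two hγ hx]
      with t ht ht'
    rw [← coordVec_velocity ht.2 ht.1, ← coordVec_velocity ht'.2 ht'.1]
    exact coordVec_transition ht.1 ht'.1 _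
  have h2 : iteratedDeriv 2 (fun t ↦ extChartAt (𝓡 4) (γ s) (γ t)) s =
      fderiv ℝ (fderiv ℝ ψ) y (deriv (fun t ↦ extChartAt (𝓡 4) x₀ (γ t)) s)
        (deriv (fun t ↦ extChartAt (𝓡 4) x₀ (γ t)) s)
      + fderiv ℝ ψ y (iteratedDeriv 2 (fun t ↦ extChartAt (𝓡 4) x₀ (γ t)) s) := by
    rw [iteratedDeriv_succ, iteratedDeriv_one, heq1.deriv_eq]
    have h3 : HasFDerivAt (fderiv ℝ ψ) (fderiv ℝ (fderiv ℝ ψ) y) (extChartAt (𝓡 4) x₀ (γ s)) :=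
      ((hψ.fderiv_right (m := 1) (by norm_num)).differentiableAt (by simp)).hasFDerivAt
    have h4 := HasFDerivAt.comp_hasDerivAt (F := E4) (E := E4 →L[ℝ] E4)
      (f := fun t ↦ extChartAt (𝓡 4) x₀ (γ t)) s h3 hd1
    exact (h4.clm_apply hd2).deriv
  -- The second derivative of the change of charts enters the left side through the coordinate
  -- acceleration and the right side through the Christoffel symbols, so it cancels.
  rw [h2, htr, hvel, hψy]
  unfold Γ
  abel

end LorentzMetric

end

section

variable {M : Type*} [TopologicalSpace M] [ChartedSpace E4 M] [IsManifold (𝓡 4) ∞ M]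

/-! ## Existence of worldlines -/

/-- A solution of an autonomous second order differential equation. -/
theorem exists_second_order_solution {U : Set E4} (hU : IsOpen U) {A : E4 × E4 → E4}
    (hA : ContDiffOn ℝ 1 A (U ×ˢ univ)) {y : E4} (hy : y ∈ U) (v : E4) :
    ∃ ε > 0, ∃ c : ℝ → E4, c 0 = y ∧ deriv c 0 = v ∧ ContDiffOn ℝ 2 c (Ioo (-ε) ε) ∧
      ∀ t ∈ Ioo (-ε) ε, c t ∈ U ∧ iteratedDeriv 2 c t = A (c t, deriv c t) := by
  have hopen : IsOpen (U ×ˢ (univ : Set E4)) := hU.prod isOpen_univ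
  -- The first order system for position and velocity.
  have hF : ContDiffOn ℝ 1 (fun p : E4 × E4 ↦ (p.2, A p)) (U ×ˢ univ) :=
    contDiffOn_snd.prodMk hA
  have hmem : (y, v) ∈ U ×ˢ (univ : Set E4) := ⟨hy, mem_univ _⟩
  obtain ⟨a, ha0, ε₀, hε₀, ha⟩ := (hF.contDiffAt (hopen.mem_nhds
    hmem)).exists_forall_mem_closedBall_exists_eq_forall_mem_Ioo_hasDerivAt₀ 0
  have hcont0 : ContinuousAt a 0 := (ha 0 (by constructor <;> linarith)).continuousAt
  have hev : ∀ᶠ t in 𝓝 (0 : ℝ), a t ∈ U ×ˢ (univ : Set E4) :=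
    hcont0.eventually_mem (hopen.mem_nhds (by rw [ha0]; exact hmem))
  obtain ⟨ε₁, hε₁, hball⟩ := Metric.eventually_nhds_iff.1 hev
  set ε := min ε₀ ε₁ with hε
  have hεpos : 0 < ε := lt_min hε₀ hε₁
  have hda : ∀ t ∈ Ioo (-ε) ε, HasDerivAt a ((a t).2, A (a t)) t := fun t ht ↦
    ha t ⟨by linarith [ht.1, min_le_left ε₀ ε₁], by linarith [ht.2, min_le_left ε₀ ε₁]⟩
  have hUa : ∀ t ∈ Ioo (-ε) ε, a t ∈ U ×ˢ (univ : Set E4) := fun t ht ↦ by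
    apply hball
    rw [Real.dist_eq, sub_zero, abs_lt]
    exact ⟨by linarith [ht.1, min_le_right ε₀ ε₁], by linarith [ht.2, min_le_right ε₀ ε₁]⟩
  have hd1 : ∀ t ∈ Ioo (-ε) ε, HasDerivAt (fun t ↦ (a t).1) (a t).2 t := fun t ht ↦
    (hda t ht).fst
  have hd2 : ∀ t ∈ Ioo (-ε) ε, HasDerivAt (fun t ↦ (a t).2) (A (a t)) t := fun t ht ↦
    (hda t ht).snd
  have hderiv : ∀ t ∈ Ioo (-ε) ε, deriv (fun t ↦ (a t).1) t = (a t).2 := fun t ht ↦ (hd1 t ht).deriv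
  have hca : ContinuousOn a (Ioo (-ε) ε) := fun t ht ↦ (hda t ht).continuousAt.continuousWithinAt
  -- Bootstrap: the velocity has the continuous derivative `A ∘ a`, so it is C¹ and the position is
  -- C².
  have h2C : ContDiffOn ℝ 1 (fun t ↦ (a t).2) (Ioo (-ε) ε) := by
    rw [show (1 : WithTop ℕ∞) = 0 + 1 by simp, contDiffOn_succ_iff_deriv_of_isOpen isOpen_Ioo]
    refine ⟨fun t ht ↦ (hd2 t ht).differentiableAt.differentiableWithinAt, by simp, ?_⟩
    rw [contDiffOn_zero]
    exact (hA.continuousOn.comp hca hUa).congr fun t ht ↦ (hd2 t ht).deriv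
  have h0 : (0 : ℝ) ∈ Ioo (-ε) ε := ⟨by linarith, hεpos⟩
  refine ⟨ε, hεpos, fun t ↦ (a t).1, by simp [ha0], by rw [hderiv 0 h0, ha0], ?_, fun t ht ↦ ?_⟩
  · rw [show (2 : WithTop ℕ∞) = 1 + 1 by norm_num, contDiffOn_succ_iff_deriv_of_isOpen isOpen_Ioo]
    refine ⟨fun t ht ↦ (hd1 t ht).differentiableAt.differentiableWithinAt, by simp, ?_⟩
    exact h2C.congr hderiv
  · refine ⟨(hUa t ht).1, ?_⟩
    have heq : deriv (fun t ↦ (a t).1) =ᶠ[𝓝 t] fun t ↦ (a t).2 := by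
      filter_upwards [isOpen_Ioo.mem_nhds ht] with t ht using hderiv t ht
    rw [iteratedDeriv_succ, iteratedDeriv_one, heq.deriv_eq, (hd2 t ht).deriv, hderiv t ht]

/-- The Christoffel term of the geodesic equation before the index is raised, as a function of
position and velocity. -/
theorem contDiffOn_koszul {E : Type*} [NormedAddCommGroup E] [NormedSpace ℝ E]
    [FiniteDimensional ℝ E] {G : E → E →L[ℝ] E →L[ℝ] ℝ} {U : Set E} (hG : ContDiffOn ℝ ∞ G U)
    (hU : IsOpen U) : ContDiffOn ℝ ∞ (fun p : E × E ↦ (1 / 2 : ℝ) •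
      (fderiv ℝ G p.1 p.2 p.2 + fderiv ℝ G p.1 p.2 p.2
        - ((fderiv ℝ G p.1).flip p.2).flip p.2)) (U ×ˢ univ) := by
  have h1 := hG.fderiv_of_isOpen (m := ∞) hU (by simp)
  have h2 := h1.comp (contDiffOn_fst (𝕜 := ℝ) (E := E) (F := E) (s := U ×ˢ univ))
    fun _ hp ↦ hp.1
  have h3 : ContDiffOn ℝ ∞ (fun p : E × E ↦ fderiv ℝ G p.1 p.2 p.2) (U ×ˢ univ) :=
    (h2.clm_apply contDiffOn_snd).clm_apply contDiffOn_snd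
  have h4 : ContDiffOn ℝ ∞ (fun p : E × E ↦ ((fderiv ℝ G p.1).flip p.2).flip p.2)
      (U ×ˢ univ) := by
    rw [contDiffOn_clm_apply]
    intro w
    exact ((h2.clm_apply contDiffOn_const).clm_apply contDiffOn_snd).clm_apply contDiffOn_snd
  exact ((h3.add h3).sub h4).const_smul (1 / 2 : ℝ)

namespace LorentzMetric

variable (g : LorentzMetric M)

theorem coordVec_injective_of_mem {x₀ x : M} (hx : x ∈ (extChartAt (𝓡 4) x₀).source) :
    Function.Injective (coordVec x₀ x) := by
  obtain ⟨y, hy, rfl⟩ : ∃ y ∈ (extChartAt (𝓡 4) x₀).target, (extChartAt (𝓡 4) x₀).symm y = x :=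
    ⟨_, (extChartAt (𝓡 4) x₀).map_source hx, (extChartAt (𝓡 4) x₀).left_inv hx⟩
  intro v w h
  rw [← chartFrame_coordVec hy v, h, chartFrame_coordVec hy]

theorem contDiffOn_christoffel (x₀ : M) :
    ContDiffOn ℝ ∞ (fun p : E4 × E4 ↦ christoffel (coordTensor g.val x₀) p.1 p.2 p.2)
      ((extChartAt (𝓡 4) x₀).target ×ˢ univ) :=
  ContDiffOn.clm_apply ((g.contDiffOn_inverse_coordTensor x₀).comp contDiffOn_fst fun _ hp ↦ hp.1)
    (contDiffOn_koszul (contDiffOn_coordTensor g.smooth x₀) (isOpen_chart_target x₀))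

/-- There is a local solution of the equations of motion with given initial data. -/
theorem exists_motion {f : M → ℝ} (hf : ContMDiff (𝓡 4) 𝓘(ℝ, ℝ) ∞ f) (x : M) (v : T x) :
    ∃ (γ : ℝ → M) (ε : ℝ), 0 < ε ∧ ContMDiffOn 𝓘(ℝ, ℝ) (𝓡 4) 2 γ (Ioo (-ε) ε) ∧
      (⟨γ 0, velocity γ 0⟩ : TangentBundle (𝓡 4) M) = ⟨x, v⟩ ∧
      ∀ s ∈ Ioo (-ε) ε, g.acceleration γ s = -(1 / 2 : ℝ) • g.grad f (γ s) := by
  have hx := mem_extChartAt_source (I := 𝓡 4) x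
  have hU := isOpen_chart_target x
  -- The acceleration prescribed by the equation of motion, in one fixed chart.
  set A : E4 × E4 → E4 := fun p ↦ -(1 / 2 : ℝ) • coordField (g.grad f) x p.1
    - christoffel (coordTensor g.val x) p.1 p.2 p.2 with hA
  have hAsm : ContDiffOn ℝ 1 A ((extChartAt (𝓡 4) x).target ×ˢ univ) := by
    have h1 : ContDiffOn ℝ ∞ (fun p : E4 × E4 ↦ coordField (g.grad f) x p.1)
        ((extChartAt (𝓡 4) x).target ×ˢ univ) :=
      (contDiffOn_coordField (g.smooth_grad hf) x).comp contDiffOn_fst fun p hp ↦ hp.1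
    exact ((h1.const_smul _).sub (g.contDiffOn_christoffel x)).of_le (by simp)
  obtain ⟨ε, hε, c, hc0, hc1, hcC, hc⟩ := exists_second_order_solution hU hAsm
    (mem_extChartAt_target x) (coordVec x x v)
  set γ : ℝ → M := fun t ↦ (extChartAt (𝓡 4) x).symm (c t) with hγ
  have hγ0 : γ 0 = x := by simp only [hγ, hc0]; exact (extChartAt (𝓡 4) x).left_inv hx
  have hsrc : ∀ s ∈ Ioo (-ε) ε, γ s ∈ (extChartAt (𝓡 4) x).source := fun s hs ↦
    (extChartAt (𝓡 4) x).map_target (hc s hs).1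
  have hφγ : ∀ s ∈ Ioo (-ε) ε, extChartAt (𝓡 4) x (γ s) = c s := fun s hs ↦
    (extChartAt (𝓡 4) x).right_inv (hc s hs).1
  have hγC : ContMDiffOn 𝓘(ℝ, ℝ) (𝓡 4) 2 γ (Ioo (-ε) ε) :=
    ((contMDiffOn_extChartAt_symm (n := ∞) x).of_le ENat.LEInfty.out).comp
      (contMDiffOn_iff_contDiffOn.2 hcC) fun s hs ↦ (hc s hs).1
  have hγA : ∀ s ∈ Ioo (-ε) ε, ContMDiffAt 𝓘(ℝ, ℝ) (𝓡 4) 2 γ s := fun s hs ↦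
    hγC.contMDiffAt (isOpen_Ioo.mem_nhds hs)
  have hev : ∀ s ∈ Ioo (-ε) ε, (fun t ↦ extChartAt (𝓡 4) x (γ t)) =ᶠ[𝓝 s] c := fun s hs ↦ by
    filter_upwards [isOpen_Ioo.mem_nhds hs] with t ht using hφγ t ht
  have hvel : ∀ s ∈ Ioo (-ε) ε, coordVec x (γ s) (velocity γ s) = deriv c s := fun s hs ↦ by
    rw [coordVec_velocity ((hγA s hs).mdifferentiableAt (by simp)) (hsrc s hs), (hev s hs).deriv_eq]
  have h0 : (0 : ℝ) ∈ Ioo (-ε) ε := ⟨by linarith, hε⟩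
  refine ⟨γ, ε, hε, hγC, ?_, fun s hs ↦ ?_⟩
  -- The two vectors live in the fibres over `γ 0` and over `x`; with a free base point `z` the
  -- fibres can be identified by substitution.
  · have key : ∀ z, z = x → ∀ w : T z, coordVec x z w = coordVec x x v →
        (⟨z, w⟩ : TangentBundle (𝓡 4) M) = ⟨x, v⟩ := by
      rintro z rfl w hw
      rw [coordVec_injective z hw]
    exact key _ hγ0 _ (by rw [hvel 0 h0, hc1])
  · apply coordVec_injective_of_mem (hsrc s hs)
    rw [g.coordVec_acceleration_chart (hγA s hs) (hsrc s hs), hvel s hs, hφγ s hs,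
      (hev s hs).iteratedDeriv_eq, (hc s hs).2, hA, map_smul, coordVec_field (hsrc s hs), hφγ s hs]
    exact sub_add_cancel _ _

/-- There is a curve with given velocity and vanishing acceleration at a point. -/
theorem exists_curve (x : M) (v : T x) :
    ∃ γ : ℝ → M, ContMDiffAt 𝓘(ℝ, ℝ) (𝓡 4) 2 γ 0 ∧
      (⟨γ 0, velocity γ 0⟩ : TangentBundle (𝓡 4) M) = ⟨x, v⟩ ∧ g.acceleration γ 0 = 0 := by
  obtain ⟨γ, ε, hε, hγ, hv, hacc⟩ := g.exists_motion (f := fun _ ↦ 0) contMDiff_const x v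
  have h0 : (0 : ℝ) ∈ Ioo (-ε) ε := ⟨by linarith, hε⟩
  refine ⟨γ, hγ.contMDiffAt (isOpen_Ioo.mem_nhds h0), hv, ?_⟩
  rw [hacc 0 h0]
  have : g.grad (fun _ ↦ (0 : ℝ)) (γ 0) = 0 := g.nondegenerate fun w ↦ by
    rw [val_grad, diff, mfderiv_const]; rfl
  rw [this, smul_zero]

end LorentzMetric

end

/-! ### Differentials of functions, Killing fields and foliations -/

section

variable {M : Type*} [TopologicalSpace M] [ChartedSpace E4 M] [IsManifold (𝓡 4) ∞ M]

theorem ContMDiff.mdifferentiableAt_of_smooth {f : M → ℝ} (hf : ContMDiff (𝓡 4) 𝓘(ℝ, ℝ) ∞ f) (x : M) :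
    MDifferentiableAt (𝓡 4) 𝓘(ℝ, ℝ) f x := (hf x).mdifferentiableAt (by simp)

theorem diff_mul {f h : M → ℝ} {x : M} (hf : MDifferentiableAt (𝓡 4) 𝓘(ℝ, ℝ) f x)
    (hh : MDifferentiableAt (𝓡 4) 𝓘(ℝ, ℝ) h x) (v : T x) :
    diff (fun z ↦ f z * h z) x v = f x * diff h x v + diff f x v * h x := by
  have h1 := (hf.hasMFDerivAt.mul hh.hasMFDerivAt).mfderiv
  have h2 : diff (fun z ↦ f z * h z) x = mfderiv (𝓡 4) 𝓘(ℝ, ℝ) (f * h) x := rfl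
  rw [h2, h1]
  exact congrArg (fun r : ℝ ↦ f x * diff h x v + r) (mul_comm (h x) (diff f x v))

theorem diff_const (c : ℝ) (x : M) (v : T x) : diff (fun _ ↦ c) x v = 0 := by
  unfold diff
  rw [mfderiv_const]
  rfl

theorem smoothVectorField_smul {f : M → ℝ} (hf : ContMDiff (𝓡 4) 𝓘(ℝ, ℝ) ∞ f)
    {X : ∀ x : M, T x} (hX : SmoothVectorField X) : SmoothVectorField fun x ↦ f x • X x := by
  refine smoothVectorField_of_coordField fun x₀ ↦ ?_
  refine ((contDiffOn_comp_chart_symm hf x₀).smul (contDiffOn_coordField hX x₀)).congr fun y _ ↦ ?_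
  unfold coordField
  rw [map_smul]
  rfl

namespace LorentzMetric

variable (g : LorentzMetric M)

/-- To prove a statement about tangent vectors, consider curves with vanishing acceleration. -/
theorem curve_induction {P : ∀ x : M, T x → Prop}
    (h : ∀ γ : ℝ → M, ContMDiffAt 𝓘(ℝ, ℝ) (𝓡 4) 2 γ 0 → g.acceleration γ 0 = 0 →
      P (γ 0) (velocity γ 0)) (x : M) (v : T x) : P x v := by
  obtain ⟨γ, hγ, hv, hacc⟩ := g.exists_curve x v
  have h1 := h γ hγ hacc
  change (fun q : TangentBundle (𝓡 4) M ↦ P q.1 q.2) ⟨γ 0, velocity γ 0⟩ at h1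
  rw [hv] at h1
  exact h1

/-- Polarization of the Killing equation. -/
theorem IsKilling.skew {g : LorentzMetric M} {X : ∀ x : M, T x} (hX : g.IsKilling X) (x : M)
    (u v : T x) : g.val x (g.covDeriv X x u) v = -g.val x (g.covDeriv X x v) u := by
  have h := hX.2 x (u + v)
  rw [covDeriv_add] at h
  simp only [map_add, add_apply, hX.2 x u, hX.2 x v] at h
  linarith

theorem contMDiff_diff (g : LorentzMetric M) {f : M → ℝ} (hf : ContMDiff (𝓡 4) 𝓘(ℝ, ℝ) ∞ f) {X : ∀ x : M, T x}
    (hX : SmoothVectorField X) : ContMDiff (𝓡 4) 𝓘(ℝ, ℝ) ∞ fun x ↦ diff f x (X x) :=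
  (contMDiff_tensor_apply g.smooth (g.smooth_grad hf) hX).congr fun x ↦ (g.val_grad f x _).symm

end LorentzMetric

namespace Foliation

variable {S : AxiStationary M} (F : Foliation S)

/-! ## The foliation parameter and its normals -/

/-- The squared norm of the gradient of the foliation parameter. -/
def gradSq (x : M) : ℝ := S.g.val x (S.g.grad F.Ω x) (S.g.grad F.Ω x)

theorem gradSq_pos (x : M) : 0 < F.gradSq x := F.spacelike x

theorem smooth_gradΩ : SmoothVectorField (S.g.grad F.Ω) := S.g.smooth_grad F.smooth

theorem contMDiff_gradSq : ContMDiff (𝓡 4) 𝓘(ℝ, ℝ) ∞ F.gradSq :=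
  contMDiff_tensor_apply S.g.smooth F.smooth_gradΩ F.smooth_gradΩ

theorem contMDiff_gradSq_inv : ContMDiff (𝓡 4) 𝓘(ℝ, ℝ) ∞ fun x ↦ (F.gradSq x)⁻¹ :=
  F.contMDiff_gradSq.inv₀ fun x ↦ (F.gradSq_pos x).ne'

theorem lapse_sq (x : M) : F.lapse x * F.lapse x = (F.gradSq x)⁻¹ := by
  unfold lapse
  rw [← mul_inv, Real.mul_self_sqrt (F.spacelike x).le]
  rfl

theorem lapse_pos (x : M) : 0 < F.lapse x := inv_pos.2 (Real.sqrt_pos.2 (F.spacelike x))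

/-- The square roots of `lapse` and `normal` cancel, which makes the flow visibly smooth. -/
theorem flow_eq (x : M) : F.flow x = (F.gradSq x)⁻¹ • S.g.grad F.Ω x := by
  unfold flow normal
  rw [smul_smul, F.lapse_sq]

theorem smooth_flow : SmoothVectorField F.flow := by
  have : F.flow = fun x ↦ (F.gradSq x)⁻¹ • S.g.grad F.Ω x := funext F.flow_eq
  rw [this]
  exact smoothVectorField_smul F.contMDiff_gradSq_inv F.smooth_gradΩ

theorem diff_Ω_grad (x : M) : diff F.Ω x (S.g.grad F.Ω x) = F.gradSq x := (S.g.val_grad _ _ _).symm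

theorem diff_Ω_flow (x : M) : diff F.Ω x (F.flow x) = 1 := by
  rw [flow_eq, map_smul, diff_Ω_grad, smul_eq_mul, inv_mul_cancel₀ (F.gradSq_pos x).ne']

theorem prime_mul_gradSq (f : M → ℝ) (x : M) :
    F.prime f x * F.gradSq x = diff f x (S.g.grad F.Ω x) := by
  unfold prime
  rw [flow_eq, map_smul, smul_eq_mul, mul_comm, ← mul_assoc, mul_inv_cancel₀ (F.gradSq_pos x).ne',
    one_mul]

theorem val_normal (x : M) (v : T x) : S.g.val x (F.normal x) v = F.lapse x * diff F.Ω x v := by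
  unfold normal
  rw [map_smul, smul_apply, S.g.val_grad, smul_eq_mul]

theorem contMDiff_prime {f : M → ℝ} (hf : ContMDiff (𝓡 4) 𝓘(ℝ, ℝ) ∞ f) :
    ContMDiff (𝓡 4) 𝓘(ℝ, ℝ) ∞ (F.prime f) := S.g.contMDiff_diff hf F.smooth_flow

/-- The derivative of a function along an integral curve of the normals. -/
theorem hasDerivAt_comp_flow {f : M → ℝ} {p : ℝ → M} {t : ℝ}
    (hf : MDifferentiableAt (𝓡 4) 𝓘(ℝ, ℝ) f (p t))
    (hp : HasMFDerivAt 𝓘(ℝ, ℝ) (𝓡 4) p t ((1 : ℝ →L[ℝ] ℝ).smulRight (F.flow (p t)))) :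
    HasDerivAt (fun t ↦ f (p t)) (F.prime f (p t)) t := by
  have h := hasDerivAt_comp_curve hf hp.mdifferentiableAt
  have hv : velocity p t = F.flow (p t) := by
    unfold velocity
    rw [hp.mfderiv]
    exact one_smul ℝ (F.flow (p t))
  rwa [hv] at h

/-- The leaf-transversal curve through a point, parametrized by the foliation parameter. -/
theorem exists_transversal (x : M) : ∃ p : ℝ → M, p (F.Ω x) = x ∧ ∀ᶠ t in 𝓝 (F.Ω x),
    F.Ω (p t) = t ∧ HasMFDerivAt 𝓘(ℝ, ℝ) (𝓡 4) p t ((1 : ℝ →L[ℝ] ℝ).smulRight (F.flow (p t))) := by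
  have : IsManifold (𝓡 4) 1 M := isManifold_one
  obtain ⟨p, hp0, hp⟩ := exists_isMIntegralCurveAt_of_contMDiffAt_boundaryless (t₀ := F.Ω x)
    (((F.smooth_flow x).of_le (by simp) :
      ContMDiffAt (𝓡 4) (𝓡 4).tangent 1 (fun x ↦ (⟨x, F.flow x⟩ : TangentBundle (𝓡 4) M)) x))
  refine ⟨p, hp0, ?_⟩
  obtain ⟨ε, hε, hball⟩ := Metric.eventually_nhds_iff_ball.1 hp
  filter_upwards [hp, Metric.ball_mem_nhds _ hε] with t ht htb
  refine ⟨?_, ht⟩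
  -- `Ω` grows at unit rate along the flow, so `Ω(p t) - t` is constant.
  have hd : ∀ s ∈ Metric.ball (F.Ω x) ε, HasDerivAt (fun t ↦ F.Ω (p t) - t) 0 s := fun s hs ↦ by
    have := (F.hasDerivAt_comp_flow (ContMDiff.mdifferentiableAt_of_smooth F.smooth _)
      (hball s hs)).sub (hasDerivAt_id s)
    rwa [prime, diff_Ω_flow, sub_self] at this
  have hconst := (convex_ball (F.Ω x) ε).is_const_of_fderivWithin_eq_zero (𝕜 := ℝ)
    (f := fun t ↦ F.Ω (p t) - t) (fun s hs ↦ (hd s hs).differentiableAt.differentiableWithinAt)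
    (fun s hs ↦ by
      rw [fderivWithin_of_isOpen Metric.isOpen_ball hs]
      ext; simp [(hd s hs).deriv])
    htb (Metric.mem_ball_self hε)
  simp only [hp0, sub_self] at hconst
  linarith

theorem isOpen_range_Ω : IsOpen (range F.Ω) := by
  rw [isOpen_iff_mem_nhds]
  rintro _ ⟨x, rfl⟩
  obtain ⟨p, -, hp⟩ := F.exists_transversal x
  filter_upwards [hp] with t ht using ⟨p t, ht.1⟩

/-- Near `x`, `f` is the composition of `Ω` with `t ↦ f (p t)` along a transversal; the chain rule
gives the claim. -/
theorem SliceConstant.diff_eq {F : Foliation S} {f : M → ℝ} (hf : F.SliceConstant f)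
    (hs : ContMDiff (𝓡 4) 𝓘(ℝ, ℝ) ∞ f) (x : M) (v : T x) :
    diff f x v = F.prime f x * diff F.Ω x v := by
  obtain ⟨p, hp0, hp⟩ := F.exists_transversal x
  -- The transversal is quantified inside the predicate, since the induction replaces `x` by the
  -- base point of a curve.
  refine S.g.curve_induction (P := fun x v ↦ ∀ p : ℝ → M, p (F.Ω x) = x →
    (∀ᶠ t in 𝓝 (F.Ω x), F.Ω (p t) = t ∧
      HasMFDerivAt 𝓘(ℝ, ℝ) (𝓡 4) p t ((1 : ℝ →L[ℝ] ℝ).smulRight (F.flow (p t)))) →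
    diff f x v = F.prime f x * diff F.Ω x v) ?_ x v p hp0 hp
  intro γ hγ _ p hp0 hp
  have hγd := hγ.mdifferentiableAt (by simp)
  have h1 := hasDerivAt_comp_curve (ContMDiff.mdifferentiableAt_of_smooth hs (γ 0)) hγd
  have h2 := hasDerivAt_comp_curve (ContMDiff.mdifferentiableAt_of_smooth F.smooth (γ 0)) hγd
  have h3 := F.hasDerivAt_comp_flow (ContMDiff.mdifferentiableAt_of_smooth hs _) hp.self_of_nhds.2
  have h4 := HasDerivAt.comp (h₂ := fun t ↦ f (p t)) (h := fun s ↦ F.Ω (γ s)) 0 h3 h2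
  rw [hp0] at h4
  refine h1.unique (h4.congr_of_eventuallyEq ?_)
  filter_upwards [h2.continuousAt.eventually hp] with s hs
  exact hf _ _ hs.1.symm

/-- Along transversals through two points of one slice, `f` is the same function of the parameter.
-/
theorem SliceConstant.prime {F : Foliation S} {f : M → ℝ} (hf : F.SliceConstant f)
    (hs : ContMDiff (𝓡 4) 𝓘(ℝ, ℝ) ∞ f) : F.SliceConstant (F.prime f) := by
  intro x y hxy
  obtain ⟨p, hp0, hp⟩ := F.exists_transversal x
  obtain ⟨q, hq0, hq⟩ := F.exists_transversal y
  have h1 := F.hasDerivAt_comp_flow (ContMDiff.mdifferentiableAt_of_smooth hs _) hp.self_of_nhds.2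
  have h2 := F.hasDerivAt_comp_flow (ContMDiff.mdifferentiableAt_of_smooth hs _) hq.self_of_nhds.2
  rw [hp0] at h1
  rw [hq0, ← hxy] at h2
  refine h1.unique (h2.congr_of_eventuallyEq ?_)
  rw [← hxy] at hq
  filter_upwards [hp, hq] with t ht ht'
  exact hf _ _ (ht.1.trans ht'.1.symm)

/-! ## Slice-reducible conformal Killing tensors -/

/-- The Hessian of the foliation parameter. -/
def hess (x : M) (u v : T x) : ℝ := S.g.val x (S.g.covDeriv (S.g.grad F.Ω) x u) v

theorem hess_symm (x : M) (u v : T x) : F.hess x u v = F.hess x v u :=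
  S.g.hessian_symm F.smooth x u v

theorem hess_add_left (x : M) (u v w : T x) : F.hess x (u + v) w = F.hess x u w + F.hess x v w := by
  unfold hess; rw [S.g.covDeriv_add]; simp

theorem hess_smul_left (x : M) (r : ℝ) (v w : T x) : F.hess x (r • v) w = r * F.hess x v w := by
  unfold hess; rw [S.g.covDeriv_smul]; simp

theorem hess_add_right (x : M) (u v w : T x) : F.hess x u (v + w) = F.hess x u v + F.hess x u w := by
  unfold hess; simp

theorem hess_smul_right (x : M) (r : ℝ) (v w : T x) : F.hess x v (r • w) = r * F.hess x v w := by
  unfold hess; simp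

theorem diff_gradSq (x : M) (v : T x) :
    diff F.gradSq x v = 2 * F.hess x v (S.g.grad F.Ω x) := by
  have := S.g.diff_val F.smooth_gradΩ F.smooth_gradΩ x v
  rw [S.g.symm x _ (S.g.covDeriv (S.g.grad F.Ω) x v)] at this
  unfold gradSq hess
  linarith

theorem val_grad_κ (x : M) (a : Fin 2) : S.g.val x (S.g.grad F.Ω x) (S.κ a x) = 0 := by
  rw [S.g.val_grad, F.tangent]

theorem val_κ_grad (x : M) (a : Fin 2) : S.g.val x (S.κ a x) (S.g.grad F.Ω x) = 0 := by
  rw [S.g.symm, val_grad_κ]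

/-- Obtained by differentiating `g(grad Ω, κ_a) = 0`. -/
theorem hess_κ (x : M) (v : T x) (a : Fin 2) :
    F.hess x v (S.κ a x) = -S.g.val x (S.g.grad F.Ω x) (S.g.covDeriv (S.κ a) x v) := by
  have h := S.g.diff_val F.smooth_gradΩ (S.killing a).1 x v
  have h0 : (fun z ↦ S.g.val z (S.g.grad F.Ω z) (S.κ a z)) = fun _ ↦ 0 :=
    funext fun z ↦ F.val_grad_κ z a
  rw [h0, diff_const] at h
  unfold hess
  linarith

theorem diff_gradSq_κ (x : M) (a : Fin 2) : diff F.gradSq x (S.κ a x) = 0 := by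
  rw [diff_gradSq, hess_symm, hess_κ, S.g.symm, (S.killing a).2, neg_zero, mul_zero]

/-- By the Killing equation, the derivative of `κ_a` along the gradient is exchanged for one along
`κ_b`. `hess_κ` turns the latter into a Hessian: this is the second fundamental form of the slices
on Killing vectors. -/
theorem diff_gram_grad (x : M) (a b : Fin 2) :
    diff (fun z ↦ S.gram z a b) x (S.g.grad F.Ω x) = 2 * F.hess x (S.κ a x) (S.κ b x) := by
  have h := S.g.diff_val (S.killing a).1 (S.killing b).1 x (S.g.grad F.Ω x)
  have h1 := (S.killing a).skew x (S.g.grad F.Ω x) (S.κ b x)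
  have h2 := (S.killing b).skew x (S.g.grad F.Ω x) (S.κ a x)
  rw [S.g.symm x (S.κ a x), h1, h2] at h
  have h3 := F.hess_κ x (S.κ b x) a
  have h4 := F.hess_κ x (S.κ a x) b
  rw [hess_symm] at h3
  rw [S.g.symm] at h3 h4
  have h5 : diff (fun z ↦ S.gram z a b) x (S.g.grad F.Ω x) =
    diff (fun z ↦ S.g.val z (S.κ a z) (S.κ b z)) x (S.g.grad F.Ω x) := rfl
  linarith

/-- The weight `e^Ψ φ²` of the squared rate of the foliation parameter. -/
def weight (Ψ : M → ℝ) (x : M) : ℝ := Real.exp (Ψ x) * (F.gradSq x)⁻¹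

theorem weight_pos (Ψ : M → ℝ) (x : M) : 0 < F.weight Ψ x :=
  mul_pos (Real.exp_pos _) (inv_pos.2 (F.gradSq_pos x))

theorem weight_mul_gradSq (Ψ : M → ℝ) (x : M) : F.weight Ψ x * F.gradSq x = Real.exp (Ψ x) := by
  unfold weight
  rw [mul_assoc, inv_mul_cancel₀ (F.gradSq_pos x).ne', mul_one]

section reducible

variable {F} {K : ∀ x : M, T x →L[ℝ] T x →L[ℝ] ℝ} {α : M → ℝ} {γ : Fin 2 → Fin 2 → M → ℝ} {Ψ : M → ℝ}
  {β : ∀ x : M, T x →L[ℝ] ℝ}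

theorem contMDiff_exp (hΨ : ContMDiff (𝓡 4) 𝓘(ℝ, ℝ) ∞ Ψ) :
    ContMDiff (𝓡 4) 𝓘(ℝ, ℝ) ∞ fun x ↦ Real.exp (Ψ x) :=
  Real.contDiff_exp.contMDiff.comp hΨ

theorem contMDiff_weight (F : Foliation S) (hΨ : ContMDiff (𝓡 4) 𝓘(ℝ, ℝ) ∞ Ψ) :
    ContMDiff (𝓡 4) 𝓘(ℝ, ℝ) ∞ (F.weight Ψ) :=
  (contMDiff_exp hΨ).mul F.contMDiff_gradSq_inv

theorem IsSliceReducible.apply_self (hK : F.IsSliceReducible K α γ Ψ) (x : M) (v : T x) :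
    K x v v = α x * S.g.val x v v
      + ∑ a, ∑ b, γ a b x * S.g.val x (S.κ a x) v * S.g.val x (S.κ b x) v
      + F.weight Ψ x * (diff F.Ω x v) ^ 2 := by
  rw [hK.form, val_normal, weight, ← lapse_sq]
  ring

/-- The fundamental identity satisfied by a slice-reducible conformal Killing tensor. -/
theorem IsSliceReducible.identity (hK : F.IsSliceReducible K α γ Ψ) (hKs : SmoothTensor K)
    (hβ : ∀ x v, S.g.covDerivTensor K x v v v = β x v * S.g.val x v v) (x : M) (v : T x) :
    β x v * S.g.val x v v = diff α x v * S.g.val x v v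
      + ∑ a, ∑ b, F.prime (γ a b) x * diff F.Ω x v
        * S.g.val x (S.κ a x) v * S.g.val x (S.κ b x) v
      + diff (F.weight Ψ) x v * (diff F.Ω x v) ^ 2
      + 2 * F.weight Ψ x * diff F.Ω x v * F.hess x v v := by
  refine S.g.curve_induction (P := fun x v ↦ β x v * S.g.val x v v = diff α x v * S.g.val x v v
      + ∑ a, ∑ b, F.prime (γ a b) x * diff F.Ω x v
        * S.g.val x (S.κ a x) v * S.g.val x (S.κ b x) v
      + diff (F.weight Ψ) x v * (diff F.Ω x v) ^ 2
      + 2 * F.weight Ψ x * diff F.Ω x v * F.hess x v v) ?_ x v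
  intro c hc hacc
  have hcd := hc.mdifferentiableAt (by simp)
  -- The derivative of `K(ċ,ċ)` at `0` is computed twice, from the conformal Killing equation and
  -- from the reducible form. Since the acceleration vanishes there, `g(ċ,ċ)` and the Killing
  -- momenta have zero derivative.
  have h1 := S.g.hasDerivAt_tensor_velocity hKs hc
  have h2 := S.g.hasDerivAt_tensor_velocity S.g.smooth hc
  have h3 : ∀ a, HasDerivAt (fun t ↦ S.g.val (c t) (S.κ a (c t)) (velocity c t)) 0 0 := fun a ↦ by
    have := S.g.hasDerivAt_field_velocity (S.killing a).1 hc
    rwa [(S.killing a).2, hacc, map_zero, add_zero] at this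
  have h4 := S.g.hasDerivAt_field_velocity F.smooth_gradΩ hc
  rw [hacc, hβ] at h1
  rw [hacc, S.g.covDerivTensor_val] at h2
  rw [hacc, map_zero, add_zero] at h4
  simp only [map_zero, zero_apply, add_zero] at h1 h2
  have h5 := hasDerivAt_comp_curve (ContMDiff.mdifferentiableAt_of_smooth hK.smooth_α (c 0)) hcd
  have h6 : ∀ a b, HasDerivAt (fun t ↦ γ a b (c t))
      (F.prime (γ a b) (c 0) * diff F.Ω (c 0) (velocity c 0)) 0 := fun a b ↦ by
    rw [← (hK.const_γ a b).diff_eq (hK.smooth_γ a b)]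
    exact hasDerivAt_comp_curve (ContMDiff.mdifferentiableAt_of_smooth (hK.smooth_γ a b) (c 0)) hcd
  have h7 := hasDerivAt_comp_curve
    (ContMDiff.mdifferentiableAt_of_smooth (F.contMDiff_weight hK.smooth_Ψ) (c 0)) hcd
  have h8 := ((h5.mul h2).add (HasDerivAt.fun_sum (u := Finset.univ) fun a _ ↦
    HasDerivAt.fun_sum (u := Finset.univ) fun b _ ↦ ((h6 a b).mul (h3 a)).mul (h3 b))).add
      (h7.mul (h4.pow 2))
  have h9 := h1.unique (h8.congr_of_eventuallyEq (.of_forall fun t ↦ by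
    simp only [Pi.add_apply, Pi.mul_apply, Pi.pow_apply]
    rw [hK.apply_self, S.g.val_grad]))
  rw [h9]
  simp only [S.g.val_grad, hess, Pi.mul_apply, Pi.pow_apply]
  simp
  ring

end reducible

end Foliation

end

/-! ### Solving the conformal Killing equation -/

section

variable {M : Type*} [TopologicalSpace M] [ChartedSpace E4 M] [IsManifold (𝓡 4) ∞ M]

namespace Foliation

variable {S : AxiStationary M} {F : Foliation S}
  {K : ∀ x : M, T x →L[ℝ] T x →L[ℝ] ℝ} {α : M → ℝ} {γ : Fin 2 → Fin 2 → M → ℝ} {Ψ : M → ℝ}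
  {β : ∀ x : M, T x →L[ℝ] ℝ}

theorem diff_exp_eq (hΨ : ContMDiff (𝓡 4) 𝓘(ℝ, ℝ) ∞ Ψ) (x : M) (v : T x) :
    diff (fun z ↦ Real.exp (Ψ z)) x v =
      F.weight Ψ x * diff F.gradSq x v + diff (F.weight Ψ) x v * F.gradSq x := by
  rw [← diff_mul (ContMDiff.mdifferentiableAt_of_smooth (F.contMDiff_weight hΨ) x)
    (ContMDiff.mdifferentiableAt_of_smooth F.contMDiff_gradSq x)]
  simp only [weight_mul_gradSq]

/-- On a slice, the conformal factor of the tensor is determined by `α`. -/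
theorem IsSliceReducible.conformal_tangent (hK : F.IsSliceReducible K α γ Ψ) (hKs : SmoothTensor K)
    (hβ : ∀ x v, S.g.covDerivTensor K x v v v = β x v * S.g.val x v v) (x : M) (v : T x)
    (hv : diff F.Ω x v = 0) : β x v = diff α x v := by
  -- On tangent vectors the identity collapses to `(β - dα)(v) g(v,v) = 0`, so only null vectors
  -- need an argument.
  have key : ∀ v : T x, diff F.Ω x v = 0 → (β x v - diff α x v) * S.g.val x v v = 0 := by
    intro v hv
    have h := hK.identity hKs hβ x v
    rw [hv] at h
    simp only [mul_zero, zero_mul, Finset.sum_const_zero, add_zero, ne_eq, OfNat.ofNat_ne_zero,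
      not_false_eq_true, zero_pow] at h
    linarith
  by_contra hne
  have hl : β x v - diff α x v ≠ 0 := sub_ne_zero.2 hne
  have hnull : S.g.val x v v = 0 := (mul_eq_zero.1 (key v hv)).resolve_left hl
  have hv0 : v ≠ 0 := by
    rintro rfl
    simp at hne
  obtain ⟨w₀, hw₀⟩ : ∃ w, S.g.val x v w ≠ 0 := by
    by_contra! hall
    exact hv0 (S.g.nondegenerate hall)
  -- A vector tangent to the slice and not orthogonal to the null vector `v`, made tangent by a
  -- correction along the flow.
  set w := w₀ - (diff F.Ω x w₀) • F.flow x with hw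
  have hΩw : diff F.Ω x w = 0 := by rw [hw, map_sub, map_smul, diff_Ω_flow]; simp
  have hvflow : S.g.val x v (F.flow x) = 0 := by
    rw [S.g.symm, flow_eq, map_smul, smul_apply, S.g.val_grad, hv, smul_zero]
  have hvw : S.g.val x v w ≠ 0 := by rwa [hw, map_sub, map_smul, hvflow, smul_zero, sub_zero]
  have hpoly : ∀ t : ℝ, ((β x v - diff α x v) + t * (β x w - diff α x w)) *
      (2 * t * S.g.val x v w + t ^ 2 * S.g.val x w w) = 0 := by
    intro t
    have h := key (v + t • w) (by rw [map_add, map_smul, hv, hΩw]; simp)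
    simp only [map_add, map_smul, add_apply, smul_apply, smul_eq_mul, hnull,
      S.g.symm x w v] at h
    linear_combination h
  have h1 := hpoly 1
  have h2 := hpoly (-1)
  have h3 := hpoly 2
  -- The left side of `hpoly` is a cubic in `t` without constant term. Its values at 1, -1, 2
  -- isolate the linear coefficient, which is twice this product.
  have : (β x v - diff α x v) * (S.g.val x v w) = 0 := by
    linear_combination (1 / 2 : ℝ) * h1 - (1 / 6 : ℝ) * h2 - (1 / 12 : ℝ) * h3
  exact (mul_ne_zero hl hvw) this

/-- The conformal factor of the tensor. -/
theorem IsSliceReducible.conformal_eq (hK : F.IsSliceReducible K α γ Ψ) (hKs : SmoothTensor K)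
    (hβ : ∀ x v, S.g.covDerivTensor K x v v v = β x v * S.g.val x v v) (x : M) (v : T x) :
    β x v = diff α x v + F.prime (fun z ↦ Real.exp (Ψ z)) x * diff F.Ω x v := by
  set Z := S.g.grad F.Ω x with hZ
  have hk := F.gradSq_pos x
  have hZZ : S.g.val x Z Z = F.gradSq x := rfl
  -- On the gradient the Killing terms vanish and `2 hess(Z,Z)` is the derivative of `gradSq`, so
  -- the remaining terms form the derivative of `weight * gradSq = e^Ψ`. The rest of `v` is tangent
  -- to the slice.
  have h1 := hK.identity hKs hβ x Z
  simp only [F.val_κ_grad, hZ, mul_zero, Finset.sum_const_zero, add_zero, F.diff_Ω_grad] at h1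
  rw [← hZ, hZZ] at h1
  have h2 := F.diff_gradSq x Z
  have h3 := diff_exp_eq (F := F) hK.smooth_Ψ x Z
  rw [← hZ] at h2
  have h4 := F.prime_mul_gradSq (fun z ↦ Real.exp (Ψ z)) x
  rw [← hZ] at h4
  have h5 : β x Z = diff α x Z + diff (fun z ↦ Real.exp (Ψ z)) x Z := by
    apply mul_right_cancel₀ hk.ne'
    rw [h1, h3, h2]
    ring
  have h6 : diff F.Ω x (v - (diff F.Ω x v * (F.gradSq x)⁻¹) • Z) = 0 := by
    rw [map_sub, map_smul, hZ, F.diff_Ω_grad, smul_eq_mul, mul_assoc, inv_mul_cancel₀ hk.ne']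
    ring
  have h7 := hK.conformal_tangent hKs hβ x _ h6
  simp only [map_sub, map_smul, smul_eq_mul, h5, ← h4] at h7
  have h8 : diff F.Ω x v * (F.gradSq x)⁻¹ * (F.prime (fun z ↦ Real.exp (Ψ z)) x * F.gradSq x) =
      F.prime (fun z ↦ Real.exp (Ψ z)) x * diff F.Ω x v := by
    field_simp
  linear_combination h7 + h8

/-- The quadratic form whose vanishing is equivalent to the conformal Killing equation. -/
theorem IsSliceReducible.quadratic_identity (hK : F.IsSliceReducible K α γ Ψ) (hKs : SmoothTensor K)
    (hβ : ∀ x v, S.g.covDerivTensor K x v v v = β x v * S.g.val x v v) (x : M) (v : T x) :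
    F.prime (fun z ↦ Real.exp (Ψ z)) x * S.g.val x v v =
      ∑ a, ∑ b, F.prime (γ a b) x * S.g.val x (S.κ a x) v * S.g.val x (S.κ b x) v
      + diff (F.weight Ψ) x v * diff F.Ω x v + 2 * F.weight Ψ x * F.hess x v v := by
  -- Once `β` is known, every remaining term of the fundamental identity has the factor `dΩ(v)`,
  -- which can be cancelled where it is nonzero.
  have key : ∀ v : T x, diff F.Ω x v ≠ 0 → F.prime (fun z ↦ Real.exp (Ψ z)) x * S.g.val x v v =
      ∑ a, ∑ b, F.prime (γ a b) x * S.g.val x (S.κ a x) v * S.g.val x (S.κ b x) v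
      + diff (F.weight Ψ) x v * diff F.Ω x v + 2 * F.weight Ψ x * F.hess x v v := by
    intro v hv
    have h1 := hK.identity hKs hβ x v
    rw [hK.conformal_eq hKs hβ] at h1
    apply mul_left_cancel₀ hv
    simp only [Fin.sum_univ_two] at h1 ⊢
    linear_combination h1
  by_cases hv : diff F.Ω x v = 0
  swap
  · exact key v hv
  set Z := S.g.grad F.Ω x with hZ
  have hk := F.gradSq_pos x
  -- Tangent vectors are reached as limits of `v + t grad Ω`: both sides are quadratic in `t`, and
  -- the values at 1, -1, 2 determine the constant coefficient.
  have hpoly : ∀ t : ℝ, t ≠ 0 → F.prime (fun z ↦ Real.exp (Ψ z)) x *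
      (S.g.val x v v + t ^ 2 * F.gradSq x) =
      ∑ a, ∑ b, F.prime (γ a b) x * S.g.val x (S.κ a x) v * S.g.val x (S.κ b x) v
      + (diff (F.weight Ψ) x v + t * diff (F.weight Ψ) x Z) * (t * F.gradSq x)
      + 2 * F.weight Ψ x * (F.hess x v v + 2 * t * F.hess x v Z + t ^ 2 * F.hess x Z Z) := by
    intro t ht
    have hZZ : S.g.val x Z Z = F.gradSq x := rfl
    have hvZ : S.g.val x v Z = 0 := by rw [S.g.symm, hZ, S.g.val_grad, hv]
    have hZv : S.g.val x Z v = 0 := by rw [S.g.symm, hvZ]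
    have h := key (v + t • Z) (by
      rw [map_add, map_smul, hv, hZ, F.diff_Ω_grad, zero_add, smul_eq_mul]
      exact mul_ne_zero ht hk.ne')
    have h1 : ∀ a, S.g.val x (S.κ a x) (v + t • Z) = S.g.val x (S.κ a x) v := fun a ↦ by
      rw [map_add, map_smul, hZ, F.val_κ_grad, smul_zero, add_zero]
    have h2 : S.g.val x (v + t • Z) (v + t • Z) = S.g.val x v v + t ^ 2 * F.gradSq x := by
      simp only [map_add, map_smul, add_apply, smul_apply, smul_eq_mul, hZZ, hvZ, hZv]
      ring
    have h3 : F.hess x (v + t • Z) (v + t • Z) =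
        F.hess x v v + 2 * t * F.hess x v Z + t ^ 2 * F.hess x Z Z := by
      simp only [hess_add_left, hess_add_right, hess_smul_left, hess_smul_right]
      rw [F.hess_symm x Z v]
      ring
    have h4 : diff F.Ω x (v + t • Z) = t * F.gradSq x := by
      rw [map_add, map_smul, hv, hZ, F.diff_Ω_grad, zero_add, smul_eq_mul]
    simp only [h1] at h
    rw [h2, h3, h4, map_add, map_smul, smul_eq_mul] at h
    exact h
  have h1 := hpoly 1 one_ne_zero
  have h2 := hpoly (-1) (by norm_num)
  have h3 := hpoly 2 two_ne_zero
  rw [hv, mul_zero, add_zero]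
  linear_combination h1 + (1 / 3 : ℝ) * h2 - (1 / 3 : ℝ) * h3

/-- The mixed term of `quadratic_identity` between a tangent vector and the gradient. It says that
`weight * gradSq²`, which is `e^Ψ |∇Ω|²`, has zero derivative along the slices. -/
theorem IsSliceReducible.diff_weight_tangent (hK : F.IsSliceReducible K α γ Ψ) (hKs : SmoothTensor K)
    (hβ : ∀ x v, S.g.covDerivTensor K x v v v = β x v * S.g.val x v v) (x : M) (v : T x)
    (hv : diff F.Ω x v = 0) :
    F.gradSq x * diff (F.weight Ψ) x v + 2 * F.weight Ψ x * diff F.gradSq x v = 0 := by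
  set Z := S.g.grad F.Ω x with hZ
  have h0 := hK.quadratic_identity hKs hβ x v
  have h1 := hK.quadratic_identity hKs hβ x (v + Z)
  have h2 := hK.quadratic_identity hKs hβ x Z
  have e1 : ∀ a, S.g.val x (S.κ a x) (v + Z) = S.g.val x (S.κ a x) v := fun a ↦ by
    rw [map_add, hZ, F.val_κ_grad, add_zero]
  have e1' : ∀ a, S.g.val x (S.κ a x) Z = 0 := fun a ↦ by rw [hZ, F.val_κ_grad]
  have hvZ : S.g.val x v Z = 0 := by rw [S.g.symm, hZ, S.g.val_grad, hv]
  have hZv : S.g.val x Z v = 0 := by rw [S.g.symm, hvZ]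
  have e2 : S.g.val x (v + Z) (v + Z) = S.g.val x v v + S.g.val x Z Z := by
    simp only [map_add, add_apply, hvZ, hZv]
    ring
  have e3 : F.hess x (v + Z) (v + Z) = F.hess x v v + 2 * F.hess x v Z + F.hess x Z Z := by
    simp only [hess_add_left, hess_add_right]
    rw [F.hess_symm x Z v]
    ring
  have e4 : diff F.Ω x Z = F.gradSq x := F.diff_Ω_grad x
  simp only [e1] at h1
  simp only [e1', mul_zero, Finset.sum_const_zero, zero_add] at h2
  rw [e2, e3, map_add, map_add, hv, e4] at h1
  rw [hv] at h0
  rw [e4] at h2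
  rw [F.diff_gradSq x v]
  linear_combination h0 + h2 - h1

theorem IsSliceReducible.diff_weight_κ (hK : F.IsSliceReducible K α γ Ψ) (hKs : SmoothTensor K)
    (hβ : ∀ x v, S.g.covDerivTensor K x v v v = β x v * S.g.val x v v) (x : M) (a : Fin 2) :
    diff (F.weight Ψ) x (S.κ a x) = 0 := by
  have h := hK.diff_weight_tangent hKs hβ x _ (F.tangent a x)
  rw [F.diff_gradSq_κ, mul_zero, add_zero] at h
  exact (mul_eq_zero.1 h).resolve_left (F.gradSq_pos x).ne'

/-- The evolution of the Gram matrix of the Killing vectors along the normals. -/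
theorem IsSliceReducible.prime_gram (hK : F.IsSliceReducible K α γ Ψ) (hKs : SmoothTensor K)
    (hβ : ∀ x v, S.g.covDerivTensor K x v v v = β x v * S.g.val x v v) (x : M) (w : Fin 2 → ℝ) :
    F.prime (fun z ↦ Real.exp (Ψ z)) x * ∑ a, ∑ b, w a * w b * S.gram x a b =
      ∑ a, ∑ b, F.prime (γ a b) x * (∑ c, S.gram x a c * w c) * (∑ c, S.gram x b c * w c)
      + Real.exp (Ψ x) * ∑ a, ∑ b, w a * w b * F.prime (fun z ↦ S.gram z a b) x := by
  -- A combination of Killing vectors is tangent to the slice, so the differential of the weight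
  -- drops out and the Hessian becomes the rate of the Gram matrix. With `q = G w` the result is
  -- `(e^Ψ G^ab)' = (γ^ab)'` evaluated on `q`.
  have h := hK.quadratic_identity hKs hβ x (∑ a, w a • S.κ a x)
  have hΩ : diff F.Ω x (∑ a, w a • S.κ a x) = 0 := by simp [F.tangent]
  have hexp := F.weight_mul_gradSq Ψ x
  have hκ : ∀ a, S.g.val x (S.κ a x) (∑ a, w a • S.κ a x) = ∑ c, S.gram x a c * w c := fun a ↦ by
    simp [AxiStationary.gram, mul_comm]
  have hg : S.g.val x (∑ a, w a • S.κ a x) (∑ a, w a • S.κ a x) =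
      ∑ a, ∑ b, w a * w b * S.gram x a b := by
    simp only [Fin.sum_univ_two, map_add, map_smul, add_apply, smul_apply, smul_eq_mul,
      AxiStationary.gram, Matrix.of_apply]
    ring
  have hh : F.weight Ψ x * (2 * F.hess x (∑ a, w a • S.κ a x) (∑ a, w a • S.κ a x)) =
      Real.exp (Ψ x) * ∑ a, ∑ b, w a * w b * F.prime (fun z ↦ S.gram z a b) x := by
    have e : ∀ a b, F.prime (fun z ↦ S.gram z a b) x * F.gradSq x =
        2 * F.hess x (S.κ a x) (S.κ b x) := fun a b ↦ by
      rw [F.prime_mul_gradSq, F.diff_gram_grad]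
    rw [← hexp]
    simp only [Fin.sum_univ_two, hess_add_left, hess_add_right, hess_smul_left, hess_smul_right]
    linear_combination -F.weight Ψ x * (w 0 * w 0 * e 0 0 + w 0 * w 1 * e 0 1 + w 1 * w 0 * e 1 0
      + w 1 * w 1 * e 1 1)
  simp only [hκ] at h
  rw [hg, hΩ, mul_zero, add_zero] at h
  rw [h, ← hh]
  ring

end Foliation

end

/-! ### Dynamics across the slices -/

section

variable {M : Type*} [TopologicalSpace M] [ChartedSpace E4 M] [IsManifold (𝓡 4) ∞ M]

namespace Foliation

variable {S : AxiStationary M} {F : Foliation S}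
  {K : ∀ x : M, T x →L[ℝ] T x →L[ℝ] ℝ} {α : M → ℝ} {γ : Fin 2 → Fin 2 → M → ℝ} {Ψ : M → ℝ}
  {β : ∀ x : M, T x →L[ℝ] ℝ} {m : M → ℝ} {q : Fin 2 → ℝ} {c : ℝ → M} {I : Set ℝ} {s : ℝ}

/-- A slice-reducible conformal Killing tensor with conformal factor `β`, together with a mass
compatible with it. -/
structure IsReduced (F : Foliation S) (K : ∀ x : M, T x →L[ℝ] T x →L[ℝ] ℝ) (α : M → ℝ)
    (γ : Fin 2 → Fin 2 → M → ℝ) (Ψ : M → ℝ) (β : ∀ x : M, T x →L[ℝ] ℝ) (m : M → ℝ) : Prop where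
  reducible : F.IsSliceReducible K α γ Ψ
  smooth : SmoothTensor K
  conformal : ∀ x v, S.g.covDerivTensor K x v v v = β x v * S.g.val x v v
  smooth_mass : ContMDiff (𝓡 4) 𝓘(ℝ, ℝ) ∞ fun x ↦ m x ^ 2
  mass_κ : ∀ a x, diff (fun z ↦ m z ^ 2) x (S.κ a x) = 0
  const_mass : F.SliceConstant (F.prime fun x ↦ Real.exp (Ψ x) * m x ^ 2)

/-- The exact case is a conformal one with `β = 0`. Then `conformal_eq` gives `(e^Ψ)' = -α'`, so
`(e^Ψ m²)' = -α' m²` is constant on slices because `α` is and `m` is constant. -/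
theorem Integrable.exists_isReduced (hK : F.IsSliceReducible K α γ Ψ)
    (hm : ContMDiff (𝓡 4) 𝓘(ℝ, ℝ) ∞ fun x ↦ m x ^ 2) (h : F.Integrable K α Ψ m) :
    ∃ β, F.IsReduced K α γ Ψ β m := by
  rcases h with ⟨⟨hKs, -, h0⟩, hα, hmc⟩ | ⟨⟨hKs, -, β, hβ⟩, hmκ, hmp⟩
  · have hβ : ∀ x v, S.g.covDerivTensor K x v v v =
        (0 : ∀ x : M, T x →L[ℝ] ℝ) x v * S.g.val x v v := fun x v ↦ by
      rw [h0]; simp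
    have hdm : ∀ x v, diff (fun z ↦ m z ^ 2) x v = 0 := fun x v ↦ by
      have : (fun z ↦ m z ^ 2) = fun _ ↦ m x ^ 2 := funext fun z ↦ by rw [hmc z x]
      rw [this, diff_const]
    have hexp : ∀ x, F.prime (fun z ↦ Real.exp (Ψ z)) x = -F.prime α x := fun x ↦ by
      have := hK.conformal_eq hKs hβ x (F.flow x)
      rw [F.diff_Ω_flow] at this
      simp only [Pi.zero_apply, zero_apply] at this
      unfold prime at this ⊢
      linarith
    refine ⟨0, hK, hKs, hβ, hm, fun a x ↦ hdm x _, fun x y hxy ↦ ?_⟩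
    have hp : ∀ x, F.prime (fun x ↦ Real.exp (Ψ x) * m x ^ 2) x = -F.prime α x * m x ^ 2 := by
      intro x
      unfold prime
      rw [diff_mul (ContMDiff.mdifferentiableAt_of_smooth (contMDiff_exp hK.smooth_Ψ) x)
        (ContMDiff.mdifferentiableAt_of_smooth hm x), hdm, mul_zero, zero_add]
      have := hexp x
      unfold prime at this
      rw [this]
    rw [hp, hp, hα.prime hK.smooth_α x y hxy, hmc x y]
  · exact ⟨β, hK, hKs, hβ, hm, hmκ, hmp⟩

/-- The force on a particle with conserved quantities `q`, orthogonal to the slices. -/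
def force (F : Foliation S) (γ : Fin 2 → Fin 2 → M → ℝ) (Ψ m : M → ℝ) (q : Fin 2 → ℝ) (x : M) : ℝ :=
  (∑ a, ∑ b, F.prime (γ a b) x * q a * q b) + F.prime (fun z ↦ Real.exp (Ψ z) * m z ^ 2) x

/-- The part of the Killing tensor normal to the slices, along a curve. -/
def kinetic (F : Foliation S) (Ψ : M → ℝ) (c : ℝ → M) (s : ℝ) : ℝ :=
  F.weight Ψ (c s) * (diff F.Ω (c s) (velocity c s)) ^ 2

theorem kinetic_nonneg (F : Foliation S) (Ψ : M → ℝ) (c : ℝ → M) (s : ℝ) : 0 ≤ F.kinetic Ψ c s :=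
  mul_nonneg (F.weight_pos _ _).le (sq_nonneg _)

namespace IsReduced

variable (h : F.IsReduced K α γ Ψ β m)
include h

theorem force_const (q : Fin 2 → ℝ) : F.SliceConstant (F.force γ Ψ m q) := by
  intro x y hxy
  unfold force
  rw [h.const_mass x y hxy]
  congr 1
  refine Finset.sum_congr rfl fun a _ ↦ Finset.sum_congr rfl fun b _ ↦ ?_
  rw [(h.reducible.const_γ a b).prime (h.reducible.smooth_γ a b) x y hxy]

theorem contMDiff_force (q : Fin 2 → ℝ) : ContMDiff (𝓡 4) 𝓘(ℝ, ℝ) ∞ (F.force γ Ψ m q) := by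
  have h1 : ∀ a b, ContMDiff (𝓡 4) 𝓘(ℝ, ℝ) ∞ fun x ↦ F.prime (γ a b) x * q a * q b := fun a b ↦
    ((F.contMDiff_prime (h.reducible.smooth_γ a b)).mul contMDiff_const).mul contMDiff_const
  have h2 := F.contMDiff_prime ((contMDiff_exp h.reducible.smooth_Ψ).mul h.smooth_mass)
  have h3 : F.force γ Ψ m q = fun x ↦ ((F.prime (γ 0 0) x * q 0 * q 0 + F.prime (γ 0 1) x * q 0 * q 1)
      + (F.prime (γ 1 0) x * q 1 * q 0 + F.prime (γ 1 1) x * q 1 * q 1))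
      + F.prime (fun z ↦ Real.exp (Ψ z) * m z ^ 2) x := by
    funext x
    simp only [force, Fin.sum_univ_two]
  rw [h3]
  exact (((h1 0 0).add (h1 0 1)).add ((h1 1 0).add (h1 1 1))).add h2

end IsReduced

theorem contMDiffAt_worldline (hw : S.g.IsWorldline m c I) (hs : s ∈ I) :
    ContMDiffAt 𝓘(ℝ, ℝ) (𝓡 4) 2 c s := hw.smooth.contMDiffAt (hw.isOpen.mem_nhds hs)

theorem hasDerivAt_Ω_worldline (F : Foliation S) (hw : S.g.IsWorldline m c I) (hs : s ∈ I) :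
    HasDerivAt (fun t ↦ F.Ω (c t)) (diff F.Ω (c s) (velocity c s)) s :=
  hasDerivAt_comp_curve (ContMDiff.mdifferentiableAt_of_smooth F.smooth _)
    ((contMDiffAt_worldline hw hs).mdifferentiableAt (by simp))

namespace IsReduced

variable (h : F.IsReduced K α γ Ψ β m)
include h

theorem hasDerivAt_momentum (hw : S.g.IsWorldline m c I) (hs : s ∈ I) (a : Fin 2) :
    HasDerivAt (fun t ↦ S.g.val (c t) (S.κ a (c t)) (velocity c t)) 0 s := by
  have := S.g.hasDerivAt_field_velocity (S.killing a).1 (contMDiffAt_worldline hw hs)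
  rwa [(S.killing a).2, hw.motion s hs, map_smul, S.g.symm _ (S.κ a _), S.g.val_grad, h.mass_κ,
    smul_zero, add_zero] at this

theorem momentum_const (hw : S.g.IsWorldline m c I) {s t : ℝ} (hs : s ∈ I) (ht : t ∈ I)
    (a : Fin 2) : S.g.val (c t) (S.κ a (c t)) (velocity c t) =
      S.g.val (c s) (S.κ a (c s)) (velocity c s) :=
  hw.isOpen.is_const_of_deriv_eq_zero hw.ordConnected.isPreconnected
    (fun _ hu ↦ (h.hasDerivAt_momentum hw hu a).differentiableAt.differentiableWithinAt)
    (fun _ hu ↦ (h.hasDerivAt_momentum hw hu a).deriv) ht hs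

/-- `kinetic` is `K(ċ,ċ)` minus its `α` and `γ^ab` parts. With `g(ċ,ċ) = -m²`, the term `dα` of the
conformal factor cancels the derivative of `α`, leaving `-(e^Ψ)' m² dΩ(ċ)`. The acceleration
contributes `-e^Ψ (m²)' dΩ(ċ)`, and `γ^ab` contributes its own rate. -/
theorem hasDerivAt_kinetic (hw : S.g.IsWorldline m c I) (hs : s ∈ I)
    (hq : ∀ a, S.g.val (c s) (S.κ a (c s)) (velocity c s) = q a) :
    HasDerivAt (F.kinetic Ψ c)
      (-(diff F.Ω (c s) (velocity c s) * F.force γ Ψ m q (c s))) s := by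
  have hc := contMDiffAt_worldline hw hs
  have hcd := hc.mdifferentiableAt (by simp)
  have hK := h.reducible
  have h1 := S.g.hasDerivAt_tensor_velocity h.smooth hc
  have h2 := S.g.hasDerivAt_tensor_velocity S.g.smooth hc
  have h3 := h.hasDerivAt_momentum hw hs
  have h5 := hasDerivAt_comp_curve (ContMDiff.mdifferentiableAt_of_smooth hK.smooth_α (c s)) hcd
  have h6 : ∀ a b, HasDerivAt (fun t ↦ γ a b (c t))
      (F.prime (γ a b) (c s) * diff F.Ω (c s) (velocity c s)) s := fun a b ↦ by
    rw [← (hK.const_γ a b).diff_eq (hK.smooth_γ a b)]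
    exact hasDerivAt_comp_curve (ContMDiff.mdifferentiableAt_of_smooth (hK.smooth_γ a b) (c s)) hcd
  have h8 := (h1.sub (h5.mul h2)).sub (HasDerivAt.fun_sum (u := Finset.univ) fun a _ ↦
    HasDerivAt.fun_sum (u := Finset.univ) fun b _ ↦ ((h6 a b).mul (h3 a)).mul (h3 b))
  refine (h8.congr_of_eventuallyEq (.of_forall fun t ↦ ?_)).congr_deriv ?_
  · simp only [Pi.sub_apply, Pi.mul_apply]
    rw [hK.apply_self, kinetic]
    ring
  · have hκ : ∀ a, S.g.val (c s) (S.κ a (c s)) (S.g.acceleration c s) = 0 := fun a ↦ by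
      rw [hw.motion s hs, map_smul, S.g.symm _ (S.κ a _), S.g.val_grad, h.mass_κ, smul_zero]
    have hΩ : diff F.Ω (c s) (S.g.acceleration c s) =
        -(1 / 2) * (F.prime (fun z ↦ m z ^ 2) (c s) * F.gradSq (c s)) := by
      rw [hw.motion s hs, map_smul, ← S.g.val_grad F.Ω, S.g.symm, S.g.val_grad,
        F.prime_mul_gradSq, smul_eq_mul]
    have hl := F.lapse_sq (c s)
    have hexp := F.weight_mul_gradSq Ψ (c s)
    have hprime : F.prime (fun z ↦ Real.exp (Ψ z) * m z ^ 2) (c s) =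
        Real.exp (Ψ (c s)) * F.prime (fun z ↦ m z ^ 2) (c s) +
        F.prime (fun z ↦ Real.exp (Ψ z)) (c s) * m (c s) ^ 2 :=
      diff_mul (ContMDiff.mdifferentiableAt_of_smooth (contMDiff_exp hK.smooth_Ψ) _)
        (ContMDiff.mdifferentiableAt_of_smooth h.smooth_mass _) _
    have hKacc : K (c s) (S.g.acceleration c s) (velocity c s) =
        α (c s) * S.g.val (c s) (S.g.acceleration c s) (velocity c s) +
        F.weight Ψ (c s) * diff F.Ω (c s) (S.g.acceleration c s) *
          diff F.Ω (c s) (velocity c s) := by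
      rw [hK.form]
      simp only [hκ, mul_zero, zero_mul, Finset.sum_const_zero, add_zero, val_normal]
      rw [weight, ← hl]
      ring
    have hKacc' : K (c s) (velocity c s) (S.g.acceleration c s) =
        α (c s) * S.g.val (c s) (S.g.acceleration c s) (velocity c s) +
        F.weight Ψ (c s) * diff F.Ω (c s) (S.g.acceleration c s) *
          diff F.Ω (c s) (velocity c s) := by
      rw [hK.form]
      simp only [hκ, mul_zero, Finset.sum_const_zero, add_zero, val_normal]
      rw [weight, ← hl, S.g.symm _ (velocity c s)]
      ring
    rw [hKacc, hKacc', h.conformal, S.g.covDerivTensor_val,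
      hK.conformal_eq h.smooth h.conformal, hΩ, hw.norm s hs,
      S.g.symm _ (velocity c s) (S.g.acceleration c s)]
    simp only [force, hprime, hq, Pi.mul_apply, Fin.sum_univ_two]
    rw [← hexp]
    ring

/-- The force is at most proportional to the distance from a slice on which it vanishes. -/
theorem force_isBigO {x : M} (hx : F.force γ Ψ m q x = 0) :
    ∃ C, ∀ᶠ z in 𝓝 x, |F.force γ Ψ m q z| ≤ C * |F.Ω z - F.Ω x| := by
  obtain ⟨p, hp0, hp⟩ := F.exists_transversal x
  have h1 := F.hasDerivAt_comp_flow
    (ContMDiff.mdifferentiableAt_of_smooth (h.contMDiff_force q) _) hp.self_of_nhds.2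
  obtain ⟨C, hC⟩ := h1.isBigO_sub.bound
  refine ⟨C, ?_⟩
  -- The estimate holds along a transversal by differentiability and spreads over the slices because
  -- the force is constant on them.
  filter_upwards [F.smooth.continuous.continuousAt.eventually (hC.and hp)] with z hz
  have h2 : F.force γ Ψ m q (p (F.Ω z)) = F.force γ Ψ m q z := h.force_const q _ _ hz.2.1
  rw [hp0, hx, sub_zero, h2] at hz
  exact hz.1

end IsReduced

/-- Uniqueness for linear differential inequalities. -/
theorem eventually_eq_zero_of_abs_deriv_le {e e' : ℝ → ℝ} {s C : ℝ}
    (hd : ∀ᶠ t in 𝓝 s, HasDerivAt e (e' t) t) (hle : ∀ᶠ t in 𝓝 s, |e' t| ≤ C * |e t|)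
    (h0 : e s = 0) : ∀ᶠ t in 𝓝 s, e t = 0 := by
  obtain ⟨ε, hε, hball⟩ := Metric.eventually_nhds_iff_ball.1 (hd.and hle)
  filter_upwards [Metric.ball_mem_nhds s hε] with t ht
  rw [Real.ball_eq_Ioo] at hball ht
  rcases le_total s t with hst | hts
  · have hsub : Icc s t ⊆ Ioo (s - ε) (s + ε) := fun u hu ↦
      ⟨by linarith [hu.1], lt_of_le_of_lt hu.2 ht.2⟩
    exact eq_zero_of_abs_deriv_le_mul_abs_self_of_eq_zero_right (f := e) (f' := e') (K := C)
      (fun u hu ↦ (hball u (hsub hu)).1.continuousAt.continuousWithinAt)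
      (fun u hu ↦ (hball u (hsub (Ico_subset_Icc_self hu))).1.hasDerivWithinAt) h0
      (fun u hu ↦ (hball u (hsub (Ico_subset_Icc_self hu))).2) t ⟨hst, le_rfl⟩
  -- The estimate runs forwards only; earlier parameters are handled by reversing the curve.
  · have hsub : ∀ u ∈ Icc (-s) (-t), -u ∈ Ioo (s - ε) (s + ε) := fun u hu ↦
      ⟨by linarith [hu.2, ht.1], by linarith [hu.1]⟩
    have := eq_zero_of_abs_deriv_le_mul_abs_self_of_eq_zero_right (f := fun u ↦ e (-u))
      (f' := fun u ↦ -e' (-u)) (K := C) (a := -s) (b := -t)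
      (fun u hu ↦ ((hball _ (hsub u hu)).1.continuousAt.comp
        (f := fun u : ℝ ↦ -u) continuous_neg.continuousAt).continuousWithinAt)
      (fun u hu ↦ ((hball _ (hsub u (Ico_subset_Icc_self hu))).1.comp u
        (hasDerivAt_neg u)).hasDerivWithinAt.congr_deriv (by ring)) (by simpa using h0)
      (fun u hu ↦ by
        simpa using (hball _ (hsub u (Ico_subset_Icc_self hu))).2) (-t) ⟨neg_le_neg hts, le_rfl⟩
    simpa using this

/-- A continuous function whose zeros are all interior vanishes on a preconnected set, once it has
a zero there. -/
theorem eq_zero_of_eventually_eq_zero {e : ℝ → ℝ} {I : Set ℝ} (hI : IsPreconnected I)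
    (hc : ∀ t ∈ I, ContinuousAt e t) (hloc : ∀ t ∈ I, e t = 0 → ∀ᶠ u in 𝓝 t, e u = 0) {s : ℝ}
    (hs : s ∈ I) (h0 : e s = 0) : ∀ t ∈ I, e t = 0 := by
  have hsub : I ⊆ {t | ∀ᶠ u in 𝓝 t, e u = 0} := by
    refine hI.subset_of_closure_inter_subset isOpen_setOfPred_eventually_nhds
      ⟨s, hs, hloc s hs h0⟩ ?_
    rintro t ⟨htc, htI⟩
    refine hloc t htI ?_
    have hfr : ∃ᶠ u in 𝓝 t, e u ∈ ({0} : Set ℝ) :=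
      (mem_closure_iff_frequently.1 htc).mono fun u hu ↦ by
        simpa using (show ∀ᶠ v in 𝓝 u, e v = 0 from hu).self_of_nhds
    simpa using isClosed_singleton.mem_of_frequently_of_tendsto hfr (hc t htI)
  exact fun t ht ↦ (show ∀ᶠ u in 𝓝 t, e u = 0 from hsub ht).self_of_nhds

namespace IsReduced

variable (h : F.IsReduced K α γ Ψ β m)
include h

/-- Grönwall's inequality for the energy `kinetic + (Ω - Ω(c s))²`. Both terms of its derivative are
bounded by a multiple of `|Ω - Ω(c s)| |dΩ(ċ)|`, since the force vanishes to first order at the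
slice, and this product is controlled by the energy. -/
theorem eventually_on_slice (hw : S.g.IsWorldline m c I) (hs : s ∈ I)
    (hq : ∀ a, S.g.val (c s) (S.κ a (c s)) (velocity c s) = q a)
    (hforce : F.force γ Ψ m q (c s) = 0) (hΩ : diff F.Ω (c s) (velocity c s) = 0) :
    ∀ᶠ t in 𝓝 s, F.kinetic Ψ c t + (F.Ω (c t) - F.Ω (c s)) ^ 2 = 0 := by
  have hI : ∀ᶠ t in 𝓝 s, t ∈ I := hw.isOpen.mem_nhds hs
  have hcont : ContinuousAt c s := (contMDiffAt_worldline hw hs).continuousAt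
  obtain ⟨C, hC⟩ := h.force_isBigO hforce
  set w := F.weight Ψ (c s) / 2 with hw_def
  have hw0 : 0 < w := half_pos (F.weight_pos _ _)
  have hweight : ∀ᶠ t in 𝓝 s, w < F.weight Ψ (c t) :=
    ((F.contMDiff_weight h.reducible.smooth_Ψ).continuous.continuousAt.comp hcont).eventually_const_lt
      (half_lt_self (F.weight_pos _ _))
  -- The factor `2 + |C|` bounds the derivative by `|u| |d|`; the factor `1 + w⁻¹` comes from `|u|
  -- |d| ≤ u² + d²` and `d² ≤ w⁻¹ kinetic`.
  refine eventually_eq_zero_of_abs_deriv_le (C := (2 + |C|) * (1 + w⁻¹))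
    (e' := fun t ↦ -(diff F.Ω (c t) (velocity c t) * F.force γ Ψ m q (c t)) +
      2 * (F.Ω (c t) - F.Ω (c s)) * diff F.Ω (c t) (velocity c t)) ?_ ?_ ?_
  · filter_upwards [hI] with t ht
    have h1 := h.hasDerivAt_kinetic hw ht (q := q) fun a ↦ (h.momentum_const hw hs ht a).trans (hq a)
    have h2 := ((hasDerivAt_Ω_worldline F hw ht).sub_const (F.Ω (c s))).pow 2
    refine (h1.add h2).congr_deriv ?_
    simp
  · filter_upwards [hcont.eventually hC, hweight] with t ht hwt
    set d := diff F.Ω (c t) (velocity c t)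
    set u := F.Ω (c t) - F.Ω (c s)
    have hk : w * d ^ 2 ≤ F.kinetic Ψ c t := mul_le_mul_of_nonneg_right hwt.le (sq_nonneg d)
    have hd : d ^ 2 ≤ w⁻¹ * F.kinetic Ψ c t := by
      rw [inv_mul_eq_div, le_div_iff₀ hw0]
      linarith
    have hkn := F.kinetic_nonneg Ψ c t
    have hwi : 0 < w⁻¹ := inv_pos.2 hw0
    rw [abs_of_nonneg (add_nonneg hkn (sq_nonneg u))]
    have h1 : |(-(d * F.force γ Ψ m q (c t)) + 2 * u * d)| ≤ (2 + |C|) * (|u| * |d|) := by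
      have h3 : |F.force γ Ψ m q (c t)| ≤ |C| * |u| :=
        ht.trans (mul_le_mul_of_nonneg_right (le_abs_self C) (abs_nonneg u))
      calc _ ≤ |(-(d * F.force γ Ψ m q (c t)))| + |2 * u * d| := abs_add_le _ _
        _ = |d| * |F.force γ Ψ m q (c t)| + 2 * |u| * |d| := by simp [abs_mul]
        _ ≤ |d| * (|C| * |u|) + 2 * |u| * |d| := by gcongr
        _ = _ := by ring
    have h2 : |u| * |d| ≤ (1 + w⁻¹) * (F.kinetic Ψ c t + u ^ 2) := by
      have : |u| * |d| ≤ u ^ 2 + d ^ 2 := by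
        nlinarith [sq_nonneg (|u| - |d|), sq_abs u, sq_abs d, sq_nonneg u, sq_nonneg d]
      have h4 : 0 ≤ w⁻¹ * u ^ 2 := by positivity
      nlinarith
    calc _ ≤ (2 + |C|) * (|u| * |d|) := h1
      _ ≤ (2 + |C|) * ((1 + w⁻¹) * (F.kinetic Ψ c t + u ^ 2)) := by gcongr
      _ = _ := by ring
  · simp [kinetic, hΩ]

/-- A worldline touching a slice on which the force vanishes belongs to the slice. -/
theorem mem_slice_of_force_eq_zero {r : ℝ} (ht : F.Touches m r q c I s)
    (hforce : F.force γ Ψ m q (c s) = 0) : ∀ t ∈ I, c t ∈ F.slice r := by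
  have hw := ht.worldline
  set e := fun t ↦ F.kinetic Ψ c t + (F.Ω (c t) - r) ^ 2 with he
  have hz : ∀ t, e t = 0 → F.Ω (c t) = r ∧ diff F.Ω (c t) (velocity c t) = 0 := by
    intro t h0
    have h1 := F.kinetic_nonneg Ψ c t
    have h2 := sq_nonneg (F.Ω (c t) - r)
    have h3 : F.kinetic Ψ c t = 0 := by simp only [he] at h0; linarith
    have h4 : (F.Ω (c t) - r) ^ 2 = 0 := by simp only [he] at h0; linarith
    refine ⟨sub_eq_zero.1 (pow_eq_zero_iff two_ne_zero |>.1 h4), ?_⟩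
    exact pow_eq_zero_iff two_ne_zero |>.1
      ((mul_eq_zero.1 h3).resolve_left (F.weight_pos _ _).ne')
  -- At any zero of `e` the curve is tangent to the same slice, where the force vanishes too, so the
  -- local statement applies again.
  have hloc : ∀ t ∈ I, e t = 0 → ∀ᶠ u in 𝓝 t, e u = 0 := by
    intro t htI h0
    obtain ⟨h1, h2⟩ := hz t h0
    have h3 : F.force γ Ψ m q (c t) = 0 := by
      rw [← hforce]
      exact h.force_const q _ _ (h1.trans ht.on_slice.symm)
    have := h.eventually_on_slice hw htI
      (fun a ↦ (h.momentum_const hw ht.mem htI a).trans (ht.conserved a)) h3 h2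
    rwa [h1] at this
  have hcont : ∀ t ∈ I, ContinuousAt e t := fun t htI ↦
    ((h.hasDerivAt_kinetic hw htI (q := q) fun a ↦
      (h.momentum_const hw ht.mem htI a).trans (ht.conserved a)).add
      (((hasDerivAt_Ω_worldline F hw htI).sub_const r).pow 2)).continuousAt
  have h1 : F.Ω (c s) = r := ht.on_slice
  exact fun t htI ↦ (hz t (eq_zero_of_eventually_eq_zero hw.ordConnected.isPreconnected hcont hloc
    ht.mem (by simp [he, kinetic, ht.tangent, h1]) t htI)).1

/-- The force vanishes along a worldline belonging to a slice. -/
theorem force_eq_zero_of_mem_slice {r : ℝ} (ht : F.Touches m r q c I s)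
    (hmem : ∀ t ∈ I, c t ∈ F.slice r) : F.force γ Ψ m q (c s) = 0 := by
  have hw := ht.worldline
  have hI : ∀ᶠ t in 𝓝 s, t ∈ I := hw.isOpen.mem_nhds ht.mem
  have h0 : ∀ᶠ t in 𝓝 s, diff F.Ω (c t) (velocity c t) = 0 := by
    filter_upwards [hI] with t htI
    refine (hasDerivAt_Ω_worldline F hw htI).unique ((hasDerivAt_const t r).congr_of_eventuallyEq ?_)
    filter_upwards [hw.isOpen.mem_nhds htI] with u hu using hmem u hu
  -- Differentiating `g(grad Ω, ċ) = 0` expresses `hess(ċ,ċ)` by the rate of `m²`. Inserted in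
  -- `quadratic_identity`, this leaves the force.
  have h1 := S.g.hasDerivAt_field_velocity F.smooth_gradΩ (contMDiffAt_worldline hw ht.mem)
  have h2 := h1.unique ((hasDerivAt_const s (0 : ℝ)).congr_of_eventuallyEq (by
    filter_upwards [h0] with t ht0
    rw [S.g.val_grad, ht0]))
  have h3 := h.reducible.quadratic_identity h.smooth h.conformal (c s) (velocity c s)
  rw [hw.motion s ht.mem, map_smul, S.g.symm _ (S.g.grad F.Ω (c s)), S.g.val_grad, smul_eq_mul] at h2
  rw [ht.tangent, mul_zero, add_zero, hw.norm s ht.mem] at h3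
  have h4 := F.prime_mul_gradSq (fun z ↦ m z ^ 2) (c s)
  have h5 := F.weight_mul_gradSq Ψ (c s)
  have hprime : F.prime (fun z ↦ Real.exp (Ψ z) * m z ^ 2) (c s) =
      Real.exp (Ψ (c s)) * F.prime (fun z ↦ m z ^ 2) (c s) +
      F.prime (fun z ↦ Real.exp (Ψ z)) (c s) * m (c s) ^ 2 :=
    diff_mul (ContMDiff.mdifferentiableAt_of_smooth (contMDiff_exp h.reducible.smooth_Ψ) _)
      (ContMDiff.mdifferentiableAt_of_smooth h.smooth_mass _) _
  rw [← h4] at h2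
  simp only [ht.conserved] at h3
  unfold force
  rw [hprime, ← h5]
  unfold hess at h3
  linear_combination -h3 - 2 * F.weight Ψ (c s) * h2

end IsReduced

end Foliation

namespace LorentzMetric

/-- A particle can be sent in every direction allowed by its mass. -/
theorem exists_isWorldline (g : LorentzMetric M) {m : M → ℝ}
    (hm : ContMDiff (𝓡 4) 𝓘(ℝ, ℝ) ∞ fun x ↦ m x ^ 2) (x : M) (v : T x)
    (hv : g.val x v v = -(m x) ^ 2) : ∃ (c : ℝ → M) (I : Set ℝ), g.IsWorldline m c I ∧ (0 : ℝ) ∈ I ∧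
      (⟨c 0, velocity c 0⟩ : TangentBundle (𝓡 4) M) = ⟨x, v⟩ := by
  obtain ⟨c, ε, hε, hc, hv0, hacc⟩ := g.exists_motion hm x v
  have h0 : (0 : ℝ) ∈ Ioo (-ε) ε := ⟨neg_lt_zero.2 hε, hε⟩
  refine ⟨c, Ioo (-ε) ε, ⟨isOpen_Ioo, ordConnected_Ioo, hc, hacc, ?_⟩, h0, hv0⟩
  -- The mass shell condition need only hold initially: `g(ċ,ċ) + m²` is conserved by the equation
  -- of motion.
  have hd : ∀ s ∈ Ioo (-ε) ε, HasDerivAt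
      (fun t ↦ g.val (c t) (velocity c t) (velocity c t) + (m (c t)) ^ 2) 0 s := by
    intro s hs
    have hcs := hc.contMDiffAt (isOpen_Ioo.mem_nhds hs)
    have h1 := g.hasDerivAt_tensor_velocity g.smooth hcs
    have h2 := hasDerivAt_comp_curve (ContMDiff.mdifferentiableAt_of_smooth hm (c s))
      (hcs.mdifferentiableAt (by simp))
    refine (h1.add h2).congr_deriv ?_
    rw [g.covDerivTensor_val, g.symm _ (velocity c s), hacc s hs, map_smul, smul_apply, g.val_grad,
      smul_eq_mul]
    ring
  intro s hs
  have h1 := isOpen_Ioo.is_const_of_deriv_eq_zero isPreconnected_Ioo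
    (fun u hu ↦ (hd u hu).differentiableAt.differentiableWithinAt)
    (fun u hu ↦ (hd u hu).deriv) hs h0
  have h2 : g.val (c 0) (velocity c 0) (velocity c 0) + (m (c 0)) ^ 2 = 0 := by
    change (fun q : TangentBundle (𝓡 4) M ↦ g.val q.1 q.2 q.2 + m q.1 ^ 2) ⟨c 0, velocity c 0⟩ = 0
    rw [hv0]
    change g.val x v v + m x ^ 2 = 0
    rw [hv]
    ring
  simp only [h2] at h1
  linarith

end LorentzMetric

end

/-! ### The Gram and shadow matrices along the normals -/

section

variable {M : Type*} [TopologicalSpace M] [ChartedSpace E4 M] [IsManifold (𝓡 4) ∞ M]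

theorem quad_fin_two (A : Matrix (Fin 2) (Fin 2) ℝ) (ρ : Fin 2 → ℝ) :
    quad A ρ = A 0 0 * ρ 0 ^ 2 + (A 0 1 + A 1 0) * ρ 0 * ρ 1 + A 1 1 * ρ 1 ^ 2 := by
  simp only [quad, Matrix.mulVec, dotProduct, Fin.sum_univ_two]
  ring

theorem quad_smul (A : Matrix (Fin 2) (Fin 2) ℝ) (r : ℝ) (ρ : Fin 2 → ℝ) :
    quad A (r • ρ) = r ^ 2 * quad A ρ := by
  simp only [quad_fin_two, Pi.smul_apply, smul_eq_mul]
  ring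

theorem quad_sub (A B : Matrix (Fin 2) (Fin 2) ℝ) (ρ : Fin 2 → ℝ) :
    quad (A - B) ρ = quad A ρ - quad B ρ := by
  simp only [quad_fin_two, Matrix.sub_apply]
  ring

theorem dotProduct_fin_two (v w : Fin 2 → ℝ) : v ⬝ᵥ w = v 0 * w 0 + v 1 * w 1 := by
  simp [dotProduct, Fin.sum_univ_two]

theorem inv_apply_fin_two (A : Matrix (Fin 2) (Fin 2) ℝ) :
    A⁻¹ = A.det⁻¹ • !![A 1 1, -A 0 1; -A 1 0, A 0 0] := by
  rw [Matrix.inv_def, Matrix.adjugate_fin_two, Ring.inverse_eq_inv']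

theorem quad_inv (A : Matrix (Fin 2) (Fin 2) ℝ) (hA : A 1 0 = A 0 1) (ρ : Fin 2 → ℝ) :
    quad A⁻¹ ρ =
      A.det⁻¹ * (A 1 1 * ρ 0 ^ 2 - 2 * A 0 1 * ρ 0 * ρ 1 + A 0 0 * ρ 1 ^ 2) := by
  rw [quad_fin_two, inv_apply_fin_two]
  simp [hA]
  ring

namespace AxiStationary

variable (S : AxiStationary M)

theorem gram_symm (x : M) (a b : Fin 2) : S.gram x a b = S.gram x b a := S.g.symm _ _ _

theorem contMDiff_gram (a b : Fin 2) : ContMDiff (𝓡 4) 𝓘(ℝ, ℝ) ∞ fun x ↦ S.gram x a b :=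
  contMDiff_tensor_apply S.g.smooth (S.killing a).1 (S.killing b).1

theorem det_gram (x : M) :
    (S.gram x).det = S.gram x 0 0 * S.gram x 1 1 - S.gram x 0 1 * S.gram x 0 1 := by
  rw [Matrix.det_fin_two, S.gram_symm x 1 0]

theorem contMDiff_det_gram : ContMDiff (𝓡 4) 𝓘(ℝ, ℝ) ∞ fun x ↦ (S.gram x).det := by
  simp only [S.det_gram]
  exact ((S.contMDiff_gram 0 0).mul (S.contMDiff_gram 1 1)).sub
    ((S.contMDiff_gram 0 1).mul (S.contMDiff_gram 0 1))

end AxiStationary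

namespace Foliation.IsReduced

variable {S : AxiStationary M} {F : Foliation S}
  {K : ∀ x : M, T x →L[ℝ] T x →L[ℝ] ℝ} {α : M → ℝ} {γ : Fin 2 → Fin 2 → M → ℝ} {Ψ : M → ℝ}
  {β : ∀ x : M, T x →L[ℝ] ℝ} {m : M → ℝ} {p : ℝ → M} {J : Set ℝ} {t : ℝ}
  (h : F.IsReduced K α γ Ψ β m)
include h

/-- The determinant of the Gram matrix satisfies a linear differential equation along the
normals. -/
theorem hasDerivAt_det_gram
    (hp : HasMFDerivAt 𝓘(ℝ, ℝ) (𝓡 4) p t ((1 : ℝ →L[ℝ] ℝ).smulRight (F.flow (p t)))) :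
    HasDerivAt (fun t ↦ (S.gram (p t)).det)
      ((Real.exp (-Ψ (p t)) * (2 * F.prime (fun z ↦ Real.exp (Ψ z)) (p t) -
        (F.prime (γ 0 0) (p t) * S.gram (p t) 0 0 + F.prime (γ 0 1) (p t) * S.gram (p t) 0 1 +
          F.prime (γ 1 0) (p t) * S.gram (p t) 0 1 + F.prime (γ 1 1) (p t) * S.gram (p t) 1 1))) *
        (S.gram (p t)).det) t := by
  have hd := fun a b ↦ F.hasDerivAt_comp_flow
    (ContMDiff.mdifferentiableAt_of_smooth (S.contMDiff_gram a b) (p t)) hp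
  simp only [S.det_gram]
  refine (((hd 0 0).mul (hd 1 1)).sub ((hd 0 1).mul (hd 0 1))).congr_deriv ?_
  -- These three test vectors determine the rates of all entries of the symmetric Gram matrix.
  have h1 := h.reducible.prime_gram h.smooth h.conformal (p t) ![1, 0]
  have h2 := h.reducible.prime_gram h.smooth h.conformal (p t) ![0, 1]
  have h3 := h.reducible.prime_gram h.smooth h.conformal (p t) ![1, 1]
  simp only [Fin.sum_univ_two, Matrix.cons_val_zero, Matrix.cons_val_one, S.gram_symm _ 1 0]
    at h1 h2 h3
  rw [Real.exp_neg]
  have he := (Real.exp_pos (Ψ (p t))).ne'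
  field_simp
  linear_combination (-(S.gram (p t) 1 1) - S.gram (p t) 0 1) * h1
    - (S.gram (p t) 0 0 + S.gram (p t) 0 1) * h2 + S.gram (p t) 0 1 * h3

/-- The integral curves of the normals do not reach the axis. -/
theorem offAxis_of_integralCurve (hJ : IsPreconnected J)
    (hp : ∀ t ∈ J, HasMFDerivAt 𝓘(ℝ, ℝ) (𝓡 4) p t ((1 : ℝ →L[ℝ] ℝ).smulRight (F.flow (p t))))
    (hJo : IsOpen J) {t₀ : ℝ} (ht₀ : t₀ ∈ J) (h0 : S.OffAxis (p t₀)) : ∀ t ∈ J, S.OffAxis (p t) := by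
  set k : M → ℝ := fun z ↦ (Real.exp (-Ψ z) * (2 * F.prime (fun z ↦ Real.exp (Ψ z)) z -
        (F.prime (γ 0 0) z * S.gram z 0 0 + F.prime (γ 0 1) z * S.gram z 0 1 +
          F.prime (γ 1 0) z * S.gram z 0 1 + F.prime (γ 1 1) z * S.gram z 1 1))) with hk
  have hkc : Continuous k := by
    have h1 := h.reducible.smooth_Ψ.continuous
    have h2 := fun a b ↦ (S.contMDiff_gram a b).continuous
    have h3 := fun a b ↦ (F.contMDiff_prime (h.reducible.smooth_γ a b)).continuous
    have h4 := (F.contMDiff_prime (contMDiff_exp h.reducible.smooth_Ψ)).continuous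
    have h5 := fun a b c d ↦ (h3 a b).mul (h2 c d)
    exact (Real.continuous_exp.comp h1.neg).mul ((continuous_const.mul h4).sub
      ((((h5 0 0 0 0).add (h5 0 1 0 1)).add (h5 1 0 0 1)).add (h5 1 1 1 1)))
  have hpc : ∀ t ∈ J, ContinuousAt p t := fun t ht ↦ (hp t ht).continuousAt
  have hdc : ∀ t ∈ J, ContinuousAt (fun t ↦ (S.gram (p t)).det) t := fun t ht ↦
    (h.hasDerivAt_det_gram (hp t ht)).continuousAt
  -- By the linear equation, a zero of the determinant would spread over the whole interval, up to
  -- `t₀`.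
  have hne : ∀ t ∈ J, (S.gram (p t)).det ≠ 0 := by
    intro t ht hzero
    have := eq_zero_of_eventually_eq_zero hJ hdc (fun t ht hz ↦ ?_) ht hzero t₀ ht₀
    · exact (show (S.gram (p t₀)).det < 0 from h0).ne this
    have hJt : ∀ᶠ u in 𝓝 t, u ∈ J := hJo.mem_nhds ht
    refine eventually_eq_zero_of_abs_deriv_le (C := |k (p t)| + 1)
      (e' := fun u ↦ k (p u) * (S.gram (p u)).det) ?_ ?_ hz
    · filter_upwards [hJt] with u hu using h.hasDerivAt_det_gram (hp u hu)
    · have hcont : ContinuousAt (fun u ↦ |k (p u)|) t :=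
        (hkc.continuousAt.comp (f := p) (hpc t ht)).abs
      filter_upwards [hcont.eventually_lt_const (lt_add_one _)] with u hu
      rw [abs_mul]
      exact mul_le_mul_of_nonneg_right hu.le (abs_nonneg _)
  intro t ht
  by_contra hcon
  have hpos : 0 ≤ (S.gram (p t)).det := not_lt.1 hcon
  obtain ⟨u, hu, hu0⟩ := hJ.intermediate_value ht₀ ht
    (fun t ht ↦ (hdc t ht).continuousWithinAt) ⟨(show (S.gram (p t₀)).det < 0 from h0).le, hpos⟩
  exact hne u hu hu0

end Foliation.IsReduced

namespace Observer

variable {S : AxiStationary M} {F : Foliation S}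
  {K : ∀ x : M, T x →L[ℝ] T x →L[ℝ] ℝ} {α : M → ℝ} {γ : Fin 2 → Fin 2 → M → ℝ} {Ψ : M → ℝ}
  {β : ∀ x : M, T x →L[ℝ] ℝ} {m : M → ℝ} {p : ℝ → M} {t : ℝ} {x : M} (O : Observer F m)

theorem speed_pos : 0 < O.speed := Real.sqrt_pos.2 (neg_pos.2 O.timelike)

theorem speed_sq : O.speed ^ 2 = -quad (S.gram O.pt) O.v :=
  Real.sq_sqrt (neg_pos.2 O.timelike).le

/-- The normalization by `v̄` cancels: on covectors with `v̄^a ρ_a = -Ē` the observer's data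
disappear and the second term is `e^Ψ m²`. -/
theorem quad_shadowMatrix (x : M) (ρ : Fin 2 → ℝ) : quad (O.shadowMatrix Ψ x) ρ =
    Real.exp (Ψ x) * quad (S.gram x)⁻¹ ρ +
      Real.exp (Ψ x) * m x ^ 2 * ((O.v ⬝ᵥ ρ) ^ 2 / O.E ^ 2) := by
  have hs := O.speed_pos.ne'
  have hm : O.mE2 x / O.speed ^ 2 = m x ^ 2 / O.E ^ 2 := by
    unfold mE2
    field_simp
  rw [shadowMatrix, hm, quad_fin_two, quad_fin_two, dotProduct_fin_two]
  simp only [Matrix.smul_apply, Matrix.add_apply, Matrix.vecMulVec_apply, smul_eq_mul]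
  ring

theorem mdifferentiableAt_shadowMatrix (hΨ : ContMDiff (𝓡 4) 𝓘(ℝ, ℝ) ∞ Ψ)
    (hm : ContMDiff (𝓡 4) 𝓘(ℝ, ℝ) ∞ fun x ↦ m x ^ 2) (hx : S.OffAxis x) (a b : Fin 2) :
    MDifferentiableAt (𝓡 4) 𝓘(ℝ, ℝ) (fun z ↦ O.shadowMatrix Ψ z a b) x := by
  have hdet : ContMDiffAt (𝓡 4) 𝓘(ℝ, ℝ) ∞ (fun z ↦ (S.gram z).det⁻¹) x :=
    (S.contMDiff_det_gram x).inv₀ (show (S.gram x).det < 0 from hx).ne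
  have hmE : ContMDiffAt (𝓡 4) 𝓘(ℝ, ℝ) ∞
      (fun z ↦ O.mE2 z / O.speed ^ 2 * (O.v a * O.v b)) x := by
    have : (fun z ↦ O.mE2 z / O.speed ^ 2 * (O.v a * O.v b)) =
        fun z ↦ m z ^ 2 * (O.speed ^ 2 / O.E ^ 2 / O.speed ^ 2 * (O.v a * O.v b)) := by
      funext z
      unfold mE2
      ring
    rw [this]
    exact (hm x).mul contMDiffAt_const
  have hinv : ContMDiffAt (𝓡 4) 𝓘(ℝ, ℝ) ∞ (fun z ↦ (S.gram z)⁻¹ a b) x := by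
    simp only [inv_apply_fin_two, Matrix.smul_apply, smul_eq_mul]
    fin_cases a <;> fin_cases b
    · exact hdet.mul (S.contMDiff_gram 1 1 x)
    · exact hdet.mul (S.contMDiff_gram 0 1 x).neg
    · exact hdet.mul (S.contMDiff_gram 1 0 x).neg
    · exact hdet.mul (S.contMDiff_gram 0 0 x)
  have : (fun z ↦ O.shadowMatrix Ψ z a b) = fun z ↦ Real.exp (Ψ z) *
      ((S.gram z)⁻¹ a b + O.mE2 z / O.speed ^ 2 * (O.v a * O.v b)) := by
    funext z
    simp [shadowMatrix, Matrix.vecMulVec_apply]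
  rw [this]
  exact (((Foliation.contMDiff_exp hΨ) x).mul (hinv.add hmE)).mdifferentiableAt (by simp)

/-- The rate of the shadow matrix along the normals. -/
theorem hasDerivAt_quad_shadowMatrix (h : F.IsReduced K α γ Ψ β m) (hx : S.OffAxis (p t))
    (hp : HasMFDerivAt 𝓘(ℝ, ℝ) (𝓡 4) p t ((1 : ℝ →L[ℝ] ℝ).smulRight (F.flow (p t))))
    (ρ : Fin 2 → ℝ) : HasDerivAt (fun t ↦ quad (O.shadowMatrix Ψ (p t)) ρ)
      ((∑ a, ∑ b, F.prime (γ a b) (p t) * ρ a * ρ b) +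
        F.prime (fun z ↦ Real.exp (Ψ z) * m z ^ 2) (p t) * ((O.v ⬝ᵥ ρ) ^ 2 / O.E ^ 2)) t := by
  have hdet : (S.gram (p t)).det ≠ 0 := (show (S.gram (p t)).det < 0 from hx).ne
  have hd := fun a b ↦ F.hasDerivAt_comp_flow
    (ContMDiff.mdifferentiableAt_of_smooth (S.contMDiff_gram a b) (p t)) hp
  have he := F.hasDerivAt_comp_flow (ContMDiff.mdifferentiableAt_of_smooth
    (Foliation.contMDiff_exp h.reducible.smooth_Ψ) (p t)) hp
  have hem := F.hasDerivAt_comp_flow (ContMDiff.mdifferentiableAt_of_smooth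
    ((Foliation.contMDiff_exp h.reducible.smooth_Ψ).mul h.smooth_mass) (p t)) hp
  simp only [O.quad_shadowMatrix]
  refine HasDerivAt.add ?_ (hem.mul_const _)
  simp only [quad_inv _ (S.gram_symm _ 1 0), S.det_gram] at hdet ⊢
  have hD := (((hd 0 0).mul (hd 1 1)).sub ((hd 0 1).mul (hd 0 1))).inv hdet
  have hN := (((hd 1 1).mul_const (ρ 0 ^ 2)).sub
    ((((hd 0 1).const_mul 2).mul_const (ρ 0)).mul_const (ρ 1))).add ((hd 0 0).mul_const (ρ 1 ^ 2))
  refine (he.mul (hD.mul hN)).congr_deriv ?_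
  -- The test vector is the adjugate of the Gram matrix applied to `ρ`, that is `det G` times `G⁻¹
  -- ρ`; it turns the evolution of `G_ab` into that of `G^ab` without denominators.
  have hw := h.reducible.prime_gram h.smooth h.conformal (p t)
    ![S.gram (p t) 1 1 * ρ 0 - S.gram (p t) 0 1 * ρ 1, S.gram (p t) 0 0 * ρ 1 - S.gram (p t) 0 1 * ρ 0]
  simp only [Fin.sum_univ_two, Matrix.cons_val_zero, Matrix.cons_val_one, S.gram_symm _ 1 0]
    at hw ⊢
  simp only [Pi.mul_apply, Pi.sub_apply, Pi.add_apply, Pi.inv_apply]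
  have hdet' : S.gram (p t) 0 0 * S.gram (p t) 1 1 - S.gram (p t) 0 1 ^ 2 ≠ 0 := by rwa [sq]
  field_simp
  linear_combination hw

theorem quad_shadowMatrix' (h : F.IsReduced K α γ Ψ β m) (hx : S.OffAxis x) (ρ : Fin 2 → ℝ) :
    quad (O.shadowMatrix' Ψ x) ρ = (∑ a, ∑ b, F.prime (γ a b) x * ρ a * ρ b) +
        F.prime (fun z ↦ Real.exp (Ψ z) * m z ^ 2) x * ((O.v ⬝ᵥ ρ) ^ 2 / O.E ^ 2) := by
  obtain ⟨p, hp0, hp⟩ := F.exists_transversal x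
  have hp1 := hp.self_of_nhds.2
  -- Frees the parameter value from `x`, so that `x` can be replaced by `p t`.
  generalize F.Ω x = t at hp0 hp1
  subst hp0
  refine HasDerivAt.unique ?_ (O.hasDerivAt_quad_shadowMatrix h hx hp1 ρ)
  simp only [quad_fin_two, shadowMatrix', Matrix.of_apply]
  have hd := fun a b ↦ F.hasDerivAt_comp_flow
    (O.mdifferentiableAt_shadowMatrix h.reducible.smooth_Ψ h.smooth_mass hx a b) hp1
  exact (((hd 0 0).mul_const _).add ((((hd 0 1).add (hd 1 0)).mul_const _).mul_const _)).add
    ((hd 1 1).mul_const _)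

/-- The bridge between impact vectors and dynamics: after normalization, criticality of the shadow
matrix is the vanishing of the force. -/
theorem quad_shadowMatrix'_eq_force (h : F.IsReduced K α γ Ψ β m) (hx : S.OffAxis x)
    (hE : O.E ≠ 0) {q : Fin 2 → ℝ} (hq : O.v ⬝ᵥ q = -O.E) :
    quad (O.shadowMatrix' Ψ x) q = F.force γ Ψ m q x := by
  rw [O.quad_shadowMatrix' h hx, hq, neg_sq, div_self (pow_ne_zero 2 hE), mul_one, Foliation.force]

end Observer

end

/-! ### Causal linear algebra and the frame of the observer -/

section

variable {M : Type*} [TopologicalSpace M] [ChartedSpace E4 M] [IsManifold (𝓡 4) ∞ M]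

/-- Orthogonality equates `t₀ w₀` with the spatial product. If the spatial part of `w` were nonzero,
Cauchy–Schwarz for it would contradict that `t` is timelike and `w` is not spacelike. -/
theorem eq_zero_of_minkowski_orthogonal {t₀ t₁ t₂ t₃ w₀ w₁ w₂ w₃ : ℝ}
    (ht : -(t₀ * t₀) + t₁ * t₁ + t₂ * t₂ + t₃ * t₃ < 0)
    (htw : -(t₀ * w₀) + t₁ * w₁ + t₂ * w₂ + t₃ * w₃ = 0)
    (hw : -(w₀ * w₀) + w₁ * w₁ + w₂ * w₂ + w₃ * w₃ ≤ 0) : w₀ = 0 ∧ w₁ = 0 ∧ w₂ = 0 ∧ w₃ = 0 := by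
  have hcs : (t₁ * w₁ + t₂ * w₂ + t₃ * w₃) ^ 2 ≤
      (t₁ ^ 2 + t₂ ^ 2 + t₃ ^ 2) * (w₁ ^ 2 + w₂ ^ 2 + w₃ ^ 2) := by
    nlinarith [sq_nonneg (t₁ * w₂ - t₂ * w₁), sq_nonneg (t₁ * w₃ - t₃ * w₁),
      sq_nonneg (t₂ * w₃ - t₃ * w₂)]
  have h1 : t₁ * w₁ + t₂ * w₂ + t₃ * w₃ = t₀ * w₀ := by linarith
  rw [h1, mul_pow] at hcs
  have h2 : 0 ≤ w₁ ^ 2 + w₂ ^ 2 + w₃ ^ 2 := by positivity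
  have h3 : t₀ ^ 2 * (w₁ ^ 2 + w₂ ^ 2 + w₃ ^ 2) ≤ t₀ ^ 2 * w₀ ^ 2 :=
    mul_le_mul_of_nonneg_left (by linarith) (sq_nonneg _)
  have h4 : w₁ ^ 2 + w₂ ^ 2 + w₃ ^ 2 = 0 := by
    by_contra hne
    have h5 : 0 < w₁ ^ 2 + w₂ ^ 2 + w₃ ^ 2 := lt_of_le_of_ne h2 (Ne.symm hne)
    have h6 : (t₁ ^ 2 + t₂ ^ 2 + t₃ ^ 2) * (w₁ ^ 2 + w₂ ^ 2 + w₃ ^ 2) <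
        t₀ ^ 2 * (w₁ ^ 2 + w₂ ^ 2 + w₃ ^ 2) := mul_lt_mul_of_pos_right (by linarith) h5
    linarith
  have hw₁ : w₁ = 0 := pow_eq_zero_iff two_ne_zero |>.1 (by linarith [sq_nonneg w₁, sq_nonneg w₂, sq_nonneg w₃])
  have hw₂ : w₂ = 0 := pow_eq_zero_iff two_ne_zero |>.1 (by linarith [sq_nonneg w₁, sq_nonneg w₂, sq_nonneg w₃])
  have hw₃ : w₃ = 0 := pow_eq_zero_iff two_ne_zero |>.1 (by linarith [sq_nonneg w₁, sq_nonneg w₂, sq_nonneg w₃])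
  refine ⟨?_, hw₁, hw₂, hw₃⟩
  rw [hw₁, hw₂, hw₃] at htw
  have ht₀ : t₀ ≠ 0 := by
    rintro rfl
    linarith [mul_self_nonneg t₁, mul_self_nonneg t₂, mul_self_nonneg t₃]
  have h5 : t₀ * w₀ = 0 := by linarith
  exact (mul_eq_zero.1 h5).resolve_left ht₀

/-- Reversed Cauchy–Schwarz: the orthogonal complement of a timelike vector is spacelike. -/
theorem LorentzMetric.eq_zero_of_orthogonal_timelike (g : LorentzMetric M) {x : M} {t w : T x}
    (ht : g.val x t t < 0) (htw : g.val x t w = 0) (hw : g.val x w w ≤ 0) : w = 0 := by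
  obtain ⟨e, he⟩ := g.signature x
  have hexp : ∀ u v, g.val x u v = -(e.repr u 0 * e.repr v 0) + e.repr u 1 * e.repr v 1 +
      e.repr u 2 * e.repr v 2 + e.repr u 3 * e.repr v 3 := by
    intro u v
    conv_lhs => rw [← e.sum_repr u, ← e.sum_repr v]
    simp only [map_sum, map_smul, sum_apply, smul_apply, he, smul_eq_mul]
    simp [Fin.sum_univ_four]
    ring
  rw [hexp] at ht htw hw
  obtain ⟨h0, h1, h2, h3⟩ := eq_zero_of_minkowski_orthogonal ht htw hw
  refine e.ext_elem fun i ↦ ?_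
  rw [map_zero]
  fin_cases i <;> assumption

namespace AxiStationary

variable (S : AxiStationary M) {x : M}

theorem val_κ_sum (x : M) (w : Fin 2 → ℝ) (a : Fin 2) :
    S.g.val x (S.κ a x) (∑ b, w b • S.κ b x) = (S.gram x *ᵥ w) a := by
  simp [AxiStationary.gram, Matrix.mulVec, dotProduct, mul_comm]

theorem val_sum_κ (x : M) (w : Fin 2 → ℝ) (z : T x) :
    S.g.val x (∑ b, w b • S.κ b x) z = ∑ b, w b * S.g.val x (S.κ b x) z := by
  simp

theorem val_sum_sum (x : M) (v w : Fin 2 → ℝ) :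
    S.g.val x (∑ b, v b • S.κ b x) (∑ b, w b • S.κ b x) = v ⬝ᵥ (S.gram x *ᵥ w) := by
  rw [val_sum_κ]
  simp only [S.val_κ_sum, dotProduct]

/-- Off the axis, vectors orthogonal to the Killing vectors are spacelike. -/
theorem OffAxis.eq_zero_of_orthogonal {S : AxiStationary M} (hx : S.OffAxis x) {w : T x}
    (hκ : ∀ a, S.g.val x (S.κ a x) w = 0) (hw : S.g.val x w w ≤ 0) : w = 0 := by
  have hdet : (S.gram x).det < 0 := hx
  rw [S.det_gram] at hdet
  -- A negative determinant yields a timelike combination of Killing vectors. If `G_11 = 0`, the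
  -- second component is solved for the value -1; if `G_11 > 0`, the vector `(G_11, -G_01)` has the
  -- value `G_11 det G`.
  obtain ⟨u, hu⟩ : ∃ u : Fin 2 → ℝ, quad (S.gram x) u < 0 := by
    have hq := fun a b : ℝ ↦ quad_fin_two (S.gram x) ![a, b]
    simp only [Matrix.cons_val_zero, Matrix.cons_val_one, S.gram_symm x 1 0] at hq
    rcases lt_trichotomy (S.gram x 1 1) 0 with h1 | h1 | h1
    · exact ⟨![0, 1], by rw [hq]; linarith⟩
    · rw [h1] at hdet
      have h01 : S.gram x 0 1 ≠ 0 := fun h0 ↦ by rw [h0] at hdet; linarith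
      refine ⟨![1, -(S.gram x 0 0 + 1) / (2 * S.gram x 0 1)], ?_⟩
      rw [hq, h1]
      have h2 : S.gram x 0 1 * (-(S.gram x 0 0 + 1) / (2 * S.gram x 0 1)) =
          -(S.gram x 0 0 + 1) / 2 := by field_simp
      linarith
    · refine ⟨![S.gram x 1 1, -S.gram x 0 1], ?_⟩
      rw [hq]
      nlinarith
  refine S.g.eq_zero_of_orthogonal_timelike (t := ∑ b, u b • S.κ b x) ?_ ?_ hw
  · rw [S.val_sum_sum]; exact hu
  · simp [hκ]

/-- The component of a vector along the Killing vectors. -/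
theorem OffAxis.mulVec_inv {S : AxiStationary M} (hx : S.OffAxis x) (q : Fin 2 → ℝ) :
    S.gram x *ᵥ ((S.gram x)⁻¹ *ᵥ q) = q := by
  rw [Matrix.mulVec_mulVec, Matrix.mul_nonsing_inv, Matrix.one_mulVec]
  exact (show (S.gram x).det < 0 from hx).ne.isUnit

theorem OffAxis.quad_gram_inv {S : AxiStationary M} (hx : S.OffAxis x) (q : Fin 2 → ℝ) :
    quad (S.gram x) ((S.gram x)⁻¹ *ᵥ q) = quad (S.gram x)⁻¹ q := by
  rw [quad, hx.mulVec_inv, dotProduct_comm]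
  rfl

/-- The component of `u` along the Killing vectors has squared norm `G^ab q_a q_b`; the orthogonal
remainder is spacelike or zero. -/
theorem OffAxis.quad_inv_le {S : AxiStationary M} (hx : S.OffAxis x) {q : Fin 2 → ℝ} {u : T x}
    (hq : ∀ a, S.g.val x (S.κ a x) u = q a) : quad (S.gram x)⁻¹ q ≤ S.g.val x u u := by
  set u₀ := ∑ b, ((S.gram x)⁻¹ *ᵥ q) b • S.κ b x with hu₀
  have h0 : ∀ a, S.g.val x (S.κ a x) (u - u₀) = 0 := fun a ↦ by
    rw [map_sub, hq, hu₀, S.val_κ_sum, hx.mulVec_inv, sub_self]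
  have h1 : 0 ≤ S.g.val x (u - u₀) (u - u₀) := by
    by_contra! hlt
    rw [hx.eq_zero_of_orthogonal h0 hlt.le, map_zero] at hlt
    exact lt_irrefl _ hlt
  have h2 : S.g.val x u₀ (u - u₀) = 0 := by
    rw [hu₀, S.val_sum_κ]
    simp only [← hu₀, h0, mul_zero, Finset.sum_const_zero]
  have h3 : S.g.val x u₀ u₀ = quad (S.gram x)⁻¹ q := by
    rw [hu₀, S.val_sum_sum, ← quad, hx.quad_gram_inv]
  have h4 : S.g.val x u u = S.g.val x (u - u₀) (u - u₀) + 2 * S.g.val x u₀ (u - u₀) +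
      S.g.val x u₀ u₀ := by
    simp only [map_sub, sub_apply, S.g.symm x u₀ u]
    ring
  linarith

end AxiStationary

theorem Foliation.val_normal_normal {S : AxiStationary M} (F : Foliation S) (x : M) :
    S.g.val x (F.normal x) (F.normal x) = 1 := by
  have hn : F.normal x = F.lapse x • S.g.grad F.Ω x := rfl
  rw [F.val_normal, hn, map_smul, F.diff_Ω_grad, smul_eq_mul, ← mul_assoc, F.lapse_sq,
    inv_mul_cancel₀ (F.gradSq_pos _).ne']

/-- Off the axis, there is a vector tangent to the slice with prescribed conserved quantities and
norm, provided that the norm is not too small. -/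
theorem Foliation.exists_tangent {S : AxiStationary M} (F : Foliation S) {x : M} (hx : S.OffAxis x)
    {q : Fin 2 → ℝ} {r : ℝ} (hr : quad (S.gram x)⁻¹ q ≤ r) : ∃ u : T x, diff F.Ω x u = 0 ∧
      (∀ a, S.g.val x (S.κ a x) u = q a) ∧ S.g.val x u u = r := by
  -- Three linear conditions on a four-dimensional space have a nonzero solution, which is spacelike
  -- by orthogonality to the Killing vectors. Adding a multiple of it to the Killing component
  -- reaches the prescribed norm.
  obtain ⟨e, he0, heκ, heΩ⟩ : ∃ e : T x, e ≠ 0 ∧ (∀ a, S.g.val x (S.κ a x) e = 0) ∧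
      diff F.Ω x e = 0 := by
    let L : T x →ₗ[ℝ] (Fin 3 → ℝ) := LinearMap.pi
      ![(S.g.val x (S.κ 0 x) : T x →ₗ[ℝ] ℝ), (S.g.val x (S.κ 1 x) : T x →ₗ[ℝ] ℝ),
        (diff F.Ω x : T x →ₗ[ℝ] ℝ)]
    have hdim : Module.finrank ℝ (Fin 3 → ℝ) < Module.finrank ℝ (T x) := by
      have : Module.finrank ℝ (T x) = 4 := finrank_euclideanSpace_fin (𝕜 := ℝ) (n := 4)
      rw [this]
      simp
    have hfin : FiniteDimensional ℝ (T x) := inferInstanceAs (FiniteDimensional ℝ E4)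
    obtain ⟨e, he, he0⟩ := (Submodule.ne_bot_iff _).1 (L.ker_ne_bot_of_finrank_lt hdim)
    refine ⟨e, he0, fun a ↦ ?_, congrFun he 2⟩
    fin_cases a
    · exact congrFun he 0
    · exact congrFun he 1
  have hepos : 0 < S.g.val x e e := by
    by_contra! hle
    exact he0 (hx.eq_zero_of_orthogonal heκ hle)
  set u₀ := ∑ b, ((S.gram x)⁻¹ *ᵥ q) b • S.κ b x with hu₀
  refine ⟨u₀ + √((r - quad (S.gram x)⁻¹ q) / S.g.val x e e) • e, ?_, fun a ↦ ?_, ?_⟩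
  · simp [hu₀, heΩ, F.tangent]
  · rw [map_add, hu₀, S.val_κ_sum, hx.mulVec_inv, map_smul, heκ, smul_zero, add_zero]
  · have h2 : S.g.val x u₀ e = 0 := by
      rw [hu₀, S.val_sum_κ]
      simp only [heκ, mul_zero, Finset.sum_const_zero]
    have h3 : S.g.val x u₀ u₀ = quad (S.gram x)⁻¹ q := by
      rw [hu₀, S.val_sum_sum, ← quad, hx.quad_gram_inv]
    have h4 := Real.sq_sqrt (div_nonneg (sub_nonneg.2 hr) hepos.le)
    simp only [map_add, map_smul, add_apply, smul_apply, S.g.symm x e u₀, h2, h3, smul_eq_mul]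
    have h5 : (r - quad (S.gram x)⁻¹ q) / S.g.val x e e * S.g.val x e e = r - quad (S.gram x)⁻¹ q :=
      div_mul_cancel₀ _ hepos.ne'
    rw [← h4] at h5
    linear_combination h5

namespace Observer

variable {S : AxiStationary M} {F : Foliation S} {m : M → ℝ} {Ψ : M → ℝ} (O : Observer F m)

/-- The momentum `√(Ē²/v̄² - m̄²)` of the captured particles. -/
def momentum : ℝ := √((O.E / O.speed) ^ 2 - m O.pt ^ 2)

theorem det_neg : (S.gram O.pt).det < 0 := O.offAxis

theorem gram_mulVec_τ (a : Fin 2) : (S.gram O.pt *ᵥ O.τ) a =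
    √(-(S.gram O.pt).det) * ![O.v 1, -O.v 0] a := by
  rw [τ, O.offAxis.mulVec_inv]
  fin_cases a <;> simp [Matrix.mulVec, dotProduct, Fin.sum_univ_two]

theorem v_dot_gram_τ : O.v ⬝ᵥ (S.gram O.pt *ᵥ O.τ) = 0 := by
  rw [dotProduct_fin_two, O.gram_mulVec_τ, O.gram_mulVec_τ]
  simp only [Matrix.cons_val_zero, Matrix.cons_val_one]
  ring

theorem τ_dot_gram_v : O.τ ⬝ᵥ (S.gram O.pt *ᵥ O.v) = 0 := by
  rw [← O.v_dot_gram_τ]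
  simp only [dotProduct_fin_two, Matrix.mulVec, S.gram_symm O.pt 1 0]
  ring

theorem v_dot_gram_v : O.v ⬝ᵥ (S.gram O.pt *ᵥ O.v) = -O.speed ^ 2 := by
  rw [O.speed_sq, neg_neg]; rfl

/-- The pairing with `τ̄` is, up to normalization, the determinant of `G v̄` and `ρ`; this form is
free of the inverse Gram matrix. -/
theorem sqrt_det_mul_τ_dot (ρ : Fin 2 → ℝ) : √(-(S.gram O.pt).det) * (O.τ ⬝ᵥ ρ) =
    (S.gram O.pt *ᵥ O.v) 0 * ρ 1 - (S.gram O.pt *ᵥ O.v) 1 * ρ 0 := by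
  have hd := O.det_neg
  have hs := Real.sq_sqrt (neg_pos.2 hd).le
  have hne : (S.gram O.pt).det ≠ 0 := hd.ne
  rw [τ, inv_apply_fin_two]
  set D := (S.gram O.pt).det
  have hD : D * D⁻¹ = 1 := mul_inv_cancel₀ hne
  simp only [dotProduct_fin_two, Matrix.mulVec, S.gram_symm O.pt 1 0, Matrix.smul_apply,
    Matrix.of_apply, Matrix.cons_val_zero, Matrix.cons_val_one, smul_eq_mul, mul_zero, mul_one,
    zero_mul, zero_add, add_zero, Matrix.cons_val', Matrix.cons_val_fin_one]
  rw [sq] at hs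
  linear_combination (D⁻¹ * (S.gram O.pt 1 1 * O.v 1 + S.gram O.pt 0 1 * O.v 0) * ρ 0
    - D⁻¹ * (S.gram O.pt 0 1 * O.v 1 + S.gram O.pt 0 0 * O.v 0) * ρ 1) * hs
    + (-(S.gram O.pt 1 1 * O.v 1 + S.gram O.pt 0 1 * O.v 0) * ρ 0
    + (S.gram O.pt 0 1 * O.v 1 + S.gram O.pt 0 0 * O.v 0) * ρ 1) * hD

theorem τ_dot_gram_τ : O.τ ⬝ᵥ (S.gram O.pt *ᵥ O.τ) = O.speed ^ 2 := by
  have h1 := O.sqrt_det_mul_τ_dot ![O.v 1, -O.v 0]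
  have h2 := O.v_dot_gram_v
  simp only [dotProduct_fin_two, O.gram_mulVec_τ] at h1 h2 ⊢
  simp only [Matrix.cons_val_zero, Matrix.cons_val_one] at h1 h2 ⊢
  linarith

/-- The inverse Gram matrix at the observer, in terms of the orthogonal vectors `v̄`, `τ̄`. -/
theorem speed_sq_mul_quad_inv (ρ : Fin 2 → ℝ) :
    O.speed ^ 2 * quad (S.gram O.pt)⁻¹ ρ = (O.τ ⬝ᵥ ρ) ^ 2 - (O.v ⬝ᵥ ρ) ^ 2 := by
  have hd := O.det_neg
  have hs := Real.sq_sqrt (neg_pos.2 hd).le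
  have h1 := O.sqrt_det_mul_τ_dot ρ
  have h2 := O.v_dot_gram_v
  have h3 : -(S.gram O.pt).det * (O.τ ⬝ᵥ ρ) ^ 2 =
      ((S.gram O.pt *ᵥ O.v) 0 * ρ 1 - (S.gram O.pt *ᵥ O.v) 1 * ρ 0) ^ 2 := by
    rw [← h1, mul_pow, hs]
  rw [quad_inv _ (S.gram_symm _ 1 0)]
  apply mul_left_cancel₀ (neg_pos.2 hd).ne'
  rw [mul_sub, h3]
  have hD := S.det_gram O.pt
  set D := (S.gram O.pt).det
  have hDi : D * D⁻¹ = 1 := mul_inv_cancel₀ hd.ne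
  simp only [dotProduct_fin_two, Matrix.mulVec, S.gram_symm O.pt 1 0] at h2 ⊢
  have h4 : O.speed ^ 2 = -(O.v 0 * (S.gram O.pt 0 0 * O.v 0 + S.gram O.pt 0 1 * O.v 1) +
      O.v 1 * (S.gram O.pt 0 1 * O.v 0 + S.gram O.pt 1 1 * O.v 1)) := by linarith
  rw [h4]
  have h5 : ∀ X Y : ℝ, -D * (X * (D⁻¹ * Y)) = -(X * Y) := fun X Y ↦ by
    linear_combination -X * Y * hDi
  rw [h5, hD]
  ring

/-- A covector is determined by its values on `v̄` and `τ̄`. -/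
theorem covector_ext {ρ σ : Fin 2 → ℝ} (hv : O.v ⬝ᵥ ρ = O.v ⬝ᵥ σ) (hτ : O.τ ⬝ᵥ ρ = O.τ ⬝ᵥ σ) :
    ρ = σ := by
  have h1 := O.sqrt_det_mul_τ_dot ρ
  have h2 := O.sqrt_det_mul_τ_dot σ
  rw [hτ, h2] at h1
  have h3 := O.v_dot_gram_v
  have hs := pow_pos O.speed_pos 2
  set u := S.gram O.pt *ᵥ O.v
  simp only [dotProduct_fin_two] at hv h3
  have e0 : O.speed ^ 2 * (ρ 0 - σ 0) = 0 := by
    linear_combination -u 0 * hv + (ρ 0 - σ 0) * h3 - O.v 1 * h1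
  have e1 : O.speed ^ 2 * (ρ 1 - σ 1) = 0 := by
    linear_combination -u 1 * hv + (ρ 1 - σ 1) * h3 + O.v 0 * h1
  funext a
  fin_cases a
  · exact sub_eq_zero.1 ((mul_eq_zero.1 e0).resolve_left hs.ne')
  · exact sub_eq_zero.1 ((mul_eq_zero.1 e1).resolve_left hs.ne')

theorem E_pos (hm : 0 ≤ m O.pt) : 0 < O.E := (mul_nonneg O.speed_pos.le hm).trans_lt O.energy

theorem momentum_sq_pos (hm : 0 ≤ m O.pt) : 0 < (O.E / O.speed) ^ 2 - m O.pt ^ 2 := by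
  have h1 : m O.pt < O.E / O.speed := by
    rw [lt_div_iff₀ O.speed_pos, mul_comm]
    exact O.energy
  have := pow_lt_pow_left₀ h1 hm two_ne_zero
  linarith

theorem momentum_pos (hm : 0 ≤ m O.pt) : 0 < O.momentum := Real.sqrt_pos.2 (O.momentum_sq_pos hm)

theorem momentum_sq (hm : 0 ≤ m O.pt) : O.momentum ^ 2 = (O.E / O.speed) ^ 2 - m O.pt ^ 2 :=
  Real.sq_sqrt (O.momentum_sq_pos hm).le

theorem one_sub_mE2 (hm : 0 ≤ m O.pt) : 1 - O.mE2 O.pt = (O.speed * O.momentum / O.E) ^ 2 := by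
  have h1 := O.speed_pos.ne'
  have h2 := (O.E_pos hm).ne'
  rw [div_pow, mul_pow, O.momentum_sq hm, mE2]
  field_simp

theorem sqrt_one_sub_mE2 (hm : 0 ≤ m O.pt) : √(1 - O.mE2 O.pt) = O.speed * O.momentum / O.E := by
  rw [O.one_sub_mE2 hm]
  exact Real.sqrt_sq (div_pos (mul_pos O.speed_pos (O.momentum_pos hm)) (O.E_pos hm)).le

/-- In the orthogonal directions `v̄`, `τ̄` the inverse Gram matrix is diagonal; the mass term only
changes the coefficient of `(v̄^a ρ_a)²`. -/
theorem quad_shadowMatrix_pt (hm : 0 ≤ m O.pt) (ρ : Fin 2 → ℝ) : O.speed ^ 2 * quad (O.shadowMatrix Ψ O.pt) ρ =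
    Real.exp (Ψ O.pt) * ((O.τ ⬝ᵥ ρ) ^ 2 - (1 - O.mE2 O.pt) * (O.v ⬝ᵥ ρ) ^ 2) := by
  have h2 := (O.E_pos hm).ne'
  rw [O.quad_shadowMatrix, mE2]
  field_simp
  linear_combination O.E ^ 2 * O.speed_sq_mul_quad_inv ρ

theorem q_eq (Θ Φ : ℝ) (a : Fin 2) : O.q Θ Φ a = O.E / O.speed ^ 2 * (S.gram O.pt *ᵥ O.v) a +
    O.momentum / O.speed * (Real.sin Φ * Real.sin Θ) * (S.gram O.pt *ᵥ O.τ) a := by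
  have h1 := O.speed_pos.ne'
  have h2 : S.g.val O.pt (S.κ a O.pt) (F.normal O.pt) = 0 := by
    rw [S.g.symm, F.val_normal, F.tangent, mul_zero]
  unfold q ray e₀ e₁ e₃ momentum
  simp only [map_add, map_smul, map_neg, S.val_κ_sum, O.e₂_killing, h2, smul_eq_mul]
  field_simp
  ring

theorem v_dot_q (Θ Φ : ℝ) : O.v ⬝ᵥ O.q Θ Φ = -O.E := by
  have h1 := O.speed_pos.ne'
  have h2 := O.v_dot_gram_v
  have h3 := O.v_dot_gram_τ
  rw [dotProduct_fin_two] at h2 h3 ⊢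
  rw [O.q_eq, O.q_eq]
  field_simp
  linear_combination O.E * h2 + O.speed * O.momentum * (Real.sin Φ * Real.sin Θ) * h3

theorem τ_dot_q (Θ Φ : ℝ) : O.τ ⬝ᵥ O.q Θ Φ =
    O.speed * O.momentum * (Real.sin Φ * Real.sin Θ) := by
  have h1 := O.speed_pos.ne'
  have h2 := O.τ_dot_gram_v
  have h3 := O.τ_dot_gram_τ
  rw [dotProduct_fin_two] at h2 h3 ⊢
  rw [O.q_eq, O.q_eq]
  field_simp
  linear_combination O.E * h2 + O.speed * O.momentum * (Real.sin Φ * Real.sin Θ) * h3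

/-- The sign comes from `e₃ = -n`: `cos Θ > 0` means that `Ω` decreases along the particle. -/
theorem diff_Ω_ray (Θ Φ : ℝ) : F.lapse O.pt * diff F.Ω O.pt (O.ray Θ Φ) =
    -(O.momentum * Real.cos Θ) := by
  have h1 := F.val_normal_normal O.pt
  rw [← F.val_normal]
  have h2 : ∀ a, S.g.val O.pt (F.normal O.pt) (S.κ a O.pt) = 0 := fun a ↦ by
    rw [F.val_normal, F.tangent, mul_zero]
  unfold ray e₀ e₁ e₃
  simp only [map_add, map_smul, map_neg, map_sum, h2, O.e₂_normal, h1, smul_eq_mul, momentum]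
  simp

/-- The celestial position, in terms of the shadow matrix at the observer. -/
theorem quad_shadowMatrix_pt_q (hm : 0 ≤ m O.pt) (Θ Φ : ℝ) : quad (O.shadowMatrix Ψ O.pt) (O.q Θ Φ) =
    -(Real.exp (Ψ O.pt) * O.momentum ^ 2 * (1 - (Real.sin Φ * Real.sin Θ) ^ 2)) := by
  have h1 := O.speed_pos.ne'
  have h2 := (O.E_pos hm).ne'
  have h := O.quad_shadowMatrix_pt (Ψ := Ψ) hm (O.q Θ Φ)
  rw [O.v_dot_q, O.τ_dot_q, O.one_sub_mE2 hm] at h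
  apply mul_left_cancel₀ (pow_ne_zero 2 h1)
  rw [h]
  field_simp
  ring

end Observer

end

/-! ### Massive particle surfaces and impact vectors -/

section

variable {M : Type*} [TopologicalSpace M] [ChartedSpace E4 M] [IsManifold (𝓡 4) ∞ M]

namespace Foliation.IsReduced

variable {S : AxiStationary M} {F : Foliation S}
  {K : ∀ x : M, T x →L[ℝ] T x →L[ℝ] ℝ} {α : M → ℝ} {γ : Fin 2 → Fin 2 → M → ℝ} {Ψ : M → ℝ}
  {β : ∀ x : M, T x →L[ℝ] ℝ} {m : M → ℝ} {x : M} {q : Fin 2 → ℝ}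
  (h : F.IsReduced K α γ Ψ β m)
include h

/-- The bound leaves a nonnegative squared norm for the component tangent to the slice and
orthogonal to the Killing vectors; it is also necessary, by `OffAxis.quad_inv_le`. -/
theorem exists_touches (hx : S.OffAxis x) (hq : quad (S.gram x)⁻¹ q ≤ -(m x) ^ 2) :
    ∃ c I s, F.Touches m (F.Ω x) q c I s ∧ c s = x := by
  obtain ⟨u, hu, huq, hun⟩ := F.exists_tangent hx hq
  obtain ⟨c, I, hc, h0, hc0⟩ := S.g.exists_isWorldline h.smooth_mass x u hun
  -- Initial data agree only as points of the tangent bundle, so properties are transported as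
  -- predicates on the bundle.
  have hpred : ∀ P : TangentBundle (𝓡 4) M → Prop, P ⟨x, u⟩ → P ⟨c 0, velocity c 0⟩ :=
    fun P hP ↦ by rwa [hc0]
  refine ⟨c, I, 0, ⟨hc, h0, fun a ↦ ?_, ?_, ?_⟩, ?_⟩
  · exact hpred (fun z ↦ S.g.val z.1 (S.κ a z.1) z.2 = q a) (huq a)
  · exact hpred (fun z ↦ F.Ω z.1 = F.Ω x) rfl
  · exact hpred (fun z ↦ diff F.Ω z.1 z.2 = 0) hu
  · exact hpred (fun z ↦ z.1 = x) rfl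

theorem isMassiveParticleSurface (hx : S.OffAxis x) (hq : quad (S.gram x)⁻¹ q ≤ -(m x) ^ 2)
    (hf : F.force γ Ψ m q x = 0) : F.IsMassiveParticleSurface m (F.Ω x) q := by
  refine ⟨?_, fun c I s hc ↦ h.mem_slice_of_force_eq_zero hc ?_⟩
  · obtain ⟨c, I, s, hc, hcs⟩ := h.exists_touches hx hq
    exact ⟨c, I, s, hc, hcs ▸ hx⟩
  · rw [← hf]
    exact h.force_const q _ _ hc.on_slice

/-- The existence clause of `IsMassiveParticleSurface` supplies a worldline in the slice. The force
vanishes on it, hence on the whole slice. -/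
theorem force_eq_zero {r : ℝ} (hr : F.IsMassiveParticleSurface m r q) (hx : F.Ω x = r) :
    F.force γ Ψ m q x = 0 := by
  obtain ⟨⟨c, I, s, hc, -⟩, hall⟩ := hr
  rw [← h.force_eq_zero_of_mem_slice hc (hall c I s hc)]
  exact h.force_const q _ _ (hx.trans hc.on_slice.symm)

end Foliation.IsReduced

namespace Observer

variable {S : AxiStationary M} {F : Foliation S}
  {K : ∀ x : M, T x →L[ℝ] T x →L[ℝ] ℝ} {α : M → ℝ} {γ : Fin 2 → Fin 2 → M → ℝ} {Ψ : M → ℝ}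
  {β : ∀ x : M, T x →L[ℝ] ℝ} {m : M → ℝ} {x : M} {q ρ : Fin 2 → ℝ} {Θ Φ : ℝ} (O : Observer F m)

/-- For normalized momenta, `S^ab q_a q_b ≤ 0` is thus the condition for a tangent worldline to
exist. -/
theorem quad_shadowMatrix_of_v_dot (hE : O.E ≠ 0) (hq : O.v ⬝ᵥ q = -O.E) :
    quad (O.shadowMatrix Ψ x) q = Real.exp (Ψ x) * (quad (S.gram x)⁻¹ q + m x ^ 2) := by
  rw [O.quad_shadowMatrix, hq, neg_sq, div_self (pow_ne_zero 2 hE)]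
  ring

theorem sin_mul_sin_sq_le : (Real.sin Φ * Real.sin Θ) ^ 2 ≤ 1 := by
  rw [mul_pow]
  exact mul_le_one₀ (Real.sin_sq_le_one Φ) (sq_nonneg _) (Real.sin_sq_le_one Θ)

theorem isImpact_q (h : F.IsReduced K α γ Ψ β m) (hm : 0 ≤ m O.pt) (hx : S.OffAxis x)
    (hf : F.force γ Ψ m (O.q Θ Φ) x = 0) (hS : quad (O.shadowMatrix Ψ x) (O.q Θ Φ) ≤ 0) :
    O.IsImpact Ψ x (O.q Θ Φ) := by
  have hE := (O.E_pos hm).ne'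
  refine ⟨fun h0 ↦ ?_, ?_, hS, ?_⟩
  · have := O.v_dot_q Θ Φ
    rw [h0, dotProduct_zero] at this
    exact hE (by linarith)
  · rw [O.quad_shadowMatrix'_eq_force h hx hE (O.v_dot_q Θ Φ), hf]
  · rw [O.v_dot_q, O.τ_dot_q, O.one_sub_mE2 hm, neg_sq, ← mul_pow, div_mul_cancel₀ _ hE, mul_pow]
    exact mul_le_of_le_one_right (sq_nonneg _) sin_mul_sin_sq_le

variable {O} in
-- If `v̄^a ρ_a` vanished, the bound on the sines would force `τ̄^a ρ_a = 0`, and `v̄`, `τ̄` span.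
theorem IsImpact.v_dot_ne_zero (hρ : O.IsImpact Ψ x ρ) : O.v ⬝ᵥ ρ ≠ 0 := by
  intro hv
  have h1 := hρ.sines
  rw [hv] at h1
  have h2 : O.τ ⬝ᵥ ρ = 0 := by
    rw [← pow_eq_zero_iff two_ne_zero]
    exact le_antisymm (by linarith) (sq_nonneg _)
  exact hρ.ne_zero (O.covector_ext (σ := 0) (by rw [hv, dotProduct_zero])
    (by rw [h2, dotProduct_zero]))

/-- The conserved quantities which correspond to an impact vector. -/
theorem q_eq_of_sines (hm : 0 ≤ m O.pt) (hv : O.v ⬝ᵥ ρ ≠ 0)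
    (hs : Real.sin Φ * Real.sin Θ = -(O.τ ⬝ᵥ ρ) / (√(1 - O.mE2 O.pt) * (O.v ⬝ᵥ ρ))) :
    O.q Θ Φ = (-O.E / (O.v ⬝ᵥ ρ)) • ρ := by
  have h1 := O.speed_pos.ne'
  have h2 := (O.momentum_pos hm).ne'
  have hE := (O.E_pos hm).ne'
  refine O.covector_ext ?_ ?_
  · rw [O.v_dot_q, dotProduct_smul, smul_eq_mul, div_mul_cancel₀ _ hv]
  · rw [O.τ_dot_q, dotProduct_smul, smul_eq_mul, hs, O.sqrt_one_sub_mE2 hm]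
    field_simp

theorem sines_of_q_eq (hm : 0 ≤ m O.pt) (hv : O.v ⬝ᵥ ρ ≠ 0)
    (hq : O.q Θ Φ = (-O.E / (O.v ⬝ᵥ ρ)) • ρ) :
    Real.sin Φ * Real.sin Θ = -(O.τ ⬝ᵥ ρ) / (√(1 - O.mE2 O.pt) * (O.v ⬝ᵥ ρ)) := by
  have h1 := O.speed_pos.ne'
  have h2 := (O.momentum_pos hm).ne'
  have hE := (O.E_pos hm).ne'
  have h := O.τ_dot_q Θ Φ
  rw [hq, dotProduct_smul, smul_eq_mul] at h
  rw [O.sqrt_one_sub_mE2 hm]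
  field_simp at h ⊢
  linarith

section impact

variable {O} (h : F.IsReduced K α γ Ψ β m) (hm : 0 ≤ m O.pt) (hx : S.OffAxis x)
  (hρ : O.IsImpact Ψ x ρ)
include h hm hx hρ

theorem IsImpact.force_eq_zero : F.force γ Ψ m ((-O.E / (O.v ⬝ᵥ ρ)) • ρ) x = 0 := by
  rw [← O.quad_shadowMatrix'_eq_force h hx (O.E_pos hm).ne'
    (by rw [dotProduct_smul, smul_eq_mul, div_mul_cancel₀ _ hρ.v_dot_ne_zero]), quad_smul,
    hρ.critical, mul_zero]

theorem IsImpact.quad_inv_le : quad (S.gram x)⁻¹ ((-O.E / (O.v ⬝ᵥ ρ)) • ρ) ≤ -(m x) ^ 2 := by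
  have h1 := O.quad_shadowMatrix_of_v_dot (Ψ := Ψ) (x := x) (q := (-O.E / (O.v ⬝ᵥ ρ)) • ρ)
    (O.E_pos hm).ne' (by rw [dotProduct_smul, smul_eq_mul, div_mul_cancel₀ _ hρ.v_dot_ne_zero])
  rw [quad_smul] at h1
  have h2 := mul_nonpos_of_nonneg_of_nonpos (sq_nonneg (-O.E / (O.v ⬝ᵥ ρ))) hρ.nonpos
  rw [h1] at h2
  have := nonpos_of_mul_nonpos_right h2 (Real.exp_pos _)
  linarith

theorem IsImpact.isMassiveParticleSurface :
    F.IsMassiveParticleSurface m (F.Ω x) ((-O.E / (O.v ⬝ᵥ ρ)) • ρ) :=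
  h.isMassiveParticleSurface hx (hρ.quad_inv_le h hm hx) (hρ.force_eq_zero h hm hx)

end impact

/-- The points of the massive particle region are those with an impact vector. -/
theorem mem_massiveParticleRegion_iff (h : F.IsReduced K α γ Ψ β m) (hm : 0 ≤ m O.pt)
    (hx : S.OffAxis x) : x ∈ O.massiveParticleRegion ↔ ∃ ρ, O.IsImpact Ψ x ρ := by
  have hE := (O.E_pos hm).ne'
  constructor
  · rintro ⟨Θ, -, Φ, -, r, hr, c, I, s, hc, rfl⟩
    refine ⟨O.q Θ Φ, O.isImpact_q h hm hx (h.force_eq_zero hr hc.on_slice) ?_⟩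
    rw [O.quad_shadowMatrix_of_v_dot hE (O.v_dot_q Θ Φ)]
    have := hx.quad_inv_le hc.conserved
    rw [hc.worldline.norm s hc.mem] at this
    exact mul_nonpos_of_nonneg_of_nonpos (Real.exp_pos _).le (by linarith)
  · rintro ⟨ρ, hρ⟩
    have hv := hρ.v_dot_ne_zero
    -- The value required of `sin Φ sin Θ`. Only this product matters for `q`, so `Θ = π/2`
    -- suffices; `Φ = π - arcsin C` lies in `[0, 2π]`, unlike `arcsin C`, which may be negative.
    set C := -(O.τ ⬝ᵥ ρ) / (√(1 - O.mE2 O.pt) * (O.v ⬝ᵥ ρ)) with hC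
    have hpos : 0 < 1 - O.mE2 O.pt := by
      rw [O.one_sub_mE2 hm]
      have := O.speed_pos
      have := O.momentum_pos hm
      have := O.E_pos hm
      positivity
    have hC1 : |C| ≤ 1 := by
      rw [← sq_le_one_iff_abs_le_one, hC, div_pow, mul_pow, Real.sq_sqrt hpos.le, neg_sq]
      exact div_le_one_of_le₀ hρ.sines (mul_nonneg hpos.le (sq_nonneg _))
    rw [abs_le] at hC1
    have hπ := Real.pi_pos
    have hsin : Real.sin (Real.pi - Real.arcsin C) * Real.sin (Real.pi / 2) = C := by
      rw [Real.sin_pi_sub, Real.sin_arcsin hC1.1 hC1.2, Real.sin_pi_div_two, mul_one]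
    have hq := O.q_eq_of_sines hm hv (hsin.trans hC)
    have h1 := Real.arcsin_mem_Icc C
    refine ⟨Real.pi / 2, ⟨by linarith, by linarith⟩, Real.pi - Real.arcsin C,
      ⟨by linarith [h1.2], by linarith [h1.1]⟩, F.Ω x, ?_⟩
    rw [hq]
    exact ⟨hρ.isMassiveParticleSurface h hm hx, h.exists_touches hx (hρ.quad_inv_le h hm hx)⟩

end Observer

end

/-! ### Conservation law for captured particles -/

section

variable {M : Type*} [TopologicalSpace M] [ChartedSpace E4 M] [IsManifold (𝓡 4) ∞ M]

theorem hasMFDerivAt_of_isMIntegralCurveOn {X : ∀ x : M, T x} {p : ℝ → M} {J : Set ℝ}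
    (hJ : IsOpen J) (hp : IsMIntegralCurveOn p X J) (t : ℝ) (ht : t ∈ J) :
    HasMFDerivAt 𝓘(ℝ, ℝ) (𝓡 4) p t ((1 : ℝ →L[ℝ] ℝ).smulRight (X (p t))) :=
  (hp t ht).hasMFDerivAt (hJ.mem_nhds ht)

namespace Foliation

variable {S : AxiStationary M} {F : Foliation S}
  {K : ∀ x : M, T x →L[ℝ] T x →L[ℝ] ℝ} {α : M → ℝ} {γ : Fin 2 → Fin 2 → M → ℝ} {Ψ : M → ℝ}
  {β : ∀ x : M, T x →L[ℝ] ℝ} {m : M → ℝ} {p : ℝ → M} {J : Set ℝ} {q : Fin 2 → ℝ}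

/-- The integral curves of the normals are parametrized by the foliation parameter. -/
theorem Ω_integralCurve (hJo : IsOpen J) (hJ : IsPreconnected J)
    (hp : ∀ t ∈ J, HasMFDerivAt 𝓘(ℝ, ℝ) (𝓡 4) p t ((1 : ℝ →L[ℝ] ℝ).smulRight (F.flow (p t))))
    {t₀ : ℝ} (ht₀ : t₀ ∈ J) (h0 : F.Ω (p t₀) = t₀) : ∀ t ∈ J, F.Ω (p t) = t := by
  have hd : ∀ s ∈ J, HasDerivAt (fun t ↦ F.Ω (p t) - t) 0 s := fun s hs ↦ by
    have := (F.hasDerivAt_comp_flow (ContMDiff.mdifferentiableAt_of_smooth F.smooth _)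
      (hp s hs)).sub (hasDerivAt_id s)
    rwa [prime, diff_Ω_flow, sub_self] at this
  intro t ht
  have := hJo.is_const_of_deriv_eq_zero hJ
    (fun s hs ↦ (hd s hs).differentiableAt.differentiableWithinAt) (fun s hs ↦ (hd s hs).deriv)
    ht ht₀
  simp only [h0, sub_self] at this
  linarith

/-- Functions invariant under the stationary Killing vector field are, on a shell between two
slices, determined by their values on a compact set. -/
theorem CompactSections.exists_isCompact (hF : F.CompactSections) {a b : ℝ} (ha : a ∈ range F.Ω)
    (hb : b ∈ range F.Ω) : ∃ C : Set M, IsCompact C ∧ ∀ x, F.Ω x ∈ Icc a b → ∃ y ∈ C,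
      ∀ f : M → ℝ, ContMDiff (𝓡 4) 𝓘(ℝ, ℝ) ∞ f → (∀ z, diff f z (S.κ 0 z) = 0) → f x = f y := by
  obtain ⟨C, hC, hall⟩ := hF a ha b hb
  refine ⟨C, hC, fun x hx ↦ ?_⟩
  obtain ⟨σ, hσ, hσ0, t, ht⟩ := hall x hx
  refine ⟨σ t, ht, fun f hf hfκ ↦ ?_⟩
  have hd : ∀ s, HasDerivAt (fun s ↦ f (σ s)) 0 s := fun s ↦ by
    have h := hasDerivAt_comp_curve (ContMDiff.mdifferentiableAt_of_smooth hf (σ s))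
      (hσ s).mdifferentiableAt
    have hv : velocity σ s = S.κ 0 (σ s) := by
      unfold velocity
      rw [(hσ s).mfderiv]
      exact one_smul ℝ (S.κ 0 (σ s))
    rwa [hv, hfκ] at h
  rw [← hσ0]
  exact is_const_of_deriv_eq_zero (fun s ↦ (hd s).differentiableAt) (fun s ↦ (hd s).deriv) 0 t

namespace IsReduced

variable (h : F.IsReduced K α γ Ψ β m)
include h

theorem diff_exp_κ (a : Fin 2) (x : M) : diff (fun z ↦ Real.exp (Ψ z)) x (S.κ a x) = 0 := by
  rw [diff_exp_eq (F := F) h.reducible.smooth_Ψ, F.diff_gradSq_κ,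
    h.reducible.diff_weight_κ h.smooth h.conformal]
  ring

/-- The weight is constant along the orbits of the stationary Killing field, so its values on the
shell are taken on a compact set. -/
theorem exists_weight_le (hF : F.CompactSections) {a b : ℝ} (ha : a ∈ range F.Ω)
    (hb : b ∈ range F.Ω) : ∃ B, 0 < B ∧ ∀ x, F.Ω x ∈ Icc a b → F.weight Ψ x ≤ B := by
  obtain ⟨C, hC, hall⟩ := hF.exists_isCompact ha hb
  have hw := F.contMDiff_weight h.reducible.smooth_Ψ
  obtain ⟨B, hB⟩ := hC.exists_bound_of_continuousOn hw.continuous.continuousOn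
  refine ⟨max B 1, lt_max_of_lt_right one_pos, fun x hx ↦ ?_⟩
  obtain ⟨y, hy, hxy⟩ := hall x hx
  rw [hxy _ hw fun z ↦ h.reducible.diff_weight_κ h.smooth h.conformal z 0]
  exact (le_abs_self _).trans ((hB y hy).trans (le_max_left _ _))

theorem exists_exp_le (hF : F.CompactSections) {a b : ℝ} (ha : a ∈ range F.Ω)
    (hb : b ∈ range F.Ω) :
    ∃ B, ∀ x, F.Ω x ∈ Icc a b → Real.exp (Ψ x) ≤ B ∧ (Real.exp (Ψ x))⁻¹ ≤ B := by
  obtain ⟨C, hC, hall⟩ := hF.exists_isCompact ha hb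
  have hw := contMDiff_exp h.reducible.smooth_Ψ
  obtain ⟨B, hB⟩ := hC.exists_bound_of_continuousOn hw.continuous.continuousOn
  obtain ⟨B', hB'⟩ := hC.exists_bound_of_continuousOn
    (hw.continuous.inv₀ fun x ↦ (Real.exp_pos (Ψ x)).ne').continuousOn
  refine ⟨max B B', fun x hx ↦ ?_⟩
  obtain ⟨y, hy, hxy⟩ := hall x hx
  have hxy := hxy _ hw fun z ↦ h.diff_exp_κ 0 z
  rw [hxy]
  exact ⟨(le_abs_self _).trans ((hB y hy).trans (le_max_left _ _)),
    (le_abs_self _).trans ((hB' y hy).trans (le_max_right _ _))⟩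

/-- A potential of the force, as a function of the foliation parameter. -/
theorem exists_potential (q : Fin 2 → ℝ) (x₀ : M) : ∃ W : ℝ → ℝ,
    ∀ A ⊆ range F.Ω, IsPreconnected A → F.Ω x₀ ∈ A →
      ∀ x, F.Ω x ∈ A → HasDerivAt W (F.force γ Ψ m q x) (F.Ω x) := by
  classical
  -- The force as a function of the foliation parameter, with default value zero outside the range
  -- of `Ω`.
  set f : ℝ → ℝ := fun t ↦ if ht : ∃ x, F.Ω x = t then F.force γ Ψ m q ht.choose else 0 with hf
  have hfΩ : ∀ x, f (F.Ω x) = F.force γ Ψ m q x := fun x ↦ by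
    have hx : ∃ y, F.Ω y = F.Ω x := ⟨x, rfl⟩
    simp only [hf, dif_pos hx]
    exact h.force_const q _ _ hx.choose_spec
  have hcont : ∀ x, ContinuousAt f (F.Ω x) := fun x ↦ by
    obtain ⟨p, hp0, hp⟩ := F.exists_transversal x
    have h1 := F.hasDerivAt_comp_flow
      (ContMDiff.mdifferentiableAt_of_smooth (h.contMDiff_force q) _) hp.self_of_nhds.2
    refine h1.continuousAt.congr ?_
    filter_upwards [hp] with t ht
    rw [← hfΩ, ht.1]
  have hcontOn : ContinuousOn f (range F.Ω) := by
    rintro _ ⟨x, rfl⟩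
    exact (hcont x).continuousWithinAt
  -- The range of `Ω` may be disconnected, so the integral is a potential only on connected sets
  -- containing the base value. One `W` then serves both the values taken along a worldline and the
  -- interval `J`.
  refine ⟨fun t ↦ ∫ u in (F.Ω x₀)..t, f u, fun A hA hAc hx₀ x hx ↦ ?_⟩
  rw [← hfΩ]
  refine intervalIntegral.integral_hasDerivAt_right ?_
    (hcontOn.stronglyMeasurableAtFilter F.isOpen_range_Ω _ ⟨x, rfl⟩) (hcont x)
  exact (hcontOn.mono ((hAc.ordConnected.uIcc_subset hx₀ hx).trans hA)).intervalIntegrable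

end IsReduced

end Foliation

namespace Observer

variable {S : AxiStationary M} {F : Foliation S}
  {K : ∀ x : M, T x →L[ℝ] T x →L[ℝ] ℝ} {α : M → ℝ} {γ : Fin 2 → Fin 2 → M → ℝ} {Ψ : M → ℝ}
  {β : ∀ x : M, T x →L[ℝ] ℝ} {m : M → ℝ} {x : M} {q ρ : Fin 2 → ℝ} {Θ Φ : ℝ} {O : Observer F m}
  {p : ℝ → M} {J : Set ℝ} {c : ℝ → M} {I : Set ℝ}

theorem IsCaptured.conserved (h : F.IsReduced K α γ Ψ β m) (hc : O.IsCaptured Θ Φ c I) {s : ℝ}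
    (hs : s ∈ I) (a : Fin 2) :
    S.g.val (c s) (S.κ a (c s)) (velocity c s) = O.q Θ Φ a := by
  rw [h.momentum_const hc.worldline hc.zero_mem hs]
  change (fun z : TangentBundle (𝓡 4) M ↦ S.g.val z.1 (S.κ a z.1) z.2 = O.q Θ Φ a)
    ⟨c 0, velocity c 0⟩
  rw [hc.init_velocity]
  rfl

theorem IsCaptured.lapse_mul_diff (hc : O.IsCaptured Θ Φ c I) :
    F.lapse (c 0) * diff F.Ω (c 0) (velocity c 0) = -(O.momentum * Real.cos Θ) := by
  change (fun z : TangentBundle (𝓡 4) M ↦ F.lapse z.1 * diff F.Ω z.1 z.2 =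
    -(O.momentum * Real.cos Θ)) ⟨c 0, velocity c 0⟩
  rw [hc.init_velocity]
  exact O.diff_Ω_ray Θ Φ

theorem kinetic_eq (s : ℝ) : F.kinetic Ψ c s =
    Real.exp (Ψ (c s)) * (S.g.val (c s) (F.normal (c s)) (velocity c s)) ^ 2 := by
  rw [F.val_normal, Foliation.kinetic, Foliation.weight, ← F.lapse_sq]
  ring

theorem IsCaptured.kinetic_zero (hc : O.IsCaptured Θ Φ c I) :
    F.kinetic Ψ c 0 = Real.exp (Ψ O.pt) * (O.momentum * Real.cos Θ) ^ 2 := by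
  rw [kinetic_eq, F.val_normal, hc.lapse_mul_diff, hc.init_pt, neg_sq]

/-- An integral curve of the normals through the observer, on an open interval. -/
structure IsNormalCurve (O : Observer F m) (p : ℝ → M) (J : Set ℝ) : Prop where
  isOpen : IsOpen J
  ordConnected : J.OrdConnected
  mem : F.Ω O.pt ∈ J
  init : p (F.Ω O.pt) = O.pt
  deriv : ∀ t ∈ J, HasMFDerivAt 𝓘(ℝ, ℝ) (𝓡 4) p t ((1 : ℝ →L[ℝ] ℝ).smulRight (F.flow (p t)))

theorem IsNormalCurve.Ω_eq (hp : O.IsNormalCurve p J) : ∀ t ∈ J, F.Ω (p t) = t :=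
  F.Ω_integralCurve hp.isOpen hp.ordConnected.isPreconnected hp.deriv hp.mem (by rw [hp.init])

theorem IsNormalCurve.subset_range (hp : O.IsNormalCurve p J) : J ⊆ range F.Ω :=
  fun t ht ↦ ⟨p t, hp.Ω_eq t ht⟩

theorem IsNormalCurve.offAxis (h : F.IsReduced K α γ Ψ β m) (hp : O.IsNormalCurve p J) :
    ∀ t ∈ J, S.OffAxis (p t) :=
  h.offAxis_of_integralCurve hp.ordConnected.isPreconnected hp.deriv hp.isOpen hp.mem
    (by rw [hp.init]; exact O.offAxis)

/-- On the normal curve the shadow matrix is itself a potential of the force. -/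
theorem IsNormalCurve.hasDerivAt (h : F.IsReduced K α γ Ψ β m) (hm : 0 ≤ m O.pt)
    (hp : O.IsNormalCurve p J) (hq : O.v ⬝ᵥ q = -O.E) {t : ℝ} (ht : t ∈ J) :
    HasDerivAt (fun t ↦ quad (O.shadowMatrix Ψ (p t)) q) (F.force γ Ψ m q (p t)) t := by
  have := O.hasDerivAt_quad_shadowMatrix h (hp.offAxis h t ht) (hp.deriv t ht) q
  rwa [hq, neg_sq, div_self (pow_ne_zero 2 (O.E_pos hm).ne'), mul_one] at this

/-- Conservation of the Killing tensor for captured particles. -/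
theorem IsCaptured.kinetic_eq (h : F.IsReduced K α γ Ψ β m) (hm : 0 ≤ m O.pt)
    (hp : O.IsNormalCurve p J) (hc : O.IsCaptured Θ Φ c I) {s : ℝ} (hs : s ∈ I)
    (hsJ : F.Ω (c s) ∈ J) : F.kinetic Ψ c s =
      Real.exp (Ψ O.pt) * (O.momentum * Real.cos Θ) ^ 2 +
        quad (O.shadowMatrix Ψ O.pt) (O.q Θ Φ) -
        quad (O.shadowMatrix Ψ (p (F.Ω (c s)))) (O.q Θ Φ) := by
  -- The worldline leaves the normal curve and may leave the shell over `J` in between. The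
  -- potential `W` compares the conservation law along the worldline with the shadow matrix along
  -- the curve, both started at the observer.
  obtain ⟨W, hW⟩ := h.exists_potential (O.q Θ Φ) O.pt
  have hw := hc.worldline
  have hI := hw.ordConnected.isPreconnected
  have hΩc : ∀ u ∈ I, HasDerivAt (fun t ↦ F.Ω (c t)) (diff F.Ω (c u) (velocity c u)) u :=
    fun u hu ↦ Foliation.hasDerivAt_Ω_worldline F hw hu
  have h1 : ∀ u ∈ I, HasDerivAt (fun t ↦ F.kinetic Ψ c t + W (F.Ω (c t))) 0 u := by
    intro u hu
    have e1 := h.hasDerivAt_kinetic hw hu (hc.conserved h hu)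
    have e2 := hW ((fun t ↦ F.Ω (c t)) '' I) (by rintro _ ⟨t, -, rfl⟩; exact ⟨c t, rfl⟩)
      (hI.image _ fun t ht ↦ (hΩc t ht).continuousAt.continuousWithinAt)
      ⟨0, hc.zero_mem, by simp only [hc.init_pt]⟩ (c u) ⟨u, hu, rfl⟩
    refine (e1.add (HasDerivAt.comp u e2 (hΩc u hu))).congr_deriv ?_
    ring
  have h2 := hw.isOpen.is_const_of_deriv_eq_zero hI
    (fun u hu ↦ (h1 u hu).differentiableAt.differentiableWithinAt) (fun u hu ↦ (h1 u hu).deriv)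
    hs hc.zero_mem
  have h3 : ∀ u ∈ J, HasDerivAt
      (fun t ↦ quad (O.shadowMatrix Ψ (p t)) (O.q Θ Φ) - W t) 0 u := by
    intro u hu
    have e1 := hp.hasDerivAt h hm (O.v_dot_q Θ Φ) hu
    have hu' := hp.Ω_eq u hu
    have e2 := hW J hp.subset_range hp.ordConnected.isPreconnected hp.mem (p u)
      (by rwa [hu'])
    rw [hu'] at e2
    exact (e1.sub e2).congr_deriv (sub_self _)
  have h4 := hp.isOpen.is_const_of_deriv_eq_zero hp.ordConnected.isPreconnected
    (fun u hu ↦ (h3 u hu).differentiableAt.differentiableWithinAt) (fun u hu ↦ (h3 u hu).deriv)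
    hsJ hp.mem
  simp only [hp.init] at h4
  simp only [hc.init_pt] at h2
  have h5 := hc.kinetic_zero (Ψ := Ψ)
  linarith

/-- For a boundary position, the shadow matrix at the slice. -/
theorem IsCaptured.quad_sub_eq (h : F.IsReduced K α γ Ψ β m) (hm : 0 ≤ m O.pt)
    (hF : F.CompactSections) (hp : O.IsNormalCurve p J) (hc : O.IsCaptured Θ Φ c I) {r : ℝ}
    (hr : r ∈ J) {l : Filter ℝ} [l.NeBot] (hl : ∀ᶠ s in l, s ∈ I)
    (ht : F.AsymptoticallyTangent c r l) :
    quad (O.shadowMatrix Ψ (p r)) (O.q Θ Φ) - quad (O.shadowMatrix Ψ O.pt) (O.q Θ Φ) =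
      Real.exp (Ψ O.pt) * (O.momentum * Real.cos Θ) ^ 2 := by
  have hJ := ht.1.eventually (hp.isOpen.mem_nhds hr)
  have h1 := ((hp.hasDerivAt h hm (O.v_dot_q Θ Φ) hr).continuousAt.tendsto.comp ht.1).const_sub
    (Real.exp (Ψ O.pt) * (O.momentum * Real.cos Θ) ^ 2 +
      quad (O.shadowMatrix Ψ O.pt) (O.q Θ Φ))
  -- The convergence `g(n,ċ) → 0` gives this only with a bound on `e^Ψ` near the slice, which
  -- compact sections provide.
  have h2 : Tendsto (F.kinetic Ψ c) l (𝓝 0) := by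
    obtain ⟨ε, hε, hball⟩ := Metric.nhds_basis_closedBall.mem_iff.1 (hp.isOpen.mem_nhds hr)
    rw [Real.closedBall_eq_Icc] at hball
    have hsub := hball.trans hp.subset_range
    obtain ⟨B, hB⟩ := h.exists_exp_le hF (hsub ⟨le_rfl, by linarith⟩) (hsub ⟨by linarith, le_rfl⟩)
    refine squeeze_zero' (.of_forall fun s ↦ F.kinetic_nonneg Ψ c s)
      (g := fun s ↦ B * (S.g.val (c s) (F.normal (c s)) (velocity c s)) ^ 2) ?_ ?_
    · filter_upwards [ht.1.eventually (Icc_mem_nhds (show r - ε < r by linarith)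
        (show r < r + ε by linarith))] with s hs
      rw [Observer.kinetic_eq]
      exact mul_le_mul_of_nonneg_right (hB _ hs).1 (sq_nonneg _)
    · simpa using (ht.2.pow 2).const_mul B
  have h3 := tendsto_nhds_unique h2 (h1.congr' (by
    filter_upwards [hJ, hl] with s hsJ hsI
    exact (hc.kinetic_eq h hm hp hsI hsJ).symm))
  linarith

end Observer

end

section

/-! ## Stereographic coordinates -/

theorem tan_half_mul (Θ : ℝ) (hΘ : 1 + Real.cos Θ ≠ 0) :
    Real.tan (Θ / 2) * (1 + Real.cos Θ) = Real.sin Θ := by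
  have h1 : Real.cos Θ = 2 * Real.cos (Θ / 2) ^ 2 - 1 := by
    rw [← Real.cos_two_mul]; ring_nf
  have h2 : Real.sin Θ = 2 * Real.sin (Θ / 2) * Real.cos (Θ / 2) := by
    rw [← Real.sin_two_mul]; ring_nf
  have h3 : Real.cos (Θ / 2) ≠ 0 := by
    intro h0
    rw [h1, h0] at hΘ
    norm_num at hΘ
  rw [Real.tan_eq_sin_div_cos, h2, h1]
  field_simp
  ring

theorem sq_eq_one_of_sign {ε : ℝ} (hε : ε = 1 ∨ ε = -1) : ε ^ 2 = 1 := by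
  rcases hε with rfl | rfl <;> norm_num

theorem exists_sin_cos {u v : ℝ} (h : u ^ 2 + v ^ 2 = 1) :
    ∃ Φ ∈ Icc 0 (2 * Real.pi), Real.sin Φ = u ∧ Real.cos Φ = v := by
  have hv : v ^ 2 ≤ 1 := by linarith [sq_nonneg u]
  rw [sq_le_one_iff_abs_le_one, abs_le] at hv
  have hc := Real.cos_arccos hv.1 hv.2
  have hs : Real.sin (Real.arccos v) = |u| := by
    rw [Real.sin_arccos, ← Real.sqrt_sq_eq_abs]
    congr 1
    linarith
  have h0 := Real.arccos_nonneg v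
  have hπ := Real.arccos_le_pi v
  rcases le_total 0 u with hu | hu
  · exact ⟨Real.arccos v, ⟨h0, by linarith⟩, by rw [hs, abs_of_nonneg hu], hc⟩
  · refine ⟨2 * Real.pi - Real.arccos v, ⟨by linarith, by linarith⟩, ?_, ?_⟩
    · rw [Real.sin_two_pi_sub, hs, abs_of_nonpos hu, neg_neg]
    · rw [Real.cos_two_pi_sub, hc]

theorem cos_add_one_ne_zero {Θ : ℝ} (hΘ : Θ ∈ Icc 0 Real.pi) (hne : Θ ≠ Real.pi) :
    1 + Real.cos Θ ≠ 0 := by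
  intro h0
  refine hne (Real.injOn_cos hΘ ⟨Real.pi_pos.le, le_rfl⟩ ?_)
  rw [Real.cos_pi]
  linarith

section sphere

variable {L a b z ε Θ Φ : ℝ}

/-- Up to signs, `a/L`, `b/L`, `z/L` are the Cartesian coordinates of the celestial point, and
`tan(Θ/2) = sin Θ / (1 + cos Θ)`. Only the square of `cos Φ sin Θ` is determined, hence the sign
`δ`. -/
theorem stereo_of_angles (hL : L ≠ 0) (habz : a ^ 2 + b ^ 2 + z ^ 2 = L ^ 2) (hε : ε ^ 2 = 1)
    (hcos : Real.cos Θ = ε * a / L) (hsin : Real.sin Φ * Real.sin Θ = -z / L)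
    (hΘ : 1 + Real.cos Θ ≠ 0) : L + ε * a ≠ 0 ∧ stereoX Θ Φ = 2 * z / (L + ε * a) ∧
      ∃ δ : ℝ, (δ = 1 ∨ δ = -1) ∧ stereoY Θ Φ = δ * (2 * b / (L + ε * a)) := by
  have h1 : L * (1 + Real.cos Θ) = L + ε * a := by
    rw [hcos]
    field_simp
  have hD : L + ε * a ≠ 0 := h1 ▸ mul_ne_zero hL hΘ
  have ht := tan_half_mul Θ hΘ
  have hcosL : L * Real.cos Θ = ε * a := by linarith
  have hz : L * (Real.sin Φ * Real.sin Θ) = -z := by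
    rw [hsin]
    field_simp
  refine ⟨hD, ?_, ?_⟩
  · rw [eq_div_iff hD, ← h1, stereoX]
    linear_combination -2 * Real.sin Φ * L * ht - 2 * hz
  · have hb : (L * (Real.cos Φ * Real.sin Θ)) ^ 2 = b ^ 2 := by
      have hs1 := Real.sin_sq_add_cos_sq Θ
      have hs2 := Real.sin_sq_add_cos_sq Φ
      have e1 : (L * Real.cos Θ) ^ 2 = a ^ 2 := by rw [hcosL, mul_pow, hε, one_mul]
      have e2 : (L * (Real.sin Φ * Real.sin Θ)) ^ 2 = z ^ 2 := by rw [hz, neg_sq]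
      linear_combination -e1 - e2 - habz + L ^ 2 * hs1 + L ^ 2 * Real.sin Θ ^ 2 * hs2
    have hY : ∀ δ : ℝ, L * (Real.cos Φ * Real.sin Θ) = -δ * b →
        stereoY Θ Φ = δ * (2 * b / (L + ε * a)) := by
      intro δ hδ
      rw [← mul_div_assoc, eq_div_iff hD, ← h1, stereoY]
      linear_combination -2 * Real.cos Φ * L * ht - 2 * hδ
    rcases sq_eq_sq_iff_eq_or_eq_neg.1 hb with h | h
    · exact ⟨-1, Or.inr rfl, hY _ (by rw [h]; ring)⟩
    · exact ⟨1, Or.inl rfl, hY _ (by rw [h]; ring)⟩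

theorem angles_of_stereo {δ : ℝ} (hL : L ≠ 0) (habz : a ^ 2 + b ^ 2 + z ^ 2 = L ^ 2)
    (hε : ε ^ 2 = 1) (hδ : δ ^ 2 = 1) (hD : L + ε * a ≠ 0) :
    ∃ Θ ∈ Ico 0 Real.pi, ∃ Φ ∈ Icc 0 (2 * Real.pi), stereoX Θ Φ = 2 * z / (L + ε * a) ∧
      stereoY Θ Φ = δ * (2 * b / (L + ε * a)) ∧ Real.cos Θ = ε * a / L ∧
      Real.sin Φ * Real.sin Θ = -z / L := by
  have hL2 : 0 < L ^ 2 := by positivity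
  have hC2 : 1 - (ε * a / L) ^ 2 = (b ^ 2 + z ^ 2) / L ^ 2 := by
    rw [div_pow, mul_pow, hε, ← habz]
    rw [← habz] at hL2
    field_simp
    ring
  have hC1 : (ε * a / L) ^ 2 ≤ 1 := by
    have : 0 ≤ (b ^ 2 + z ^ 2) / L ^ 2 := by positivity
    linarith
  rw [sq_le_one_iff_abs_le_one, abs_le] at hC1
  have hcos := Real.cos_arccos hC1.1 hC1.2
  have hsin2 : Real.sin (Real.arccos (ε * a / L)) ^ 2 = (b ^ 2 + z ^ 2) / L ^ 2 := by
    rw [← hC2, Real.sin_sq, hcos]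
  set Θ := Real.arccos (ε * a / L) with hΘ
  have h1 : 1 + Real.cos Θ ≠ 0 := by
    rw [hcos]
    intro h0
    apply hD
    field_simp at h0
    linarith
  have hne : Θ ≠ Real.pi := by
    intro h0
    rw [h0, Real.cos_pi] at h1
    norm_num at h1
  obtain ⟨Φ, hΦ, hz, hb⟩ : ∃ Φ ∈ Icc 0 (2 * Real.pi), Real.sin Φ * Real.sin Θ = -z / L ∧
      Real.cos Φ * Real.sin Θ = -δ * b / L := by
    -- At the pole `Φ` is arbitrary; elsewhere it is the polar angle of a point of the unit circle.
    by_cases hs : Real.sin Θ = 0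
    · rw [hs] at hsin2 ⊢
      have h0 : b ^ 2 + z ^ 2 = 0 := by
        have := (div_eq_zero_iff.1 (hsin2.symm.trans (by norm_num)))
        exact this.resolve_right hL2.ne'
      have hb0 : b = 0 := pow_eq_zero_iff two_ne_zero |>.1 (by linarith [sq_nonneg b, sq_nonneg z])
      have hz0 : z = 0 := pow_eq_zero_iff two_ne_zero |>.1 (by linarith [sq_nonneg b, sq_nonneg z])
      exact ⟨0, ⟨le_rfl, by linarith [Real.pi_pos]⟩, by simp [hz0], by simp [hb0]⟩
    · obtain ⟨Φ, hΦ, h2, h3⟩ := exists_sin_cos (u := -z / L / Real.sin Θ)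
        (v := -δ * b / L / Real.sin Θ) (by
          have hne2 : Real.sin Θ ^ 2 ≠ 0 := pow_ne_zero 2 hs
          rw [div_pow (-z / L), div_pow (-δ * b / L), ← add_div, div_eq_one_iff_eq hne2, hsin2,
            div_pow, div_pow, mul_pow, neg_sq, neg_sq, hδ]
          ring)
      exact ⟨Φ, hΦ, by rw [h2, div_mul_cancel₀ _ hs], by rw [h3, div_mul_cancel₀ _ hs]⟩
  have ht := tan_half_mul Θ h1
  have h2 : L * (1 + Real.cos Θ) = L + ε * a := by
    rw [hcos]
    field_simp
  have hz' : L * (Real.sin Φ * Real.sin Θ) = -z := by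
    rw [hz]
    field_simp
  have hb' : L * (Real.cos Φ * Real.sin Θ) = -δ * b := by
    rw [hb]
    field_simp
  refine ⟨Θ, ⟨Real.arccos_nonneg _, lt_of_le_of_ne (Real.arccos_le_pi _) hne⟩, Φ, hΦ, ?_, ?_, hcos, hz⟩
  · rw [eq_div_iff hD, ← h2, stereoX]
    linear_combination -2 * Real.sin Φ * L * ht - 2 * hz'
  · rw [← mul_div_assoc, eq_div_iff hD, ← h2, stereoY]
    linear_combination -2 * Real.cos Φ * L * ht - 2 * hb'

end sphere

/-! ### Formulas for the boundary positions -/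

variable {M : Type*} [TopologicalSpace M] [ChartedSpace E4 M] [IsManifold (𝓡 4) ∞ M]

namespace Observer

variable {S : AxiStationary M} {F : Foliation S}
  {K : ∀ x : M, T x →L[ℝ] T x →L[ℝ] ℝ} {α : M → ℝ} {γ : Fin 2 → Fin 2 → M → ℝ} {Ψ : M → ℝ}
  {β : ∀ x : M, T x →L[ℝ] ℝ} {m : M → ℝ} {x : M} {q ρ : Fin 2 → ℝ} {Θ Φ ε : ℝ} {O : Observer F m}
  {p : ℝ → M} {J : Set ℝ} {c : ℝ → M} {I : Set ℝ}

theorem rootA_sq (hA : 0 ≤ quad (O.shadowMatrix Ψ x - O.shadowMatrix Ψ O.pt) ρ) :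
    O.rootA Ψ x ρ ^ 2 = O.speed ^ 2 * (Real.exp (Ψ O.pt))⁻¹ *
      (quad (O.shadowMatrix Ψ x) ρ - quad (O.shadowMatrix Ψ O.pt) ρ) := by
  have he : Real.exp (-Ψ O.pt / 2) ^ 2 = (Real.exp (Ψ O.pt))⁻¹ := by
    rw [← Real.exp_nat_mul, ← Real.exp_neg]
    congr 1
    push_cast
    ring
  rw [rootA, mul_pow, mul_pow, Real.sq_sqrt hA, he, quad_sub]

theorem rootB_sq (hB : quad (O.shadowMatrix Ψ x) ρ ≤ 0) :
    O.rootB Ψ x ρ ^ 2 = -(O.speed ^ 2 * (Real.exp (Ψ O.pt))⁻¹ * quad (O.shadowMatrix Ψ x) ρ) := by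
  have he : Real.exp (-Ψ O.pt / 2) ^ 2 = (Real.exp (Ψ O.pt))⁻¹ := by
    rw [← Real.exp_nat_mul, ← Real.exp_neg]
    congr 1
    push_cast
    ring
  rw [rootB, mul_pow, mul_pow, Real.sq_sqrt (neg_nonneg.2 hB), he]
  ring

theorem sqrt_one_sub_mE2_pos (hm : 0 ≤ m O.pt) : 0 < √(1 - O.mE2 O.pt) := by
  rw [O.sqrt_one_sub_mE2 hm]
  exact div_pos (mul_pos O.speed_pos (O.momentum_pos hm)) (O.E_pos hm)

theorem sq_sqrt_one_sub_mE2 (hm : 0 ≤ m O.pt) : √(1 - O.mE2 O.pt) ^ 2 = 1 - O.mE2 O.pt := by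
  refine Real.sq_sqrt ?_
  rw [O.one_sub_mE2 hm]
  exact sq_nonneg _

/-- The square roots in the formulas are the coordinates of a point of a sphere. -/
theorem IsImpact.sq_add_sq_add_sq (hm : 0 ≤ m O.pt) (hρ : O.IsImpact Ψ x ρ)
    (hA : 0 ≤ quad (O.shadowMatrix Ψ x - O.shadowMatrix Ψ O.pt) ρ) :
    O.rootA Ψ x ρ ^ 2 + O.rootB Ψ x ρ ^ 2 + (O.τ ⬝ᵥ ρ) ^ 2 =
      (√(1 - O.mE2 O.pt) * (O.v ⬝ᵥ ρ)) ^ 2 := by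
  have he := mul_inv_cancel₀ (Real.exp_pos (Ψ O.pt)).ne'
  have h1 := O.quad_shadowMatrix_pt (Ψ := Ψ) hm ρ
  rw [rootA_sq hA, rootB_sq hρ.nonpos, mul_pow, sq_sqrt_one_sub_mE2 hm]
  linear_combination -(Real.exp (Ψ O.pt))⁻¹ * h1 +
    ((1 - O.mE2 O.pt) * (O.v ⬝ᵥ ρ) ^ 2 - (O.τ ⬝ᵥ ρ) ^ 2) * he

theorem IsImpact.stereo_of_angle (hm : 0 ≤ m O.pt) (hρ : O.IsImpact Ψ x ρ)
    (hA : 0 ≤ quad (O.shadowMatrix Ψ x - O.shadowMatrix Ψ O.pt) ρ) (hε : ε = 1 ∨ ε = -1)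
    (hΘ : Θ ∈ Icc 0 Real.pi) (hne : Θ ≠ Real.pi) (h : O.AngleFormula Ψ x ρ ε Θ Φ) :
    ∃ δ : ℝ, (δ = 1 ∨ δ = -1) ∧ O.StereoFormula Ψ x ρ ε δ (stereoX Θ Φ) (stereoY Θ Φ) := by
  obtain ⟨hD, hX, δ, hδ, hY⟩ := stereo_of_angles
    (mul_ne_zero (sqrt_one_sub_mE2_pos hm).ne' hρ.v_dot_ne_zero)
    (hρ.sq_add_sq_add_sq hm hA) (sq_eq_one_of_sign hε) h.1 h.2 (cos_add_one_ne_zero hΘ hne)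
  exact ⟨δ, hδ, hD, hX, hY⟩

theorem IsImpact.stereo_iff (hm : 0 ≤ m O.pt) (hρ : O.IsImpact Ψ x ρ)
    (hA : 0 ≤ quad (O.shadowMatrix Ψ x - O.shadowMatrix Ψ O.pt) ρ) (hε : ε = 1 ∨ ε = -1)
    (X Y : ℝ) : (∃ δ : ℝ, (δ = 1 ∨ δ = -1) ∧ O.StereoFormula Ψ x ρ ε δ X Y) ↔
      ∃ Θ ∈ Ico 0 Real.pi, ∃ Φ ∈ Icc 0 (2 * Real.pi), X = stereoX Θ Φ ∧ Y = stereoY Θ Φ ∧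
        O.AngleFormula Ψ x ρ ε Θ Φ := by
  constructor
  · rintro ⟨δ, hδ, hD, hX, hY⟩
    obtain ⟨Θ, hΘ, Φ, hΦ, hX', hY', hcos, hsin⟩ := angles_of_stereo
      (mul_ne_zero (sqrt_one_sub_mE2_pos hm).ne' hρ.v_dot_ne_zero) (hρ.sq_add_sq_add_sq hm hA)
      (sq_eq_one_of_sign hε) (sq_eq_one_of_sign hδ) hD
    exact ⟨Θ, hΘ, Φ, hΦ, hX.trans hX'.symm, hY.trans hY'.symm, hcos, hsin⟩
  · rintro ⟨Θ, hΘ, Φ, -, rfl, rfl, h⟩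
    exact hρ.stereo_of_angle hm hA hε ⟨hΘ.1, hΘ.2.le⟩ hΘ.2.ne h

/-- Every boundary position is given by the formulas. -/
theorem exists_impact_of_isBoundary (h : F.IsReduced K α γ Ψ β m) (hm : 0 ≤ m O.pt)
    (hF : F.CompactSections) (hp : O.IsNormalCurve p J) {r : ℝ} (hr : r ∈ J)
    (hΘ : Θ ∈ Icc 0 Real.pi) (hb : O.IsBoundary r Θ Φ) :
    ∃ ρ, O.IsImpact Ψ (p r) ρ ∧
      0 ≤ quad (O.shadowMatrix Ψ (p r) - O.shadowMatrix Ψ O.pt) ρ ∧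
      (∀ a, O.q Θ Φ a = -O.E * ρ a / (O.v ⬝ᵥ ρ)) ∧
      ∃ ε : ℝ, (ε = 1 ∨ ε = -1) ∧ O.AngleFormula Ψ (p r) ρ ε Θ Φ ∧
        (Θ ≠ Real.pi → ∃ δ : ℝ, (δ = 1 ∨ δ = -1) ∧
          O.StereoFormula Ψ (p r) ρ ε δ (stereoX Θ Φ) (stereoY Θ Φ)) := by
  obtain ⟨hmps, c, I, hc, hdir⟩ := hb
  have hE := (O.E_pos hm).ne'
  have hV := O.speed_pos.ne'
  have hr0 := O.momentum_pos hm
  have hv := O.v_dot_q Θ Φ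
  have hvne : O.v ⬝ᵥ O.q Θ Φ ≠ 0 := by rw [hv]; exact neg_ne_zero.2 hE
  have hS : quad (O.shadowMatrix Ψ (p r)) (O.q Θ Φ) - quad (O.shadowMatrix Ψ O.pt) (O.q Θ Φ) =
      Real.exp (Ψ O.pt) * (O.momentum * Real.cos Θ) ^ 2 := by
    rcases hdir with ⟨hI, ht⟩ | ⟨hI, ht⟩
    · exact hc.quad_sub_eq h hm hF hp hr ((eventually_le_atBot 0).mono fun s hs ↦ hI hs) ht
    · exact hc.quad_sub_eq h hm hF hp hr ((eventually_ge_atTop 0).mono fun s hs ↦ hI hs) ht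
  have hSO := O.quad_shadowMatrix_pt_q (Ψ := Ψ) hm Θ Φ
  have hexp := Real.exp_pos (Ψ O.pt)
  have hneg : quad (O.shadowMatrix Ψ (p r)) (O.q Θ Φ) ≤ 0 := by
    have h1 := Real.sin_sq_add_cos_sq Θ
    have h2 := Real.sin_sq_add_cos_sq Φ
    -- Combining the asymptotic relation with the value at the observer leaves the square of the
    -- `e₂` component of the spatial momentum.
    have h3 : quad (O.shadowMatrix Ψ (p r)) (O.q Θ Φ) =
        -(Real.exp (Ψ O.pt) * (O.momentum * (Real.cos Φ * Real.sin Θ)) ^ 2) := by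
      linear_combination hS + hSO + Real.exp (Ψ O.pt) * O.momentum ^ 2 * h1
        + Real.exp (Ψ O.pt) * O.momentum ^ 2 * Real.sin Θ ^ 2 * h2
    rw [h3]
    exact neg_nonpos.2 (mul_nonneg hexp.le (sq_nonneg _))
  have himp := O.isImpact_q h hm (hp.offAxis h r hr) (h.force_eq_zero hmps (hp.Ω_eq r hr)) hneg
  have hA : 0 ≤ quad (O.shadowMatrix Ψ (p r) - O.shadowMatrix Ψ O.pt) (O.q Θ Φ) := by
    rw [quad_sub, hS]
    exact mul_nonneg hexp.le (sq_nonneg _)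
  have hrootA : O.rootA Ψ (p r) (O.q Θ Φ) = O.speed * O.momentum * |Real.cos Θ| := by
    have h1 : O.rootA Ψ (p r) (O.q Θ Φ) ^ 2 = (O.speed * O.momentum * |Real.cos Θ|) ^ 2 := by
      rw [rootA_sq hA, hS, mul_pow _ |Real.cos Θ|, sq_abs]
      field_simp
    have h2 : 0 ≤ O.rootA Ψ (p r) (O.q Θ Φ) :=
      mul_nonneg (mul_nonneg O.speed_pos.le (Real.exp_pos _).le) (Real.sqrt_nonneg _)
    exact (pow_left_inj₀ h2 (mul_nonneg (mul_nonneg O.speed_pos.le hr0.le) (abs_nonneg _))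
      two_ne_zero).1 h1
  have hsines := O.sines_of_q_eq (Θ := Θ) (Φ := Φ) hm hvne (by
    rw [hv, div_self (neg_ne_zero.2 hE), one_smul])
  -- The impact vector is `q` itself, for which `v̄^a q_a = -Ē` is negative; so `ε` is opposite to
  -- the sign of `cos Θ`.
  obtain ⟨ε, hε, hcos⟩ : ∃ ε : ℝ, (ε = 1 ∨ ε = -1) ∧ Real.cos Θ = -ε * |Real.cos Θ| := by
    rcases le_total 0 (Real.cos Θ) with h0 | h0
    · exact ⟨-1, Or.inr rfl, by rw [abs_of_nonneg h0]; ring⟩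
    · exact ⟨1, Or.inl rfl, by rw [abs_of_nonpos h0]; ring⟩
  have hangle : O.AngleFormula Ψ (p r) (O.q Θ Φ) ε Θ Φ := by
    refine ⟨?_, hsines⟩
    rw [hrootA, hv, O.sqrt_one_sub_mE2 hm]
    have h1 : ε * (O.speed * O.momentum * |Real.cos Θ|) / (O.speed * O.momentum / O.E * -O.E) =
        -ε * |Real.cos Θ| := by
      field_simp
    rw [h1]
    exact hcos
  refine ⟨O.q Θ Φ, himp, hA, fun a ↦ ?_, ε, hε, hangle, fun hne ↦
    himp.stereo_of_angle hm hA hε hΘ hne hangle⟩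
  rw [hv]
  field_simp

end Observer

end

/-! ### Asymptotic motion and the converse -/

section

/-- One-dimensional motion towards a zero of the kinetic energy which is not reached. -/
theorem tendsto_zero_of_energy {u v G : ℝ → ℝ} (hu : ∀ s, 0 ≤ s → HasDerivAt u (v s) s)
    (hv : ∀ s, 0 ≤ s → ContinuousAt v s) (hne : ∀ s, 0 ≤ s → u s ≠ 0) (hu0 : 0 < u 0) (hv0 : v 0 < 0)
    (hG : ∀ s, 0 ≤ s → u s ∈ Ioc 0 (u 0) → G (u s) ≤ v s ^ 2)
    (hGc : ContinuousOn G (Icc 0 (u 0))) (hGpos : ∀ y ∈ Ioc 0 (u 0), 0 < G y) :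
    (∀ s, 0 ≤ s → u s ∈ Ioc 0 (u 0)) ∧ Tendsto u atTop (𝓝 0) := by
  have hpos : ∀ s, 0 ≤ s → 0 < u s := by
    intro s hs
    by_contra! hle
    obtain ⟨t, ht, ht0⟩ := intermediate_value_Icc' hs
      (fun t ht ↦ (hu t ht.1).continuousAt.continuousWithinAt) ⟨hle, hu0.le⟩
    exact hne t ht.1 ht0
  have hanti : ∀ b, (∀ s ∈ Ico 0 b, v s < 0) → AntitoneOn u (Icc 0 b) := fun b hb ↦ by
    refine antitoneOn_of_deriv_nonpos (convex_Icc 0 b)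
      (fun t ht ↦ (hu t ht.1).continuousAt.continuousWithinAt) (fun t ht ↦ ?_) (fun t ht ↦ ?_)
    · rw [interior_Icc] at ht
      exact (hu t ht.1.le).differentiableAt.differentiableWithinAt
    · rw [interior_Icc] at ht
      rw [(hu t ht.1.le).deriv]
      exact (hb t ⟨ht.1.le, ht.2⟩).le
  have hneg : ∀ s, 0 ≤ s → v s < 0 := by
    intro s hs
    by_contra! hle
    have hvc : ContinuousOn v (Icc 0 s) := fun t ht ↦ (hv t ht.1).continuousWithinAt
    have hclosed : IsCompact (Icc 0 s ∩ v ⁻¹' {0}) :=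
      isCompact_Icc.of_isClosed_subset
        (hvc.preimage_isClosed_of_isClosed isClosed_Icc isClosed_singleton) inter_subset_left
    obtain ⟨t₁, ht₁, ht₁0⟩ := intermediate_value_Icc hs hvc ⟨hv0.le, hle⟩
    -- Take the first zero of the velocity. Up to it `u` decreases and stays in `(0, u 0]`, where
    -- the positive lower bound `G` forbids a zero.
    obtain ⟨t, ⟨ht, ht0⟩, hleast⟩ := hclosed.exists_isLeast ⟨t₁, ht₁, ht₁0⟩
    have ht0 : v t = 0 := ht0
    have hbefore : ∀ w ∈ Ico 0 t, v w < 0 := by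
      intro w hw
      by_contra! hlew
      obtain ⟨t₂, ht₂, ht₂0⟩ := intermediate_value_Icc hw.1
        (hvc.mono (Icc_subset_Icc_right (hw.2.le.trans ht.2))) ⟨hv0.le, hlew⟩
      have := hleast ⟨⟨ht₂.1, ht₂.2.trans (hw.2.le.trans ht.2)⟩, ht₂0⟩
      exact absurd (this.trans ht₂.2) (not_le.2 hw.2)
    have hut : u t ∈ Ioc 0 (u 0) :=
      ⟨hpos t ht.1, hanti t hbefore ⟨le_rfl, ht.1⟩ ⟨ht.1, le_rfl⟩ ht.1⟩
    have h1 := hG t ht.1 hut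
    rw [ht0] at h1
    have h2 := hGpos _ hut
    norm_num at h1
    linarith
  have hantiI : AntitoneOn u (Ici 0) := fun s hs t ht hst ↦
    hanti t (fun w hw ↦ hneg w hw.1) ⟨hs, hst⟩ ⟨ht, le_rfl⟩ hst
  have hmem : ∀ s, 0 ≤ s → u s ∈ Ioc 0 (u 0) := fun s hs ↦
    ⟨hpos s hs, hantiI (mem_Ici.2 le_rfl) hs hs⟩
  refine ⟨hmem, ?_⟩
  obtain ⟨l, hl⟩ : ∃ l, Tendsto u atTop (𝓝 l) := by
    -- Truncation at 0 extends the monotonicity from the half-line to all of `ℝ`.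
    have hmono : Antitone fun s ↦ u (max s 0) := fun s t hst ↦
      hantiI (mem_Ici.2 (le_max_right _ _)) (mem_Ici.2 (le_max_right _ _)) (max_le_max_right 0 hst)
    have hbdd : BddBelow (range fun s ↦ u (max s 0)) :=
      ⟨0, by rintro _ ⟨s, rfl⟩; exact (hpos _ (le_max_right _ _)).le⟩
    refine ⟨_, (tendsto_atTop_ciInf hmono hbdd).congr' ?_⟩
    filter_upwards [eventually_ge_atTop (0 : ℝ)] with s hs
    rw [max_eq_left hs]
  have hl0 : 0 ≤ l := ge_of_tendsto hl ((eventually_ge_atTop 0).mono fun s hs ↦ (hpos s hs).le)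
  have hlu : l ≤ u 0 := le_of_tendsto hl ((eventually_ge_atTop 0).mono fun s hs ↦ (hmem s hs).2)
  rcases hl0.eq_or_lt with h0 | hlpos
  · rwa [← h0] at hl
  exfalso
  have hGl := hGpos l ⟨hlpos, hlu⟩
  have hGt : Tendsto (fun s ↦ G (u s)) atTop (𝓝 (G l)) :=
    (hGc l ⟨hl0, hlu⟩).tendsto.comp (tendsto_nhdsWithin_iff.2
      ⟨hl, (eventually_ge_atTop 0).mono fun s hs ↦ Ioc_subset_Icc_self (hmem s hs)⟩)
  obtain ⟨s₀, hs₀⟩ := eventually_atTop.1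
    ((hGt.eventually_const_lt (half_lt_self hGl)).and (eventually_ge_atTop 0))
  -- At a positive limit the speed would eventually be at least `d`, so within the further time `u 0
  -- / d` the function `u` would cease to be positive.
  set d := √(G l / 2) with hd
  have hdpos : 0 < d := Real.sqrt_pos.2 (half_pos hGl)
  have hs₀0 : 0 ≤ s₀ := (hs₀ s₀ le_rfl).2
  have hvd : ∀ s, s₀ ≤ s → v s ≤ -d := by
    intro s hs
    obtain ⟨h1, h2⟩ := hs₀ s hs
    have h3 := hG s h2 (hmem s h2)
    have h4 : d ≤ |v s| := by
      rw [hd, ← Real.sqrt_sq_eq_abs]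
      exact Real.sqrt_le_sqrt (h1.le.trans h3)
    rw [abs_of_neg (hneg s h2)] at h4
    linarith
  have hlin : u (s₀ + u 0 / d) - u s₀ ≤ -d * (s₀ + u 0 / d - s₀) := by
    have hle : s₀ ≤ s₀ + u 0 / d := by
      have : 0 ≤ u 0 / d := by positivity
      linarith
    refine (convex_Icc s₀ (s₀ + u 0 / d)).image_sub_le_mul_sub_of_deriv_le
      (fun t ht ↦ (hu t (hs₀0.trans ht.1)).continuousAt.continuousWithinAt)
      (fun t ht ↦ ?_) (fun t ht ↦ ?_) s₀ ⟨le_rfl, hle⟩ _ ⟨hle, le_rfl⟩ hle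
    · rw [interior_Icc] at ht
      exact (hu t (hs₀0.trans ht.1.le)).differentiableAt.differentiableWithinAt
    · rw [interior_Icc] at ht
      rw [(hu t (hs₀0.trans ht.1.le)).deriv]
      exact hvd t ht.1.le
  have h1 : -d * (s₀ + u 0 / d - s₀) = -u 0 := by
    field_simp
    ring
  have h2 := hpos (s₀ + u 0 / d) (by have : 0 ≤ u 0 / d := by positivity
                                     linarith)
  have h3 := (hmem s₀ hs₀0).2
  linarith

variable {M : Type*} [TopologicalSpace M] [ChartedSpace E4 M] [IsManifold (𝓡 4) ∞ M]

namespace Observer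

variable {S : AxiStationary M} {F : Foliation S}
  {K : ∀ x : M, T x →L[ℝ] T x →L[ℝ] ℝ} {α : M → ℝ} {γ : Fin 2 → Fin 2 → M → ℝ} {Ψ : M → ℝ}
  {β : ∀ x : M, T x →L[ℝ] ℝ} {m : M → ℝ} {x : M} {q ρ : Fin 2 → ℝ} {Θ Φ ε : ℝ} {O : Observer F m}
  {p : ℝ → M} {J : Set ℝ} {c : ℝ → M} {I : Set ℝ}

section asymptotics

variable (h : F.IsReduced K α γ Ψ β m) (hm : 0 ≤ m O.pt) (hF : F.CompactSections)
  (hp : O.IsNormalCurve p J) {r : ℝ} (hr : r ∈ J)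
include h hm hF hp hr

/-- A captured particle, moving (in the time direction `σ`) from the slice on which the kinetic
term vanishes and not shielded from it, is asymptotically tangent to this slice. -/
theorem IsCaptured.tendsto (hc : O.IsCaptured Θ Φ c I)
    (hmps : F.IsMassiveParticleSurface m r (O.q Θ Φ))
    (hS : quad (O.shadowMatrix Ψ (p r)) (O.q Θ Φ) - quad (O.shadowMatrix Ψ O.pt) (O.q Θ Φ) =
      Real.exp (Ψ O.pt) * (O.momentum * Real.cos Θ) ^ 2)
    (hshield : ∀ t ∈ uIcc r (F.Ω O.pt), t ≠ r →
      quad (O.shadowMatrix Ψ (p t)) (O.q Θ Φ) < quad (O.shadowMatrix Ψ (p r)) (O.q Θ Φ))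
    {σ : ℝ} (hσ : σ = 1 ∨ σ = -1) (hI : ∀ s : ℝ, 0 ≤ s → σ * s ∈ I)
    (hdir : 0 < σ * ((F.Ω O.pt - r) * Real.cos Θ)) :
    Tendsto (fun s ↦ F.Ω (c (σ * s))) atTop (𝓝 r) ∧
    Tendsto (fun s ↦ S.g.val (c (σ * s)) (F.normal (c (σ * s))) (velocity c (σ * s)))
      atTop (𝓝 0) := by
  have hw := hc.worldline
  have hσ2 := sq_eq_one_of_sign hσ
  set d := F.Ω O.pt - r with hd
  have hd0 : d ≠ 0 := by
    intro h0
    rw [h0] at hdir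
    simp at hdir
  have hd2 : 0 < d ^ 2 := by positivity
  set w := fun t ↦ quad (O.shadowMatrix Ψ (p t)) (O.q Θ Φ) with hwdef
  have hrΩ := hp.subset_range hr
  have hsub : uIcc r (F.Ω O.pt) ⊆ J := hp.ordConnected.uIcc_subset hr hp.mem
  have hwc : ∀ t ∈ J, ContinuousAt w t := fun t ht ↦
    (hp.hasDerivAt h hm (O.v_dot_q Θ Φ) ht).continuousAt
  have hkin : ∀ s ∈ I, F.Ω (c s) ∈ J → F.kinetic Ψ c s = w r - w (F.Ω (c s)) := by
    intro s hs hsJ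
    rw [hc.kinetic_eq h hm hp hs hsJ]
    simp only [hwdef]
    linarith
  obtain ⟨B, hB0, hB⟩ := h.exists_weight_le hF
    (show min r (F.Ω O.pt) ∈ range F.Ω from hp.subset_range (hsub ⟨le_rfl, min_le_max⟩))
    (show max r (F.Ω O.pt) ∈ range F.Ω from hp.subset_range (hsub ⟨min_le_max, le_rfl⟩))
  obtain ⟨B', hB'⟩ := h.exists_exp_le hF
    (show min r (F.Ω O.pt) ∈ range F.Ω from hp.subset_range (hsub ⟨le_rfl, min_le_max⟩))
    (show max r (F.Ω O.pt) ∈ range F.Ω from hp.subset_range (hsub ⟨min_le_max, le_rfl⟩))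
  have hbetween : ∀ y ∈ Icc 0 (d ^ 2), r + y / d ∈ uIcc r (F.Ω O.pt) := by
    intro y hy
    have h1 : F.Ω O.pt = r + d := by rw [hd]; ring
    rw [h1]
    rcases hd0.lt_or_gt with hneg | hpos
    · rw [uIcc_of_ge (by linarith)]
      have h2 : y / d ≤ 0 := div_nonpos_of_nonneg_of_nonpos hy.1 hneg.le
      have h3 : d ≤ y / d := by
        rw [le_div_iff_of_neg hneg]
        linarith [hy.2]
      exact ⟨by linarith, by linarith⟩
    · rw [uIcc_of_le (by linarith)]
      have h2 : 0 ≤ y / d := div_nonneg hy.1 hpos.le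
      have h3 : y / d ≤ d := by
        rw [div_le_iff₀ hpos]
        linarith [hy.2]
      exact ⟨by linarith, by linarith⟩
  -- The signed distance to the slice times its initial value: it starts at `d²` and decreases
  -- initially, on whichever side the observer is.
  set u := fun s ↦ d * (F.Ω (c (σ * s)) - r) with hu
  set v := fun s ↦ d * (diff F.Ω (c (σ * s)) (velocity c (σ * s)) * σ) with hv
  have hΩu : ∀ s, F.Ω (c (σ * s)) = r + u s / d := fun s ↦ by
    simp only [hu]
    field_simp
    ring
  have hu0 : u 0 = d ^ 2 := by
    simp only [hu, mul_zero, hc.init_pt]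
    rw [← hd, sq]
  have hσd : ∀ s, HasDerivAt (fun s ↦ σ * s) σ s := fun s ↦ by
    simpa using (hasDerivAt_id s).const_mul σ
  have hud : ∀ s, 0 ≤ s → HasDerivAt u (v s) s := fun s hs ↦
    ((HasDerivAt.comp s (Foliation.hasDerivAt_Ω_worldline F hw (hI s hs)) (hσd s)).sub_const
      r).const_mul d
  have hvc : ∀ s, 0 ≤ s → ContinuousAt v s := by
    intro s hs
    have h1 := (S.g.hasDerivAt_field_velocity F.smooth_gradΩ
      (Foliation.contMDiffAt_worldline hw (hI s hs))).continuousAt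
    simp only [S.g.val_grad] at h1
    exact ((ContinuousAt.comp (f := fun s ↦ σ * s) h1 (hσd s).continuousAt).mul_const
      σ).const_mul d
  have hv0 : v 0 < 0 := by
    have h1 : F.lapse (c (σ * 0)) * diff F.Ω (c (σ * 0)) (velocity c (σ * 0)) =
        -(O.momentum * Real.cos Θ) := by
      rw [mul_zero]
      exact hc.lapse_mul_diff
    have h4 : F.lapse (c (σ * 0)) * v 0 = -(O.momentum * (σ * (d * Real.cos Θ))) := by
      simp only [hv]
      linear_combination d * σ * h1
    have h5 := neg_neg_of_pos (mul_pos (O.momentum_pos hm) hdir)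
    rw [← h4] at h5
    exact neg_of_mul_neg_right h5 (F.lapse_pos _).le
  -- On the slice the conservation law makes `kinetic` vanish, so contact would be tangential. The
  -- slice being a massive particle surface, it would contain the whole worldline, in particular the
  -- observer.
  have hne : ∀ s, 0 ≤ s → u s ≠ 0 := by
    intro s hs h0
    have h1 : F.Ω (c (σ * s)) = r := by rw [hΩu, h0, zero_div, add_zero]
    have h2 := hkin _ (hI s hs) (h1 ▸ hr)
    rw [h1, sub_self] at h2
    have h3 : diff F.Ω (c (σ * s)) (velocity c (σ * s)) = 0 :=
      pow_eq_zero_iff two_ne_zero |>.1 ((mul_eq_zero.1 h2).resolve_left (F.weight_pos _ _).ne')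
    have h4 : F.Ω (c 0) = r := hmps.2 c I (σ * s)
      ⟨hw, hI s hs, hc.conserved h (hI s hs), h1, h3⟩ 0 hc.zero_mem
    rw [hc.init_pt] at h4
    exact hd0 (by rw [hd, h4, sub_self])
  -- The lower bound `G` is the conserved relation `weight * dΩ(ċ)² = w r - w Ω`, with the weight
  -- replaced by its bound `B`; absence of shielding makes it positive.
  have hmain := tendsto_zero_of_energy (G := fun y ↦ d ^ 2 * (w r - w (r + y / d)) / B) hud hvc hne
    (hu0 ▸ hd2) hv0 ?_ ?_ ?_
  rotate_left
  · intro s hs hus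
    rw [hu0] at hus
    have h1 := hbetween _ (Ioc_subset_Icc_self hus)
    have h2 := hkin _ (hI s hs) (by rw [hΩu]; exact hsub h1)
    rw [hΩu] at h2
    have h3 := hB (c (σ * s)) (by rw [hΩu]; exact h1)
    change d ^ 2 * (w r - w (r + u s / d)) / B ≤ v s ^ 2
    rw [div_le_iff₀ hB0, ← h2]
    simp only [hv, Foliation.kinetic]
    have h4 := mul_le_mul_of_nonneg_right h3
      (mul_nonneg hd2.le (sq_nonneg (diff F.Ω (c (σ * s)) (velocity c (σ * s)))))
    have h5 : (d * (diff F.Ω (c (σ * s)) (velocity c (σ * s)) * σ)) ^ 2 =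
        d ^ 2 * diff F.Ω (c (σ * s)) (velocity c (σ * s)) ^ 2 := by
      rw [mul_pow, mul_pow, hσ2, mul_one]
    rw [h5]
    linarith
  · intro y hy
    rw [hu0] at hy
    have h1 := hwc _ (hsub (hbetween y hy))
    have h2 : ContinuousAt (fun y ↦ r + y / d) y := by fun_prop
    have h3 : ContinuousAt (fun y ↦ d ^ 2 * (w r - w (r + y / d)) / B) y :=
      (((ContinuousAt.comp (f := fun y ↦ r + y / d) h1 h2).const_sub (w r)).const_mul
        (d ^ 2)).div_const B
    exact h3.continuousWithinAt
  · intro y hy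
    rw [hu0] at hy
    have h1 := hshield _ (hbetween y (Ioc_subset_Icc_self hy)) (by
      have := div_ne_zero hy.1.ne' hd0
      intro h0
      exact this (by linarith))
    exact div_pos (mul_pos hd2 (sub_pos.2 h1)) hB0
  obtain ⟨hmem, hlim⟩ := hmain
  have hΩlim : Tendsto (fun s ↦ F.Ω (c (σ * s))) atTop (𝓝 r) := by
    simp only [hΩu]
    simpa using (hlim.div_const d).const_add r
  refine ⟨hΩlim, ?_⟩
  have hklim : Tendsto (fun s ↦ B' * (w r - w (F.Ω (c (σ * s))))) atTop (𝓝 0) := by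
    have h1 := (((hwc r hr).tendsto.comp hΩlim).const_sub (w r)).const_mul B'
    rwa [sub_self, mul_zero] at h1
  -- Dividing `kinetic` by `e^Ψ`, which is bounded away from zero on the shell, gives the normal
  -- velocity squared.
  have hsq : Tendsto (fun s ↦ (S.g.val (c (σ * s)) (F.normal (c (σ * s)))
      (velocity c (σ * s))) ^ 2) atTop (𝓝 0) := by
    refine squeeze_zero' (.of_forall fun s ↦ sq_nonneg _) ?_ hklim
    filter_upwards [eventually_ge_atTop (0 : ℝ)] with s hs
    have h1 := hbetween _ (hu0 ▸ Ioc_subset_Icc_self (hmem s hs))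
    rw [← hΩu] at h1
    have h2 := hkin _ (hI s hs) (hsub h1)
    have h3 := F.kinetic_nonneg Ψ c (σ * s)
    have h4 := mul_le_mul_of_nonneg_right (hB' _ h1).2 h3
    rw [← h2]
    refine le_trans (le_of_eq ?_) h4
    rw [Observer.kinetic_eq, ← mul_assoc, inv_mul_cancel₀ (Real.exp_pos _).ne', one_mul]
  have h1 := hsq.sqrt
  simp only [Real.sqrt_sq_eq_abs, Real.sqrt_zero] at h1
  exact (tendsto_zero_iff_abs_tendsto_zero _).2 h1

/-- The positions given by the formulas are boundary positions, unless shielded. -/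
theorem IsImpact.isBoundary (hρ : O.IsImpact Ψ (p r) ρ)
    (hA : 0 ≤ quad (O.shadowMatrix Ψ (p r) - O.shadowMatrix Ψ O.pt) ρ) (hε : ε = 1 ∨ ε = -1)
    (hang : O.AngleFormula Ψ (p r) ρ ε Θ Φ) :
    (∀ a, O.q Θ Φ a = -O.E * ρ a / (O.v ⬝ᵥ ρ)) ∧
      F.IsMassiveParticleSurface m r (O.q Θ Φ) ∧
      (r ≠ F.Ω O.pt →
        (∀ t ∈ uIcc r (F.Ω O.pt), t ≠ r →
          quad (O.shadowMatrix Ψ (p t)) ρ < quad (O.shadowMatrix Ψ (p r)) ρ) →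
        ∀ c I, O.IsCaptured Θ Φ c I →
          (Iic 0 ⊆ I → (F.Ω O.pt - r) * Real.cos Θ < 0 →
            F.AsymptoticallyTangent c r atBot ∧ O.IsBoundary r Θ Φ) ∧
          (Ici 0 ⊆ I → 0 < (F.Ω O.pt - r) * Real.cos Θ →
            F.AsymptoticallyTangent c r atTop ∧ O.IsBoundary r Θ Φ)) := by
  have hv := hρ.v_dot_ne_zero
  have hE := O.E_pos hm
  have hq := O.q_eq_of_sines hm hv hang.2
  have hmps : F.IsMassiveParticleSurface m r (O.q Θ Φ) := by
    have := hρ.isMassiveParticleSurface h hm (hp.offAxis h r hr)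
    rwa [hp.Ω_eq r hr, ← hq] at this
  refine ⟨fun a ↦ ?_, hmps, fun _ hshield c I hc ↦ ?_⟩
  · rw [hq, Pi.smul_apply, smul_eq_mul]
    ring
  -- The formula for `cos Θ`, squared and rescaled from `ρ` to `q`.
  have hS : quad (O.shadowMatrix Ψ (p r)) (O.q Θ Φ) - quad (O.shadowMatrix Ψ O.pt) (O.q Θ Φ) =
      Real.exp (Ψ O.pt) * (O.momentum * Real.cos Θ) ^ 2 := by
    have h1 := O.speed_pos.ne'
    have h2 := (O.momentum_pos hm).ne'
    have h3 := (Real.exp_pos (Ψ O.pt)).ne'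
    have h4 := hE.ne'
    rw [hang.1, hq, quad_smul, quad_smul, mul_pow, div_pow (ε * _), mul_pow ε, rootA_sq hA,
      sq_eq_one_of_sign hε, O.sqrt_one_sub_mE2 hm]
    field_simp
  have hshield' : ∀ t ∈ uIcc r (F.Ω O.pt), t ≠ r →
      quad (O.shadowMatrix Ψ (p t)) (O.q Θ Φ) < quad (O.shadowMatrix Ψ (p r)) (O.q Θ Φ) := by
    intro t ht htr
    rw [hq, quad_smul, quad_smul]
    have : 0 < (-O.E / (O.v ⬝ᵥ ρ)) ^ 2 :=
      lt_of_le_of_ne (sq_nonneg _) (pow_ne_zero 2 (div_ne_zero (neg_ne_zero.2 hE.ne') hv)).symm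
    exact mul_lt_mul_of_pos_left (hshield t ht htr) this
  refine ⟨fun hI hlt ↦ ?_, fun hI hlt ↦ ?_⟩
  · obtain ⟨h1, h2⟩ := hc.tendsto h hm hF hp hr hmps hS hshield' (σ := -1) (Or.inr rfl)
      (fun s hs ↦ hI (by simpa using hs)) (by linarith)
    have h3 : F.AsymptoticallyTangent c r atBot :=
      ⟨(h1.comp tendsto_neg_atBot_atTop).congr fun s ↦ congrArg (fun s ↦ F.Ω (c s)) (by ring),
        (h2.comp tendsto_neg_atBot_atTop).congr fun s ↦
          congrArg (fun s ↦ S.g.val (c s) (F.normal (c s)) (velocity c s)) (by ring)⟩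
    exact ⟨h3, hmps, c, I, hc, Or.inl ⟨hI, h3⟩⟩
  · obtain ⟨h1, h2⟩ := hc.tendsto h hm hF hp hr hmps hS hshield' (σ := 1) (Or.inl rfl)
      (fun s hs ↦ hI (by simpa using hs)) (by linarith)
    have h3 : F.AsymptoticallyTangent c r atTop :=
      ⟨h1.congr fun s ↦ congrArg (fun s ↦ F.Ω (c s)) (one_mul s), h2.congr fun s ↦
        congrArg (fun s ↦ S.g.val (c s) (F.normal (c s)) (velocity c s)) (one_mul s)⟩
    exact ⟨h3, hmps, c, I, hc, Or.inr ⟨hI, h3⟩⟩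

end asymptotics

end Observer

end

end ShadowGeometry

end

open ShadowGeometry in
theorem mainTheorem1 {M : Type*} [TopologicalSpace M] [T2Space M] [SecondCountableTopology M]
    [ChartedSpace E4 M] [IsManifold (𝓡 4) ∞ M]
    -- a stationary axisymmetric spacetime with a foliation whose slices have compact sections
    (S : AxiStationary M) (F : Foliation S) (hcompact : F.CompactSections)
    -- a slice-reducible (conformal or exact) Killing tensor and a mass function
    (K : ∀ x : M, T x →L[ℝ] T x →L[ℝ] ℝ) (α : M → ℝ) (γ : Fin 2 → Fin 2 → M → ℝ) (Ψ : M → ℝ)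
    (hK : F.IsSliceReducible K α γ Ψ)
    (m : M → ℝ) (hm : ∀ x, 0 ≤ m x) (hm_smooth : ContMDiff (𝓡 4) 𝓘(ℝ, ℝ) ∞ fun x ↦ m x ^ 2)
    (hint : F.Integrable K α Ψ m)
    -- a stationary observer and the observed energy
    (O : Observer F m) :
    -- the massive particle region
    (∀ x, S.OffAxis x → (x ∈ O.massiveParticleRegion ↔ ∃ ρ, O.IsImpact Ψ x ρ)) ∧
    -- the integral curve of the normals through the observer, parametrized by `Ω`
    (∀ (p : ℝ → M) (J : Set ℝ), IsOpen J → J.OrdConnected → F.Ω O.pt ∈ J →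
      p (F.Ω O.pt) = O.pt → IsMIntegralCurveOn p F.flow J →
      (∀ t ∈ J, p t ∈ F.slice t ∧ S.OffAxis (p t)) ∧
      -- every boundary position is given by the formulas
      (∀ c ∈ J, ∀ Θ ∈ Icc 0 Real.pi, ∀ Φ ∈ Icc 0 (2 * Real.pi), O.IsBoundary c Θ Φ →
        ∃ ρ, O.IsImpact Ψ (p c) ρ ∧
          0 ≤ quad (O.shadowMatrix Ψ (p c) - O.shadowMatrix Ψ O.pt) ρ ∧
          (∀ a, O.q Θ Φ a = -O.E * ρ a / (O.v ⬝ᵥ ρ)) ∧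
          ∃ ε : ℝ, (ε = 1 ∨ ε = -1) ∧ O.AngleFormula Ψ (p c) ρ ε Θ Φ ∧
            (Θ ≠ Real.pi → ∃ δ : ℝ, (δ = 1 ∨ δ = -1) ∧
              O.StereoFormula Ψ (p c) ρ ε δ (stereoX Θ Φ) (stereoY Θ Φ))) ∧
      -- conversely, for every impact vector with real square roots
      (∀ c ∈ J, ∀ ρ, O.IsImpact Ψ (p c) ρ →
        0 ≤ quad (O.shadowMatrix Ψ (p c) - O.shadowMatrix Ψ O.pt) ρ →
        ∀ ε : ℝ, (ε = 1 ∨ ε = -1) →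
        -- the formulas for `(Θ, Φ)` and for `(X, Y)` describe the same points
        (∀ X Y : ℝ, (∃ δ : ℝ, (δ = 1 ∨ δ = -1) ∧ O.StereoFormula Ψ (p c) ρ ε δ X Y) ↔
          ∃ Θ ∈ Ico 0 Real.pi, ∃ Φ ∈ Icc 0 (2 * Real.pi), X = stereoX Θ Φ ∧ Y = stereoY Θ Φ ∧
            O.AngleFormula Ψ (p c) ρ ε Θ Φ) ∧
        -- and these points are boundary positions, unless a turning point shields the slice
        ∀ Θ ∈ Icc 0 Real.pi, ∀ Φ ∈ Icc 0 (2 * Real.pi), O.AngleFormula Ψ (p c) ρ ε Θ Φ →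
          (∀ a, O.q Θ Φ a = -O.E * ρ a / (O.v ⬝ᵥ ρ)) ∧
          F.IsMassiveParticleSurface m c (O.q Θ Φ) ∧
          (c ≠ F.Ω O.pt →
            (∀ t ∈ uIcc c (F.Ω O.pt), t ≠ c →
              quad (O.shadowMatrix Ψ (p t)) ρ < quad (O.shadowMatrix Ψ (p c)) ρ) →
            ∀ β I, O.IsCaptured Θ Φ β I →
              (Iic 0 ⊆ I → (F.Ω O.pt - c) * Real.cos Θ < 0 →
                F.AsymptoticallyTangent β c atBot ∧ O.IsBoundary c Θ Φ) ∧
              (Ici 0 ⊆ I → 0 < (F.Ω O.pt - c) * Real.cos Θ →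
                F.AsymptoticallyTangent β c atTop ∧ O.IsBoundary c Θ Φ)))) := by
  obtain ⟨β, h⟩ := hint.exists_isReduced hK hm_smooth
  have hmO := hm O.pt
  refine ⟨fun x hx ↦ O.mem_massiveParticleRegion_iff h hmO hx, fun p J hJo hJ hmem hp0 hp ↦ ?_⟩
  have hn : O.IsNormalCurve p J :=
    ⟨hJo, hJ, hmem, hp0, hasMFDerivAt_of_isMIntegralCurveOn hJo hp⟩
  refine ⟨fun t ht ↦ ⟨hn.Ω_eq t ht, hn.offAxis h t ht⟩,
    fun c hc Θ hΘ Φ _ hb ↦ Observer.exists_impact_of_isBoundary h hmO hcompact hn hc hΘ hb,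
    fun c hc ρ hρ hA ε hε ↦ ⟨fun X Y ↦ hρ.stereo_iff hmO hA hε X Y, fun Θ _ Φ _ hang ↦
      hρ.isBoundary h hmO hcompact hn hc hA hε hang⟩⟩
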